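/- **Theorem 4.** Let $V$ be a finite set of cities, $s,t\in V$ with $s\neq t$, and let $E$ be the edge set of the complete graph on $V$. For $U\subseteq V$ let $\delta(U)\subseteq E$ be the set of edges with exactly one endpoint in $U$, write $\delta(v):=\delta(\{v\})$, and for $x\in\mathbb{R}^E$ and $F\subseteq E$ let $x(F):=\sum_{e\in F}x_e$; $\chi^F\in\{0,1\}^E$ is the characteristic vector of $F$. Let $x^*\in\mathbb{R}_{\ge 0}^E$ be a feasible solution of the natural $s$-$t$-path TSP relaxation, i.e. for all $\emptyset\ne U\subsetneq V$, $x^*(\delta(U))\ge 2$ if $|U\cap\{s,t\}|$ is even and $x^*(\delta(U))\ge 1$ if $|U\cap\{s,t\}|$ is odd; $x^*(\delta(v))=2$ for $v\in V\setminus\{s,t\}$; and $x^*(\delta(s))=x^*(\delta(t))=1$. Call $C=\delta(U)$ with $\emptyset\neq U\subsetneq V$ a *narrow cut* if $x^*(C)<2$. Let $\epsilon\ge 0$ and let $S_1,\ldots,S_r\subseteq E$ be edge sets of spanning trees on $V$ such that $x=\frac1r\sum_{j=1}^r\chi^{S_j}$ satisfies $x(\delta(s))=x(\delta(t))=1$ and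 $x^*(F)-\epsilon\le x(F)\le x^*(F)+\epsilon$ for all $F\subseteq E$. Then there are edge sets $\hat S_1,\ldots,\hat S_r$ of spanning trees on $V$ such that $x=\frac1r\sum_{j=1}^r\chi^{\hat S_j}$ and for every narrow cut $C$ there exists an $h\in\{0,1,\ldots,r\}$ with $\frac hr\ge 2-x^*(C)-\epsilon$ and $|C\cap\hat S_j|=1$ for all $j=1,\ldots,h$. Moreover, there is an algorithm that, given $V$, $s$, $t$, $S_1,\ldots,S_r$ and rational $x^*$ and $\epsilon$ as above, computes such $\hat S_1,\ldots,\hat S_r$ in time polynomial in the length of the input (numbers being written in binary). -/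

import Mathlib

/-! ### Cuts, spanning trees and the linear program -/

namespace PathTSP

section Graph

variable {V : Type*} [Fintype V] [DecidableEq V]

/-- The edge set `E` of the complete graph on `V`. -/
def edges (V : Type*) [Fintype V] [DecidableEq V] : Finset (Sym2 V) :=
  (⊤ : SimpleGraph V).edgeFinset

/-- The cut `δ(U)`: all edges with exactly one endpoint in `U`. -/
def cut (U : Finset V) : Finset (Sym2 V) :=
  Finset.univ.filter fun e => ∃ u ∈ U, ∃ v ∉ U, e = s(u, v)

/-- `S ⊆ E` is the edge set of a spanning tree of the complete graph on `V`. -/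
def IsSpanningTree (S : Finset (Sym2 V)) : Prop :=
  S ⊆ edges V ∧ (SimpleGraph.fromEdgeSet (S : Set (Sym2 V))).IsTree

/-- `x(F) = ∑_{e ∈ F} x_e`. Vectors indexed by `E` are written as functions on `Sym2 V`;
the values on loops `s(v, v)` are never used. -/
def weight (x : Sym2 V → ℝ) (F : Finset (Sym2 V)) : ℝ := ∑ e ∈ F, x e

/-- Feasible solutions of the linear programming relaxation of the `s`-`t`-path TSP. -/
structure IsFeasible (s t : V) (x : Sym2 V → ℝ) : Prop where
  even_cut : ∀ U : Finset V, U.Nonempty → U ≠ Finset.univ →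
    Even (U ∩ {s, t}).card → 2 ≤ weight x (cut U)
  odd_cut : ∀ U : Finset V, U.Nonempty → U ≠ Finset.univ →
    Odd (U ∩ {s, t}).card → 1 ≤ weight x (cut U)
  degree : ∀ v : V, v ≠ s → v ≠ t → weight x (cut {v}) = 2
  degree_s : weight x (cut {s}) = 1
  degree_t : weight x (cut {t}) = 1
  nonneg : ∀ e ∈ edges V, 0 ≤ x e

/-- The narrow cuts of `x`: the cuts `δ(U)`, `∅ ≠ U ⊊ V`, with `x(δ(U)) < 2`. -/
def narrowCuts (x : Sym2 V → ℝ) : Set (Finset (Sym2 V)) :=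
  {C | (∃ U : Finset V, U.Nonempty ∧ U ≠ Finset.univ ∧ C = cut U) ∧ weight x C < 2}

/-- The vector `(1/r) ∑_j χ^{S_j}`. -/
noncomputable def average {r : ℕ} (S : Fin r → Finset (Sym2 V)) : Sym2 V → ℝ :=
  fun e => (1 / (r : ℝ)) * ∑ j, if e ∈ S j then 1 else 0

/-- The given data: a feasible solution `xstar`, a number `ε ≥ 0`, and spanning trees
`S_1, …, S_r` whose average `x` satisfies `x(δ(s)) = x(δ(t)) = 1` and is `ε`-close to `xstar` on
every edge set. (The equations force `r ≥ 1`.) -/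
structure IsInput (s t : V) {r : ℕ} (S : Fin r → Finset (Sym2 V)) (xstar : Sym2 V → ℝ)
    (ε : ℝ) : Prop where
  ne : s ≠ t
  eps_nonneg : 0 ≤ ε
  feasible : IsFeasible s t xstar
  tree : ∀ j, IsSpanningTree (S j)
  degree_s : weight (average S) (cut {s}) = 1
  degree_t : weight (average S) (cut {t}) = 1
  close : ∀ F ⊆ edges V, weight xstar F - ε ≤ weight (average S) F ∧
    weight (average S) F ≤ weight xstar F + ε

/-- The required output: spanning trees `Ŝ_1, …, Ŝ_r` with the same average such that for every
narrow cut `C` there is `h ≤ r` with `h / r ≥ 2 - xstar(C) - ε` for which each of the first `h`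
trees has exactly one edge in `C`. -/
structure IsOutput {r : ℕ} (S : Fin r → Finset (Sym2 V)) (xstar : Sym2 V → ℝ) (ε : ℝ)
    (Shat : Fin r → Finset (Sym2 V)) : Prop where
  tree : ∀ j, IsSpanningTree (Shat j)
  average_eq : average Shat = average S
  gao : ∀ C ∈ narrowCuts xstar, ∃ h : ℕ, h ≤ r ∧ (h : ℝ) / (r : ℝ) ≥ 2 - weight xstar C - ε ∧
    ∀ j : Fin r, (j : ℕ) < h → (C ∩ Shat j).card = 1

end Graph

/-! ### A machine model with a running time

List-processing programs on finite binary trees whose leaves are integers. Costs are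
logarithmic: the size of an integer is its number of binary digits, and every elementary operation
costs the total size of the data that it reads and writes. Hence the running time is, up to
a polynomial, the number of steps of a Turing machine. -/

/-- Data: integers and pairs. -/
inductive Data : Type
  | int (z : ℤ)
  | pair (a b : Data)
  deriving DecidableEq

/-- The number of bits (up to a constant factor) needed to write down `d`. -/
def Data.size : Data → ℕ
  | .int z => 1 + z.natAbs.size
  | .pair a b => 1 + a.size + b.size

/-- Elementary operations. -/
inductive Op : Type
  | copy | const (z : ℤ) | fst | snd | add | mul | le | eq | isPair

/-- The truth values are the integers `1` and `0`. -/
def Data.ofBool (b : Bool) : Data := .int (if b then 1 else 0)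

/-- The result of an elementary operation (`0` on arguments of the wrong shape). -/
def Op.eval : Op → Data → Data
  | .copy, d => d
  | .const z, _ => .int z
  | .fst, .pair a _ => a
  | .snd, .pair _ b => b
  | .add, .pair (.int y) (.int z) => .int (y + z)
  | .mul, .pair (.int y) (.int z) => .int (y * z)
  | .le, .pair (.int y) (.int z) => .ofBool (decide (y ≤ z))
  | .eq, .pair a b => .ofBool (decide (a = b))
  | .isPair, .pair _ _ => .ofBool true
  | _, _ => .int 0

/-- Programs; each of them transforms one datum into another one. -/
inductive Prog : Type
  /-- an elementary operation -/
  | op (o : Op)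
  /-- apply both programs to the input and pair up the results -/
  | pair (p q : Prog)
  /-- first `p`, then `q` -/
  | seq (p q : Prog)
  /-- if the result of `c` is not `0`, then `p`, else `q` -/
  | ite (c p q : Prog)
  /-- while the result of `c` is not `0`, apply `p` -/
  | while (c p : Prog)

/-- `Runs p d e m`: on input `d`, program `p` halts with output `e`, in time `m`. A composite
program is charged for all its parts and one more step; each part has already been charged at least
the size of its input and of its output, which pays for copying them. -/
inductive Runs : Prog → Data → Data → ℕ → Prop
  | op (o : Op) (d : Data) : Runs (.op o) d (o.eval d) (d.size + (o.eval d).size)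
  | pair {p q : Prog} {d a b : Data} {m k : ℕ} :
      Runs p d a m → Runs q d b k → Runs (.pair p q) d (.pair a b) (m + k + 1)
  | seq {p q : Prog} {d e f : Data} {m k : ℕ} :
      Runs p d e m → Runs q e f k → Runs (.seq p q) d f (m + k + 1)
  | iteTrue {c p q : Prog} {d v e : Data} {m k : ℕ} :
      Runs c d v m → v ≠ .int 0 → Runs p d e k → Runs (.ite c p q) d e (m + k + 1)
  | iteFalse {c p q : Prog} {d e : Data} {m k : ℕ} :
      Runs c d (.int 0) m → Runs q d e k → Runs (.ite c p q) d e (m + k + 1)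
  | whileStop {c p : Prog} {d : Data} {m : ℕ} :
      Runs c d (.int 0) m → Runs (.while c p) d d (m + d.size + 1)
  | whileStep {c p : Prog} {d v e f : Data} {m k l : ℕ} :
      Runs c d v m → v ≠ .int 0 → Runs p d e k → Runs (.while c p) e f l →
        Runs (.while c p) d f (m + k + l + 1)

/-- The search problem "given `a` with `valid a`, find `b` with `sol a b`" is solvable in polynomial
time: one program finds, for every valid `a`, a solution in a number of steps that is bounded by
a fixed polynomial in the size of the encoding of `a`. -/
def SolvableInPolyTime {α : Type} {β : α → Type} (encIn : α → Data) (encOut : ∀ a, β a → Data)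
    (valid : α → Prop) (sol : ∀ a, β a → Prop) : Prop :=
  ∃ (p : Prog) (P : Polynomial ℕ), ∀ a, valid a →
    ∃ (b : β a) (m : ℕ), Runs p (encIn a) (encOut a b) m ∧ m ≤ P.eval (encIn a).size ∧ sol a b

/-! ### The encoding of the given trees, vectors and numbers -/

/-- Lists are nested pairs that end with `0`. -/
def Data.list : List Data → Data
  | [] => .int 0
  | a :: l => .pair a (Data.list l)

/-- A fraction is the pair of its numerator and its denominator. -/
def Data.rat (q : ℚ) : Data := .pair (.int q.num) (.int q.den)

/-- A square matrix is the list of its rows. -/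
def Data.matrix {n : ℕ} (f : Fin n → Fin n → Data) : Data :=
  .list (List.ofFn fun i => .list (List.ofFn fun j => f i j))

/-- A set of edges on the vertex set `Fin n` is written as its adjacency matrix. -/
def Data.edgeSet {n : ℕ} (S : Finset (Sym2 (Fin n))) : Data :=
  .matrix fun i j => .ofBool (decide (s(i, j) ∈ S))

/-- The list of the edge sets `S_1, …, S_r`. -/
def Data.edgeSets {n r : ℕ} (S : Fin r → Finset (Sym2 (Fin n))) : Data :=
  .list (List.ofFn fun j => .edgeSet (S j))

/-- A vector indexed by the edges is written as a symmetric matrix with zero diagonal. -/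
def Data.edgeVector {n : ℕ} (x : Sym2 (Fin n) → ℚ) : Data :=
  .matrix fun i j => .rat (if i = j then 0 else x s(i, j))

/-- What the algorithm is given; the cities are `0, …, n - 1`. -/
structure Instance : Type where
  n : ℕ
  s : Fin n
  t : Fin n
  r : ℕ
  S : Fin r → Finset (Sym2 (Fin n))
  xstar : Sym2 (Fin n) → ℚ
  ε : ℚ

def Instance.encode (I : Instance) : Data :=
  .pair (.int I.n) (.pair (.int (I.s : ℕ)) (.pair (.int (I.t : ℕ))
    (.pair (.edgeSets I.S) (.pair (.edgeVector I.xstar) (.rat I.ε)))))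

end PathTSP

open PathTSP

/-! Number the trees from 0 and call a set U with s ∈ U ≠ V relevant for j if j < r(2 − x*(δ(U)) −
ε). It suffices that tree j crosses δ(U) exactly once for each U relevant for j: for a narrow cut,
taken on the side that contains s, the number h is then the ceiling of r(2 − x*(δ(U)) − ε), capped
at r. Every relevant cut weighs less than 2 − ε, so a relevant set omits t, and posimodularity makes
the relevant sets a chain (`Relevant.subset_or_subset`).

The trees are treated in order. Tree j only swaps single edges with later trees, so finished trees
stay as they are; a swap keeps both partners spanning trees and preserves the average
(`Reassembles.swap`). For fixed j the chain is climbed from {s}. Let K ⊂ L ⊂ M be consecutive, where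
K may be empty, and let S be the current tree j, which already connects L and L \ K, leaves L only
from L \ K, and crosses δ(L) once. Four phases give S, one after the other: connectedness inside M \
L; an edge between L \ K and M \ L; no edge between L and V \ M; a single edge in δ(M). No swapped
edge meets K, so cuts of subsets of K are untouched, and the first three properties force a single
edge in δ(L) again (`stage_spec`).

Each phase combines averaging with an exchange. By the constraints on x* and its ε-closeness to the
average, more than j trees have the property needed of a partner: connected on M \ L, connected on M
\ K, free of edges in δ(L) ∩ δ(M), or crossing δ(M) once. Only j trees precede tree j, so if tree j
fails, a later tree k has the property (`exists_later` and its applications). To exchange, remove a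
suitable edge pq from tree j and walk in tree k from p to q: the edge of this walk that enters the
side of q can replace pq, and pq can replace it (`IsSpanningTree.exchange`). In the first two phases
the edge received must lie inside a prescribed set Z, which needs the finer choice of pq in
`IsSpanningTree.exists_exchange`.

The algorithm is exhaustive local search. In each phase every admissible swap lowers an integer
potential that is at most |V|, so |V| sweeps over all candidate swaps suffice (`sweeps_spec`).
Relevant sets are found without enumerating subsets: some current tree crosses such a set once, so
the set is a side of a fundamental cut of that tree (`exists_side_eq`). The running time is
assembled from closure properties of polynomial-time computation, above all loops whose states stay
polynomially small (`Comp.foldl_of_polyBdd`). -/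

namespace PathTSP

set_option linter.unusedSectionVars false

/-! ### Spanning trees, fundamental cuts and the basic edge exchange -/

section Trees

variable {V : Type*} [Fintype V] [DecidableEq V]

/-- `v` can be reached from `u` along edges in `T`. -/
def Reach (T : Finset (Sym2 V)) : V → V → Prop :=
  Relation.ReflTransGen fun a b => s(a, b) ∈ T

/-- The edges with both endpoints in `Z`. -/
def inner (Z : Finset V) : Finset (Sym2 V) :=
  (edges V).filter fun e => ∀ v ∈ e, v ∈ Z

@[simp] theorem mem_edges {a b : V} : s(a, b) ∈ edges V ↔ a ≠ b := by
  simp [edges]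

@[simp] theorem mem_inner {Z : Finset V} {a b : V} :
    s(a, b) ∈ inner Z ↔ a ≠ b ∧ a ∈ Z ∧ b ∈ Z := by
  simp [inner]

@[simp] theorem mem_cut {U : Finset V} {a b : V} :
    s(a, b) ∈ cut U ↔ (a ∈ U ∧ b ∉ U) ∨ (b ∈ U ∧ a ∉ U) := by
  simp only [cut, Finset.mem_filter, Finset.mem_univ, true_and, Sym2.eq_iff]
  constructor
  · rintro ⟨u, hu, v, hv, ⟨rfl, rfl⟩ | ⟨rfl, rfl⟩⟩ <;> simp_all
  · rintro (⟨h1, h2⟩ | ⟨h1, h2⟩)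
    · exact ⟨a, h1, b, h2, Or.inl ⟨rfl, rfl⟩⟩
    · exact ⟨b, h1, a, h2, Or.inr ⟨rfl, rfl⟩⟩

theorem cut_subset_edges (U : Finset V) : cut U ⊆ edges V := by
  intro e
  induction e using Sym2.ind with | _ a b => ?_
  rw [mem_cut, mem_edges]
  rintro (⟨h1, h2⟩ | ⟨h1, h2⟩) rfl <;> exact h2 h1

theorem cut_compl (U : Finset V) : cut Uᶜ = cut U := by
  ext e
  induction e using Sym2.ind with | _ a b => ?_
  simp only [mem_cut, Finset.mem_compl]
  tauto

theorem inner_subset_edges (Z : Finset V) : inner Z ⊆ edges V := Finset.filter_subset _ _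

theorem inner_mono {Y Z : Finset V} (h : Y ⊆ Z) : inner Y ⊆ inner Z := by
  intro e
  induction e using Sym2.ind with | _ a b => ?_
  simp only [mem_inner]
  exact fun ⟨h1, h2, h3⟩ => ⟨h1, h h2, h h3⟩

theorem exists_of_mem_cut {U : Finset V} {e : Sym2 V} (h : e ∈ cut U) :
    ∃ a b, a ∈ U ∧ b ∉ U ∧ e = s(a, b) := by
  simp only [cut, Finset.mem_filter] at h
  obtain ⟨-, a, ha, b, hb, rfl⟩ := h
  exact ⟨a, b, ha, hb, rfl⟩

namespace Reach

variable {S T : Finset (Sym2 V)} {a b c : V}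

theorem refl (a : V) : Reach T a a := Relation.ReflTransGen.refl

theorem of_mem (h : s(a, b) ∈ T) : Reach T a b := Relation.ReflTransGen.single h

theorem trans (h : Reach T a b) (h' : Reach T b c) : Reach T a c := Relation.ReflTransGen.trans h h'

theorem symm (h : Reach T a b) : Reach T b a := by
  induction h with
  | refl => exact refl _
  | tail _ h ih => exact (of_mem (by rwa [Sym2.eq_swap])).trans ih

theorem mono (hST : S ⊆ T) (h : Reach S a b) : Reach T a b :=
  Relation.ReflTransGen.mono (fun _ _ h => hST h) _ _ h

/-- A property that is preserved along edges holds for everything that is reached. -/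
theorem induct {P : V → Prop} (h : Reach T a b) (ha : P a)
    (hs : ∀ x y, Reach T a x → P x → s(x, y) ∈ T → P y) : P b := by
  induction h with
  | refl => exact ha
  | tail h1 h2 ih => exact hs _ _ h1 ih h2

theorem iff_reachable :
    Reach T a b ↔ (SimpleGraph.fromEdgeSet (T : Set (Sym2 V))).Reachable a b := by
  rw [SimpleGraph.reachable_iff_reflTransGen]
  constructor
  · intro h
    induction h with
    | refl => exact .refl
    | @tail x y _ h2 ih =>
      by_cases hxy : x = y
      · exact hxy ▸ ih
      · exact ih.tail (by simpa [hxy] using h2)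
  · intro h
    refine Relation.ReflTransGen.mono ?_ _ _ h
    intro x y hxy
    simpa using hxy.1

end Reach

/-- Every edge set that connects `V` has at least `|V| - 1` elements. -/
theorem card_le_of_connected {T : Finset (Sym2 V)} [Nonempty V] (h : ∀ u v, Reach T u v) :
    Fintype.card V ≤ T.card + 1 := by
  have hc : (SimpleGraph.fromEdgeSet (T : Set (Sym2 V))).Connected :=
    ⟨fun u v => Reach.iff_reachable.1 (h u v)⟩
  have h1 := hc.card_vert_le_card_edgeSet_add_one
  rw [Nat.card_eq_fintype_card] at h1
  refine h1.trans (Nat.succ_le_succ ?_)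
  rw [Nat.card_coe_set_eq, ← Set.ncard_coe_finset]
  exact Set.ncard_le_ncard (by rw [SimpleGraph.edgeSet_fromEdgeSet]; exact Set.sdiff_subset)

theorem isSpanningTree_iff {T : Finset (Sym2 V)} : IsSpanningTree T ↔
    T ⊆ edges V ∧ Nonempty V ∧ (∀ u v, Reach T u v) ∧ T.card + 1 = Fintype.card V := by
  unfold IsSpanningTree
  refine and_congr_right fun hT => ?_
  rw [SimpleGraph.isTree_iff_connected_and_card]
  have hE : (SimpleGraph.fromEdgeSet (T : Set (Sym2 V))).edgeSet = T := by
    rw [SimpleGraph.edgeSet_fromEdgeSet, sdiff_eq_left, Set.disjoint_left]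
    intro e he
    have := hT he
    induction e using Sym2.ind with | _ a b => ?_
    simpa using this
  rw [Nat.card_coe_set_eq, hE, Set.ncard_coe_finset, Nat.card_eq_fintype_card, ← and_assoc]
  refine and_congr_left fun _ => ?_
  constructor
  · intro h
    exact ⟨h.nonempty, fun u v => Reach.iff_reachable.2 (h.preconnected u v)⟩
  · rintro ⟨h1, h2⟩
    exact ⟨fun u v => Reach.iff_reachable.1 (h2 u v)⟩

namespace IsSpanningTree

variable {S T : Finset (Sym2 V)}

theorem subset_edges (hT : IsSpanningTree T) : T ⊆ edges V := hT.1

theorem reach (hT : IsSpanningTree T) (u v : V) : Reach T u v := (isSpanningTree_iff.1 hT).2.2.1 u v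

theorem card_add_one (hT : IsSpanningTree T)
    : T.card + 1 = Fintype.card V := (isSpanningTree_iff.1 hT).2.2.2

theorem ne (hT : IsSpanningTree T) {a b : V} (h : s(a, b) ∈ T) : a ≠ b := mem_edges.1 (hT.1 h)

/-- Otherwise T without pq would still connect V, with one edge too few. -/
theorem not_reach_erase (hT : IsSpanningTree T)
    {p q : V} (h : s(p, q) ∈ T) : ¬ Reach (T.erase s(p, q)) p q := by
  intro hr
  have : Nonempty V := ⟨p⟩
  have h1 := card_le_of_connected (T := T.erase s(p, q)) fun u v => by
    refine (hT.reach u v).induct (P := fun x => Reach (T.erase s(p, q)) u x) (.refl _) ?_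
    intro x y _ hx hxy
    by_cases he : s(x, y) = s(p, q)
    · rcases Sym2.eq_iff.1 he with ⟨rfl, rfl⟩ | ⟨rfl, rfl⟩
      · exact hx.trans hr
      · exact hx.trans hr.symm
    · exact hx.trans (.of_mem (Finset.mem_erase.2 ⟨he, hxy⟩))
  rw [Finset.card_erase_of_mem h] at h1
  have h2 := hT.card_add_one
  have h3 := Finset.card_pos.2 ⟨_, h⟩
  omega

theorem reach_erase_or (hT : IsSpanningTree T) {p q : V} (h : s(p, q) ∈ T) (x : V) :
    Reach (T.erase s(p, q)) p x ∨ Reach (T.erase s(p, q)) q x := by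
  refine (hT.reach p x).induct (P := fun x => Reach (T.erase s(p, q)) p x ∨
    Reach (T.erase s(p, q)) q x) (Or.inl (.refl _)) ?_
  intro x y _ hx hxy
  by_cases he : s(x, y) = s(p, q)
  · rcases Sym2.eq_iff.1 he with ⟨rfl, rfl⟩ | ⟨rfl, rfl⟩
    · exact Or.inr (.refl _)
    · exact Or.inl (.refl _)
  · have := Reach.of_mem (Finset.mem_erase.2 ⟨he, hxy⟩)
    exact hx.imp (·.trans this) (·.trans this)

/-- A connected set of edges with at most as many edges as a spanning tree is one. -/
theorem of_card_le (hT : IsSpanningTree T)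
    (hS : S ⊆ edges V) (hc : ∀ u v, Reach S u v) (hle : S.card ≤ T.card) :
    IsSpanningTree S := by
  have hn := (isSpanningTree_iff.1 hT).2.1
  have h1 := card_le_of_connected hc
  have h2 := hT.card_add_one
  exact isSpanningTree_iff.2 ⟨hS, hn, hc, by omega⟩

/-- Removing pq leaves only the components of p and q, so joining p to q again joins everything. -/
theorem reach_of_reach_insert_erase (hT : IsSpanningTree T) {p q : V} {e : Sym2 V} (h : s(p, q) ∈ T)
    (hr : Reach (insert e (T.erase s(p, q))) p q) (u v : V) :
    Reach (insert e (T.erase s(p, q))) u v := by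
  have key : ∀ x, Reach (insert e (T.erase s(p, q))) p x := fun x => by
    rcases hT.reach_erase_or h x with hx | hx
    · exact hx.mono (Finset.subset_insert _ _)
    · exact hr.trans (hx.mono (Finset.subset_insert _ _))
  exact (key u).symm.trans (key v)

theorem insert_erase (hT : IsSpanningTree T) {e f : Sym2 V} (he : e ∈ edges V) (hf : f ∈ T)
    (hc : ∀ u v, Reach (insert e (T.erase f)) u v) : IsSpanningTree (insert e (T.erase f)) := by
  refine hT.of_card_le ?_ hc ?_
  · exact Finset.insert_subset he ((Finset.erase_subset _ _).trans hT.1)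
  · refine (Finset.card_insert_le _ _).trans ?_
    rw [Finset.card_erase_of_mem hf]
    have := Finset.card_pos.2 ⟨_, hf⟩
    omega

/-- If e were already in T, the new set would be T without f, too small to connect V. Hence a swap
never merges two copies of an edge, which is why it preserves the average. -/
theorem notMem_of_connected_insert_erase (hT : IsSpanningTree T)
    {e f : Sym2 V} (hf : f ∈ T) (hef : e ≠ f)
    (hc : ∀ u v, Reach (insert e (T.erase f)) u v) : e ∉ T := by
  intro he
  have hn := (isSpanningTree_iff.1 hT).2.1
  have h1 := card_le_of_connected hc
  have h2 := hT.card_add_one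
  rw [Finset.insert_eq_of_mem (Finset.mem_erase.2 ⟨hef, he⟩), Finset.card_erase_of_mem hf] at h1
  have := Finset.card_pos.2 ⟨_, hf⟩
  omega

/-- The basic exchange: `f = pq` splits `T` into two sides, and `e = ab` crosses between them on
the way from `p` to `q` in `S`. -/
theorem exchange (hT : IsSpanningTree T)
    (hS : IsSpanningTree S) {p q a b : V} (hf : s(p, q) ∈ T) (he : s(a, b) ∈ S)
    (ha : ¬ Reach (T.erase s(p, q)) q a) (hb : Reach (T.erase s(p, q)) q b)
    (hpa : Reach (S.erase s(a, b)) p a) (hbq : Reach (S.erase s(a, b)) b q) :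
    (∀ u v, Reach (insert s(a, b) (T.erase s(p, q))) u v) ∧
      ∀ u v, Reach (insert s(p, q) (S.erase s(a, b))) u v := by
  constructor
  · apply hT.reach_of_reach_insert_erase hf
    have h1 := (hT.reach_erase_or hf a).resolve_right ha
    exact ((h1.mono (Finset.subset_insert _ _)).trans
      (.of_mem (Finset.mem_insert_self _ _))).trans (hb.symm.mono (Finset.subset_insert _ _))
  · apply hS.reach_of_reach_insert_erase he
    exact ((hpa.symm.mono (Finset.subset_insert _ _)).trans
      (.of_mem (Finset.mem_insert_self _ _))).trans (hbq.symm.mono (Finset.subset_insert _ _))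

/-- Edge sets of a tree inside two vertex sets are small. -/
theorem card_add_two_le (hT : IsSpanningTree T)
    {I : Finset (Sym2 V)} (hI : I ⊆ T) {Y Z : Finset V} (hY : Y.Nonempty)
    (hZ : Z.Nonempty) (h : ∀ e ∈ I, e ∈ inner Y ∨ e ∈ inner Z) : I.card + 2 ≤ Y.card + Z.card := by
  obtain ⟨y, hy⟩ := hY
  obtain ⟨z, hz⟩ := hZ
  have : Nonempty V := ⟨y⟩
  -- Replacing I by a star on Y and a star on Z keeps V connected; comparing the number of edges
  -- with |V| − 1 gives the bound.
  set A := (Y.erase y).image fun x => s(y, x)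
  set B := (Z.erase z).image fun x => s(z, x)
  have hA : A.card ≤ Y.card - 1 := Finset.card_image_le.trans (by rw [Finset.card_erase_of_mem hy])
  have hB : B.card ≤ Z.card - 1 := Finset.card_image_le.trans (by rw [Finset.card_erase_of_mem hz])
  have rA : ∀ x ∈ Y, Reach ((T \ I) ∪ (A ∪ B)) y x := fun x hx => by
    by_cases hxy : x = y
    · exact hxy ▸ .refl _
    · exact .of_mem (Finset.mem_union_right _ (Finset.mem_union_left _
        (Finset.mem_image_of_mem _ (Finset.mem_erase.2 ⟨hxy, hx⟩))))
  have rB : ∀ x ∈ Z, Reach ((T \ I) ∪ (A ∪ B)) z x := fun x hx => by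
    by_cases hxy : x = z
    · exact hxy ▸ .refl _
    · exact .of_mem (Finset.mem_union_right _ (Finset.mem_union_right _
        (Finset.mem_image_of_mem _ (Finset.mem_erase.2 ⟨hxy, hx⟩))))
  have hc := card_le_of_connected (T := (T \ I) ∪ (A ∪ B)) fun u v => by
    refine (hT.reach u v).induct (P := fun x => Reach ((T \ I) ∪ (A ∪ B)) u x) (.refl _) ?_
    intro c d _ hr hcd
    refine hr.trans ?_
    by_cases he : s(c, d) ∈ I
    · rcases h _ he with h | h <;> rw [mem_inner] at h
      · exact (rA c h.2.1).symm.trans (rA d h.2.2)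
      · exact (rB c h.2.1).symm.trans (rB d h.2.2)
    · exact .of_mem (Finset.mem_union_left _ (Finset.mem_sdiff.2 ⟨hcd, he⟩))
  have h1 := Finset.card_union_le (T \ I) (A ∪ B)
  have h2 := Finset.card_union_le A B
  have h3 := Finset.card_sdiff_add_card_eq_card hI
  have h4 := hT.card_add_one
  have h5 := Finset.card_pos.2 ⟨y, hy⟩
  have h6 := Finset.card_pos.2 ⟨z, hz⟩
  omega

end IsSpanningTree

/-- `T` connects the vertices in `Z` by edges inside `Z`. -/
def ConnOn (T : Finset (Sym2 V)) (Z : Finset V) : Prop :=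
  ∀ u ∈ Z, ∀ v ∈ Z, Reach (T ∩ inner Z) u v

namespace IsSpanningTree

variable {S T : Finset (Sym2 V)}

theorem card_inner_add_one_le (hT : IsSpanningTree T) {Z : Finset V} (hZ : Z.Nonempty) :
    (T ∩ inner Z).card + 1 ≤ Z.card := by
  obtain ⟨z, hz⟩ := hZ
  -- The second vertex set is a dummy singleton, which contributes 1 to the right-hand side.
  have := hT.card_add_two_le (I := T ∩ inner Z) Finset.inter_subset_left ⟨z, hz⟩
    (Finset.singleton_nonempty z) fun e he => Or.inl (Finset.mem_inter.1 he).2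
  simpa using this

/-- Split Z into the vertices reached from u inside Z and the rest. Both parts are nonempty and no
edge of T inside Z joins them, so the bound for two vertex sets applies. -/
theorem card_inner_add_two_le (hT : IsSpanningTree T) {Z : Finset V} (h : ¬ ConnOn T Z) :
    (T ∩ inner Z).card + 2 ≤ Z.card := by
  classical
  unfold ConnOn at h
  push Not at h
  obtain ⟨u, hu, v, hv, huv⟩ := h
  have h1 := hT.card_add_two_le (I := T ∩ inner Z) Finset.inter_subset_left
    (Y := Z.filter fun x => Reach (T ∩ inner Z) u x)
    (Z := Z.filter fun x => ¬ Reach (T ∩ inner Z) u x)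
    ⟨u, by simp [hu, Reach.refl]⟩ ⟨v, by simp [hv, huv]⟩ (by
      intro e
      induction e using Sym2.ind with | _ a b => ?_
      intro he
      obtain ⟨h1, h2⟩ := Finset.mem_inter.1 he
      rw [mem_inner] at h2
      simp only [mem_inner, Finset.mem_filter, h2.1, h2.2, true_and, ne_eq, not_false_eq_true]
      by_cases ha : Reach (T ∩ inner Z) u a
      · exact Or.inl ⟨ha, ha.trans (.of_mem he)⟩
      · refine Or.inr ⟨ha, fun hb => ha (hb.trans (.of_mem ?_))⟩
        rwa [Sym2.eq_swap])
  rwa [Finset.card_filter_add_card_filter_not] at h1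

/-- A spanning tree crosses every cut. -/
theorem one_le_card_cut (hT : IsSpanningTree T)
    {U : Finset V} (h1 : U.Nonempty) (h2 : U ≠ Finset.univ) :
    1 ≤ (T ∩ cut U).card := by
  obtain ⟨u, hu⟩ := h1
  obtain ⟨v, hv⟩ : ∃ v, v ∉ U := by
    by_contra! h
    exact h2 (Finset.eq_univ_iff_forall.2 h)
  by_contra! h
  have h0 : T ∩ cut U = ∅ := by simpa using h
  refine hv ((hT.reach u v).induct hu fun x y _ hx hxy => ?_)
  by_contra hy
  have : s(x, y) ∈ T ∩ cut U := Finset.mem_inter.2 ⟨hxy, by simp [hx, hy]⟩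
  simp [h0] at this

/-- No edge other than pq crosses δ(U), so a component of T − pq cannot leave U or enter it. Thus U
is a side of a fundamental cut of T, which makes such sets easy to find. -/
theorem side_eq (hT : IsSpanningTree T)
    {U : Finset V} {p q : V} (h : T ∩ cut U = {s(p, q)}) (hp : p ∈ U) (x : V) :
    Reach (T.erase s(p, q)) p x ↔ x ∈ U := by
  have hpq : s(p, q) ∈ T ∩ cut U := h ▸ Finset.mem_singleton_self _
  have hq : q ∉ U := by
    have := (Finset.mem_inter.1 hpq).2
    rw [mem_cut] at this
    tauto
  have hcl : ∀ x y, s(x, y) ∈ T.erase s(p, q) → (x ∈ U ↔ y ∈ U) := by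
    intro x y hxy
    rw [Finset.mem_erase] at hxy
    by_contra hc
    have : s(x, y) ∈ T ∩ cut U := Finset.mem_inter.2 ⟨hxy.2, by rw [mem_cut]; tauto⟩
    rw [h, Finset.mem_singleton] at this
    exact hxy.1 this
  constructor
  · exact fun h => h.induct hp fun x y _ hx hxy => (hcl x y hxy).1 hx
  · intro hx
    refine (hT.reach_erase_or (Finset.mem_inter.1 hpq).1 x).resolve_right fun h => ?_
    exact h.induct (P := fun x => x ∉ U) hq (fun x y _ hx hxy hy => hx ((hcl x y hxy).2 hy)) hx

theorem connOn_of_cut_eq (hT : IsSpanningTree T)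
    {U : Finset V} {p q : V} (h : T ∩ cut U = {s(p, q)}) (hp : p ∈ U) :
    ConnOn T U := by
  have key : ∀ x ∈ U, Reach (T ∩ inner U) p x := by
    intro x hx
    have hr := (hT.side_eq h hp x).2 hx
    have := hr.induct (P := fun x => x ∈ U ∧ Reach (T ∩ inner U) p x) ⟨hp, .refl _⟩ (by
      rintro x y hx0 ⟨hx, hr⟩ hxy
      have hy : y ∈ U := (hT.side_eq h hp y).1 (hx0.trans (.of_mem hxy))
      have hT' := (Finset.mem_erase.1 hxy).2
      exact ⟨hy, hr.trans (.of_mem (Finset.mem_inter.2 ⟨hT', by simp [hT.ne hT', hx, hy]⟩))⟩)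
    exact this.2
  exact fun u hu v hv => (key u hu).symm.trans (key v hv)

theorem connOn_compl_of_cut_eq (hT : IsSpanningTree T)
    {U : Finset V} {p q : V} (h : T ∩ cut U = {s(p, q)}) (hp : p ∈ U) :
    ConnOn T Uᶜ := by
  have hpq : s(p, q) ∈ cut U := (Finset.mem_inter.1 (h ▸ Finset.mem_singleton_self _)).2
  rw [← cut_compl, Sym2.eq_swap] at h
  refine hT.connOn_of_cut_eq h ?_
  rw [mem_cut] at hpq
  rw [Finset.mem_compl]
  tauto

end IsSpanningTree

theorem cut_eq_of_card_eq_one {T : Finset (Sym2 V)} {U : Finset V} (h : (T ∩ cut U).card = 1) :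
    ∃ p q, p ∈ U ∧ q ∉ U ∧ T ∩ cut U = {s(p, q)} := by
  obtain ⟨e, he⟩ := Finset.card_eq_one.1 h
  have : e ∈ cut U := (Finset.mem_inter.1 (he ▸ Finset.mem_singleton_self _)).2
  obtain ⟨a, b, ha, hb, rfl⟩ := exists_of_mem_cut this
  exact ⟨a, b, ha, hb, he⟩

/-- A trail from outside `K` into `K` has an edge that enters `K`. -/
theorem exists_crossing {T : Finset (Sym2 V)} {K : V → Prop} {p q : V} (h : Reach T p q)
    (hp : ¬ K p) (hq : K q) : ∃ a b, ¬ K a ∧ K b ∧ s(a, b) ∈ T ∧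
      Reach (T.erase s(a, b)) p a ∧ Reach (T.erase s(a, b)) b q := by
  rw [Reach.iff_reachable] at h
  obtain ⟨w, hw⟩ := h.exists_isPath
  -- Only the absence of repeated edges is needed: the first edge that enters K does not occur again
  -- on the remaining walk.
  replace hw := hw.isTrail
  clear h
  induction w with
  | nil => exact absurd hq hp
  | @cons x y z hxy w ih =>
    have hmem : s(x, y) ∈ T := by simpa using hxy.1
    rw [SimpleGraph.Walk.isTrail_cons] at hw
    by_cases hy : K y
    · refine ⟨x, y, hp, hy, hmem, .refl _, ?_⟩
      have key : ∀ {c d : V} (w : (SimpleGraph.fromEdgeSet (T : Set (Sym2 V))).Walk c d),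
          s(x, y) ∉ w.edges → Reach (T.erase s(x, y)) c d := by
        intro c d w
        induction w with
        | nil => exact fun _ => .refl _
        | @cons c c' d h w ih =>
          intro hn
          rw [SimpleGraph.Walk.edges_cons, List.mem_cons, not_or] at hn
          exact (Reach.of_mem (Finset.mem_erase.2 ⟨fun h => hn.1 h.symm, by simpa using h.1⟩)).trans
            (ih hn.2)
      exact key w hw.2
    · obtain ⟨a, b, ha, hb, hab, h1, h2⟩ := ih hy hq hw.1
      refine ⟨a, b, ha, hb, hab, (Reach.of_mem (Finset.mem_erase.2 ⟨?_, hmem⟩)).trans h1, h2⟩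
      intro he
      rcases Sym2.eq_iff.1 he with ⟨rfl, rfl⟩ | ⟨rfl, rfl⟩
      · exact hy hb
      · exact hp hb

end Trees

/-! ### Identities and inequalities for weights of cuts -/

section Weights

variable {V : Type*} [Fintype V] [DecidableEq V]

theorem weight_eq_sum_edges (x : Sym2 V → ℝ) {F : Finset (Sym2 V)} (hF : F ⊆ edges V) :
    weight x F = ∑ e ∈ edges V, x e * if e ∈ F then 1 else 0 := by
  simp only [weight, mul_ite, mul_one, mul_zero]
  rw [Finset.sum_ite_mem, Finset.inter_eq_right.2 hF]

/-- The cuts of two nested sets, the cut of their difference, and the edges that skip it. -/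
theorem weight_cut_add_weight_cut (x : Sym2 V → ℝ) {A B : Finset V} (h : A ⊆ B) :
    weight x (cut A) + weight x (cut B) =
      weight x (cut (B \ A)) + 2 * weight x (cut A ∩ cut B) := by
  rw [weight_eq_sum_edges x (cut_subset_edges A), weight_eq_sum_edges x (cut_subset_edges B),
    weight_eq_sum_edges x (cut_subset_edges (B \ A)),
    weight_eq_sum_edges x (Finset.inter_subset_left.trans (cut_subset_edges A)), Finset.mul_sum,
    ← Finset.sum_add_distrib, ← Finset.sum_add_distrib]
  refine Finset.sum_congr rfl fun e _ => ?_
  induction e using Sym2.ind with | _ a b => ?_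
  simp only [mem_cut, Finset.mem_inter, Finset.mem_sdiff]
  have ha := @h a
  have hb := @h b
  by_cases h1 : a ∈ A <;> by_cases h2 : a ∈ B <;> by_cases h3 : b ∈ A <;> by_cases h4 : b ∈ B <;>
    simp_all <;> ring

/-- Posimodularity, checked edge by edge: only edges between A ∩ B and the complement of A ∪ B are
lost on the left. -/
theorem weight_cut_sdiff_add_le {x : Sym2 V → ℝ} (hx : ∀ e ∈ edges V, 0 ≤ x e) (A B : Finset V) :
    weight x (cut (A \ B)) + weight x (cut (B \ A)) ≤ weight x (cut A) + weight x (cut B) := by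
  rw [weight_eq_sum_edges x (cut_subset_edges A), weight_eq_sum_edges x (cut_subset_edges B),
    weight_eq_sum_edges x (cut_subset_edges (B \ A)),
    weight_eq_sum_edges x (cut_subset_edges (A \ B)),
    ← Finset.sum_add_distrib, ← Finset.sum_add_distrib]
  refine Finset.sum_le_sum fun e he => ?_
  have hxe := hx e he
  rw [← mul_add, ← mul_add]
  refine mul_le_mul_of_nonneg_left ?_ hxe
  induction e using Sym2.ind with | _ a b => ?_
  simp only [mem_cut, Finset.mem_sdiff]
  by_cases h1 : a ∈ A <;> by_cases h2 : a ∈ B <;> by_cases h3 : b ∈ A <;> by_cases h4 : b ∈ B <;>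
    simp [h1, h2, h3, h4]

/-- Handshaking: an edge inside Z is counted at both ends, an edge of δ(Z) at one. -/
theorem sum_weight_cut_singleton (x : Sym2 V → ℝ) (Z : Finset V) :
    ∑ v ∈ Z, weight x (cut {v}) = weight x (cut Z) + 2 * weight x (inner Z) := by
  simp only [weight_eq_sum_edges x (cut_subset_edges _),
    weight_eq_sum_edges x (inner_subset_edges Z)]
  rw [Finset.sum_comm, Finset.mul_sum, ← Finset.sum_add_distrib]
  refine Finset.sum_congr rfl fun e he => ?_
  rw [← Finset.mul_sum, mul_left_comm, ← mul_add]
  congr 1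
  induction e using Sym2.ind with | _ a b => ?_
  rw [mem_edges] at he
  have : ∀ v ∈ Z, (if s(a, b) ∈ cut {v} then (1 : ℝ) else 0) =
      (if v = a then 1 else 0) + (if v = b then 1 else 0) := by
    intro v _
    simp only [mem_cut, Finset.mem_singleton]
    by_cases h1 : v = a
    · subst h1
      simp [he, Ne.symm he]
    · by_cases h2 : v = b
      · subst h2
        simp [he, Ne.symm he]
      · simp [h1, h2, Ne.symm h1, Ne.symm h2]
  rw [Finset.sum_congr rfl this, Finset.sum_add_distrib, Finset.sum_ite_eq', Finset.sum_ite_eq']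
  simp only [mem_cut, mem_inner]
  by_cases h1 : a ∈ Z <;> by_cases h2 : b ∈ Z <;> simp [h1, h2, he]
  norm_num

theorem natCast_mul_weight_average {r : ℕ} (hr : r ≠ 0) (S : Fin r → Finset (Sym2 V))
    (F : Finset (Sym2 V)) :
    (r : ℝ) * weight (average S) F = ∑ k, ((S k ∩ F).card : ℝ) := by
  have hr' : (r : ℝ) ≠ 0 := Nat.cast_ne_zero.2 hr
  simp only [weight, average, ← Finset.mul_sum]
  rw [← mul_assoc, mul_one_div_cancel hr', one_mul, Finset.sum_comm]
  refine Finset.sum_congr rfl fun k _ => ?_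
  rw [Finset.sum_boole, Finset.filter_mem_eq_inter, Finset.inter_comm]

end Weights

/-! ### Relevant sets, and averaging over the trees -/

section Counting

variable {V : Type*} [Fintype V] [DecidableEq V] {s t : V} {r : ℕ} {S S' : Fin r → Finset (Sym2 V)}
  {x : Sym2 V → ℝ} {ε : ℝ}

/-- The cut `δ(U)`, with `s ∈ U`, must be crossed exactly once by the tree with number `j`. -/
def Relevant (s : V) (r : ℕ) (x : Sym2 V → ℝ) (ε : ℝ) (j : ℕ) (U : Finset V) : Prop :=
  s ∈ U ∧ U ≠ Finset.univ ∧ (j : ℝ) < r * (2 - weight x (cut U) - ε)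

/-- `S'` consists of spanning trees and has the same average as `S`. -/
def Reassembles (S S' : Fin r → Finset (Sym2 V)) : Prop :=
  (∀ k, IsSpanningTree (S' k)) ∧ average S' = average S

theorem IsInput.reassembles (h : IsInput s t S x ε) : Reassembles S S := ⟨h.tree, rfl⟩

theorem IsInput.ne_zero (h : IsInput s t S x ε) : r ≠ 0 := by
  rintro rfl
  have := h.degree_s
  simp [weight, average] at this

namespace Relevant

variable {j : ℕ} {A B U : Finset V}

theorem weight_lt (hU : Relevant s r x ε j U) : weight x (cut U) + ε < 2 := by
  by_contra! h
  have h1 := hU.2.2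
  have h2 : (r : ℝ) * (2 - weight x (cut U) - ε) ≤ 0 :=
    mul_nonpos_of_nonneg_of_nonpos (Nat.cast_nonneg _) (by linarith)
  have h3 : (0 : ℝ) ≤ j := Nat.cast_nonneg _
  linarith

/-- A set containing both s and t has an even cut, of weight at least 2, which is too heavy. -/
theorem notMem (h : IsInput s t S x ε) (hU : Relevant s r x ε j U) : t ∉ U := by
  intro ht
  have h1 := h.feasible.even_cut U ⟨s, hU.1⟩ hU.2.1 (by
    rw [Finset.inter_eq_right.2 (by simp [Finset.insert_subset_iff, hU.1, ht]),
      Finset.card_pair h.ne]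
    exact even_two)
  have := hU.weight_lt
  have := h.eps_nonneg
  linarith

theorem weight_ge (h : IsInput s t S x ε) (hU : Relevant s r x ε j U) : 1 ≤ weight x (cut U) := by
  refine h.feasible.odd_cut U ⟨s, hU.1⟩ hU.2.1 ?_
  have : U ∩ {s, t} = {s} := by
    ext v
    simp only [Finset.mem_inter, Finset.mem_insert, Finset.mem_singleton]
    have := hU.1
    have := hU.notMem h
    constructor
    · rintro ⟨h1, rfl | rfl⟩ <;> tauto
    · rintro rfl
      tauto
  rw [this, Finset.card_singleton]
  exact odd_one

end Relevant

theorem IsInput.weight_cut_ge_two (h : IsInput s t S x ε) {U : Finset V} (hne : U.Nonempty)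
    (hs : s ∉ U) (ht : t ∉ U) : 2 ≤ weight x (cut U) := by
  refine h.feasible.even_cut U hne (fun h => hs (h ▸ Finset.mem_univ _)) ?_
  have : U ∩ {s, t} = ∅ := by
    ext v
    simp only [Finset.mem_inter, Finset.mem_insert, Finset.mem_singleton, Finset.notMem_empty,
      iff_false, not_and, not_or]
    exact fun hv => ⟨fun e => hs (e ▸ hv), fun e => ht (e ▸ hv)⟩
  simp [this]

/-- The relevant cuts form a chain. -/
theorem Relevant.subset_or_subset (h : IsInput s t S x ε) {i j : ℕ} {A B : Finset V}
    (hA : Relevant s r x ε i A) (hB : Relevant s r x ε j B) : A ⊆ B ∨ B ⊆ A := by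
  by_contra! hc
  have hAt := hA.notMem h
  have hBt := hB.notMem h
  -- If neither set contains the other, both differences are nonempty and avoid s and t, so their
  -- cuts weigh at least 4 together. Posimodularity contradicts that the cuts of A and B weigh less
  -- than 2 each.
  have h1 := h.weight_cut_ge_two (U := A \ B) (Finset.sdiff_nonempty.2 hc.1) (by simp [hB.1])
    (by simp [hAt])
  have h2 := h.weight_cut_ge_two (U := B \ A) (Finset.sdiff_nonempty.2 hc.2) (by simp [hA.1])
    (by simp [hBt])
  have h3 := weight_cut_sdiff_add_le h.feasible.nonneg A B
  have h4 := hA.weight_lt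
  have h5 := hB.weight_lt
  have h6 := h.eps_nonneg
  linarith

/-- The cut δ(s) has weight 1 and every relevant cut has weight at least 1, so {s} is relevant as
soon as any set is. It is the bottom of the chain. -/
theorem Relevant.singleton (h : IsInput s t S x ε) {j : ℕ} {U : Finset V}
    (hU : Relevant s r x ε j U) : Relevant s r x ε j {s} := by
  refine ⟨Finset.mem_singleton_self _, fun hs => ?_, hU.2.2.trans_le ?_⟩
  · have := hs ▸ Finset.mem_univ t
    exact h.ne (Finset.mem_singleton.1 this).symm
  · rw [h.feasible.degree_s]
    have := hU.weight_ge h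
    exact mul_le_mul_of_nonneg_left (by linarith) (Nat.cast_nonneg _)

/-- Indices start at 0, so exactly j trees precede number j: a property of more than j trees that
fails at j cannot be confined to them. -/
theorem exists_later {P : Fin r → Prop} [DecidablePred P] {j : Fin r} (hj : ¬ P j)
    (h : (j : ℕ) < (Finset.univ.filter P).card) : ∃ k, j < k ∧ P k := by
  by_contra! hc
  have : Finset.univ.filter P ⊆ Finset.Iio j := by
    intro k hk
    rw [Finset.mem_filter] at hk
    rw [Finset.mem_Iio]
    refine lt_of_le_of_ne ?_ (fun he => hj (he ▸ hk.2))
    by_contra! hlt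
    exact hc k hlt hk.2
  have := Finset.card_le_card this
  rw [Fin.card_Iio] at this
  omega

theorem sum_card_inter (h : IsInput s t S x ε) (hS : Reassembles S S') (F : Finset (Sym2 V)) :
    ∑ k, ((S' k ∩ F).card : ℝ) = r * weight (average S) F := by
  rw [← natCast_mul_weight_average h.ne_zero, hS.2]

theorem sum_card_inter_le (h : IsInput s t S x ε) (hS : Reassembles S S')
    {F : Finset (Sym2 V)} (hF : F ⊆ edges V) :
    ∑ k, ((S' k ∩ F).card : ℝ) ≤ r * (weight x F + ε) := by
  rw [sum_card_inter h hS]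
  exact mul_le_mul_of_nonneg_left (h.close F hF).2 (Nat.cast_nonneg _)

theorem le_sum_card_inter (h : IsInput s t S x ε) (hS : Reassembles S S')
    {F : Finset (Sym2 V)} (hF : F ⊆ edges V) :
    r * (weight x F - ε) ≤ ∑ k, ((S' k ∩ F).card : ℝ) := by
  rw [sum_card_inter h hS]
  exact mul_le_mul_of_nonneg_left (h.close F hF).1 (Nat.cast_nonneg _)

/-- Each tree has at least one edge in δ(U), and at least two unless it has exactly one. The total
is at most r(x*(δ(U)) + ε), so at least r(2 − x*(δ(U)) − ε) > j trees have exactly one. -/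
theorem Relevant.lt_card_filter_cut (h : IsInput s t S x ε) (hS : Reassembles S S')
    {j : ℕ} {U : Finset V} (hU : Relevant s r x ε j U) :
    j < (Finset.univ.filter fun k => (S' k ∩ cut U).card = 1).card := by
  have h1 := sum_card_inter_le h hS (cut_subset_edges U)
  have h2 : ∑ k, (2 - if (S' k ∩ cut U).card = 1 then (1 : ℝ) else 0) ≤
      ∑ k, ((S' k ∩ cut U).card : ℝ) := by
    refine Finset.sum_le_sum fun k _ => ?_
    have := (hS.1 k).one_le_card_cut ⟨s, hU.1⟩ hU.2.1
    split_ifs with hk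
    · rw [hk]; norm_num
    · have : 2 ≤ (S' k ∩ cut U).card := by omega
      have : (2 : ℝ) ≤ ((S' k ∩ cut U).card : ℝ) := by exact_mod_cast this
      linarith
  rw [Finset.sum_sub_distrib, Finset.sum_boole, Finset.sum_const, Finset.card_univ,
    Fintype.card_fin, nsmul_eq_mul] at h2
  have h3 := hU.2.2
  have : (j : ℝ) < ((Finset.univ.filter fun k => (S' k ∩ cut U).card = 1).card : ℝ) := by
    nlinarith
  exact_mod_cast this

theorem Relevant.exists_later_cut (h : IsInput s t S x ε) (hS : Reassembles S S')
    {j : Fin r} {U : Finset V} (hU : Relevant s r x ε j U)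
    (hj : (S' j ∩ cut U).card ≠ 1) : ∃ k, j < k ∧ (S' k ∩ cut U).card = 1 :=
  exists_later hj (hU.lt_card_filter_cut h hS)

/-- Each tree has an edge at s and the average number is exactly 1, so equality holds for every
tree. This uses the exact degree of the average, not its closeness to x*. -/
theorem card_cut_source (h : IsInput s t S x ε) (hS : Reassembles S S')
    (k : Fin r) : (S' k ∩ cut {s}).card = 1 := by
  have hne : ({s} : Finset V) ≠ Finset.univ := fun hs => by
    have := hs ▸ Finset.mem_univ t
    exact h.ne (Finset.mem_singleton.1 this).symm
  have h1 := sum_card_inter h hS (cut {s})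
  rw [h.degree_s, mul_one] at h1
  have h2 : ∀ k ∈ Finset.univ, 1 ≤ (S' k ∩ cut {s}).card := fun k _ =>
    (hS.1 k).one_le_card_cut ⟨s, Finset.mem_singleton_self _⟩ hne
  have h3 : ∑ k : Fin r, 1 = ∑ k, (S' k ∩ cut {s}).card := by
    have : ((∑ k, (S' k ∩ cut {s}).card : ℕ) : ℝ) = ((∑ k : Fin r, 1 : ℕ) : ℝ) := by
      push_cast
      rw [h1]
      simp
    exact_mod_cast this.symm
  exact ((Finset.sum_eq_sum_iff_of_le h2).1 h3 k (Finset.mem_univ k)).symm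

/-- Let Z = B \ A. A tree has at most |Z| − 1 edges inside Z, and at most |Z| − 2 unless it connects
Z there. The total is at least r times the x*-weight inside Z minus ε, and the degree constraints
express that weight through |Z| and x*(δ(Z)). -/
theorem Relevant.exists_later_connOn (h : IsInput s t S x ε) (hS : Reassembles S S')
    {j : Fin r} {A B : Finset V} (hAB : A ⊂ B)
    (hA : A = ∅ ∨ Relevant s r x ε j A) (hB : Relevant s r x ε j B)
    (hj : ¬ ConnOn (S' j) (B \ A)) : ∃ k, j < k ∧ ConnOn (S' k) (B \ A) := by
  classical
  refine exists_later hj ?_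
  set Z := B \ A with hZ
  have hZne : Z.Nonempty := Finset.sdiff_nonempty.2 hAB.2
  have ht := hB.notMem h
  have h1 := le_sum_card_inter h hS (inner_subset_edges Z)
  have h2 : ∑ k, ((S' k ∩ inner Z).card : ℝ) ≤
      ∑ k, (((Z.card : ℝ) - 2) + if ConnOn (S' k) Z then (1 : ℝ) else 0) := by
    refine Finset.sum_le_sum fun k _ => ?_
    split_ifs with hk
    · have := (hS.1 k).card_inner_add_one_le hZne
      have : ((S' k ∩ inner Z).card : ℝ) + 1 ≤ Z.card := by exact_mod_cast this
      linarith
    · have := (hS.1 k).card_inner_add_two_le hk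
      have : ((S' k ∩ inner Z).card : ℝ) + 2 ≤ Z.card := by exact_mod_cast this
      linarith
  rw [Finset.sum_add_distrib, Finset.sum_boole, Finset.sum_const, Finset.card_univ,
    Fintype.card_fin, nsmul_eq_mul] at h2
  have h3 := sum_weight_cut_singleton x Z
  have hr : (0 : ℝ) < r := Nat.cast_pos.2 (Nat.pos_of_ne_zero h.ne_zero)
  have h4 : (j : ℝ) < r * (weight x (inner Z) - ε - (Z.card - 2)) := by
    -- For A = ∅ the degree 1 at s costs one half, which x*(δ(B)) ≥ 1 makes up for.
    rcases hA with rfl | hA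
    · have hZB : Z = B := by simp [hZ]
      rw [hZB] at h3 ⊢
      have h5 : ∑ v ∈ B, weight x (cut {v}) = 2 * (B.card : ℝ) - 1 := by
        rw [← Finset.add_sum_erase _ _ hB.1, h.feasible.degree_s,
          Finset.sum_congr rfl (g := fun _ => (2 : ℝ)), Finset.sum_const,
          Finset.card_erase_of_mem hB.1, nsmul_eq_mul,
          Nat.cast_sub (Finset.card_pos.2 ⟨s, hB.1⟩)]
        · push_cast; ring
        · intro v hv
          rw [Finset.mem_erase] at hv
          exact h.feasible.degree v hv.1 fun e => ht (e ▸ hv.2)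
      have h6 := hB.weight_ge h
      refine hB.2.2.trans_le (mul_le_mul_of_nonneg_left ?_ hr.le)
      linarith
    · have h5 : ∑ v ∈ Z, weight x (cut {v}) = 2 * (Z.card : ℝ) := by
        rw [Finset.sum_congr rfl (g := fun _ => (2 : ℝ)), Finset.sum_const, nsmul_eq_mul, mul_comm]
        intro v hv
        rw [hZ, Finset.mem_sdiff] at hv
        exact h.feasible.degree v (fun e => hv.2 (e ▸ hA.1)) fun e => ht (e ▸ hv.1)
      have h6 := weight_cut_add_weight_cut x hAB.1
      have h7 : 0 ≤ weight x (cut A ∩ cut B) := Finset.sum_nonneg fun e he =>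
        h.feasible.nonneg e (cut_subset_edges A (Finset.mem_inter.1 he).1)
      have h8 := hA.2.2
      have h9 := hB.2.2
      -- Since x*(δ(B \ A)) ≤ x*(δ(A)) + x*(δ(B)), the count is at least the mean of the two
      -- relevance thresholds, and both exceed j.
      have h10 : (r : ℝ) * (((2 - weight x (cut A) - ε) + (2 - weight x (cut B) - ε)) / 2) ≤
          r * (weight x (inner Z) - ε - (Z.card - 2)) :=
        mul_le_mul_of_nonneg_left (by rw [← hZ] at h6; linarith) hr.le
      linarith
  have : (j : ℝ) < ((Finset.univ.filter fun k => ConnOn (S' k) Z).card : ℝ) := by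
    nlinarith
  exact_mod_cast this

/-- The set B \ A avoids s and t, so its cut weighs at least 2, and the edges common to δ(A) and
δ(B) weigh at most (x*(δ(A)) + x*(δ(B)))/2 − 1. As each tree that uses such an edge contributes at
least 1, the number of trees without one is at least the mean of two thresholds that exceed j. -/
theorem Relevant.exists_later_inter_eq_empty (h : IsInput s t S x ε) (hS : Reassembles S S')
    {j : Fin r} {A B : Finset V} (hAB : A ⊂ B)
    (hA : Relevant s r x ε j A) (hB : Relevant s r x ε j B)
    (hj : S' j ∩ (cut A ∩ cut B) ≠ ∅) : ∃ k, j < k ∧ S' k ∩ (cut A ∩ cut B) = ∅ := by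
  refine exists_later hj ?_
  have h1 := sum_card_inter_le h hS
    ((Finset.inter_subset_left (s₂ := cut B)).trans (cut_subset_edges A))
  have h2 : ∑ k, (1 - if S' k ∩ (cut A ∩ cut B) = ∅ then (1 : ℝ) else 0) ≤
      ∑ k, ((S' k ∩ (cut A ∩ cut B)).card : ℝ) := by
    refine Finset.sum_le_sum fun k _ => ?_
    split_ifs with hk
    · rw [hk]; norm_num
    · have := Finset.card_pos.2 (Finset.nonempty_iff_ne_empty.2 hk)
      have : (1 : ℝ) ≤ ((S' k ∩ (cut A ∩ cut B)).card : ℝ) := by exact_mod_cast this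
      linarith
  rw [Finset.sum_sub_distrib, Finset.sum_boole, Finset.sum_const, Finset.card_univ,
    Fintype.card_fin, nsmul_eq_mul] at h2
  have h3 := weight_cut_add_weight_cut x hAB.1
  have ht := hB.notMem h
  have h4 := h.weight_cut_ge_two (U := B \ A) (Finset.sdiff_nonempty.2 hAB.2) (by simp [hA.1])
    (by simp [ht])
  have h5 := hA.2.2
  have h6 := hB.2.2
  have h7 : (r : ℝ) * (weight x (cut A ∩ cut B) + ε) ≤
      r * (1 - ((2 - weight x (cut A) - ε) + (2 - weight x (cut B) - ε)) / 2) :=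
    mul_le_mul_of_nonneg_left (by linarith) (Nat.cast_nonneg _)
  have : (j : ℝ) < ((Finset.univ.filter fun k => S' k ∩ (cut A ∩ cut B) = ∅).card : ℝ) := by
    nlinarith
  exact_mod_cast this

end Counting

/-! ### Trading an edge inside a vertex set for one that is not -/

section Exchange

variable {V : Type*} [Fintype V] [DecidableEq V]

namespace IsSpanningTree

variable {S T : Finset (Sym2 V)}

/-- The side of a later edge on a trail is contained in the side of an earlier one. -/
theorem reach_side_of_reach_side (hT : IsSpanningTree T)
    {o p q y : V} (ho : s(o, p) ∈ T) (hp : s(p, q) ∈ T)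
    (hne : s(o, p) ≠ s(p, q)) (h : Reach (T.erase s(p, q)) q y) : Reach (T.erase s(o, p)) p y := by
  have hnot : ¬ Reach (T.erase s(p, q)) q p := fun h => hT.not_reach_erase hp h.symm
  refine h.induct (P := fun y => Reach (T.erase s(o, p)) p y)
    (.of_mem (Finset.mem_erase.2 ⟨hne.symm, hp⟩)) ?_
  intro x y hx ih hxy
  refine ih.trans (.of_mem (Finset.mem_erase.2 ⟨fun he => ?_, (Finset.mem_erase.1 hxy).2⟩))
  rcases Sym2.eq_iff.1 he with ⟨rfl, rfl⟩ | ⟨rfl, rfl⟩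
  · exact hnot (hx.trans (.of_mem hxy))
  · exact hnot hx

/-- Follow the trail from κ to v and watch whether the far side of the current edge contains the
projection of its head. After leaving κ through an edge that fails this, the far sides shrink, so
the projection of the tail is never on the far side of the next edge. At v, which is its own
projection, the test succeeds; the first success is the required edge. It has an endpoint outside Z,
because κ is closed under edges of H into Z. -/
theorem exists_separating_edge (hT : IsSpanningTree T)
    {H : Finset (Sym2 V)} (hH : H ⊆ T) {Z : Finset V} {κ : V → Prop}
    (hκ : ∀ a b, κ a → b ∈ Z → s(a, b) ∈ H → κ b) (hκZ : ∀ a, κ a → a ∈ Z) {π : V → V}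
    (hπ : ∀ z ∈ Z, π z = z) {v : V} (hv : v ∈ Z) (hvκ : ¬ κ v) {u : V}
    (w : (SimpleGraph.fromEdgeSet (H : Set (Sym2 V))).Walk u v) (hw : w.IsTrail)
    (hu : κ u ∨ u ∉ Z ∧ ∃ o, s(o, u) ∈ T ∧ s(o, u) ∉ w.edges ∧
      ¬ Reach (T.erase s(o, u)) u (π u)) :
    ∃ p q, s(p, q) ∈ H ∧ s(p, q) ∉ inner Z ∧ ¬ Reach (T.erase s(p, q)) q (π p) ∧
      Reach (T.erase s(p, q)) q (π q) := by
  induction w with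
  | nil => exact absurd hu (by tauto)
  | @cons x q v hxq w ih =>
    have hmem : s(x, q) ∈ H := by simpa using hxq.1
    have hmemT := hH hmem
    rw [SimpleGraph.Walk.isTrail_cons] at hw
    have hnot : ¬ Reach (T.erase s(x, q)) q x := fun h => hT.not_reach_erase hmemT h.symm
    rcases hu with hu | ⟨hu, o, ho, how, hr⟩
    · by_cases hq : q ∈ Z
      · exact ih hv hvκ hw.1 (Or.inl (hκ x q hu hq hmem))
      · by_cases hr : Reach (T.erase s(x, q)) q (π q)
        · exact ⟨x, q, hmem, by simp [hq], by rwa [hπ x (hκZ x hu)], hr⟩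
        · exact ih hv hvκ hw.1 (Or.inr ⟨hq, x, hmemT, hw.2, hr⟩)
    · rw [SimpleGraph.Walk.edges_cons, List.mem_cons, not_or] at how
      have hr' : ¬ Reach (T.erase s(x, q)) q (π x) := fun h =>
        hr (hT.reach_side_of_reach_side ho hmemT how.1 h)
      by_cases hr2 : Reach (T.erase s(x, q)) q (π q)
      · exact ⟨x, q, hmem, by simp [hu], hr', hr2⟩
      · have hq : q ∉ Z := fun hq => hr2 (by rw [hπ q hq]; exact .refl _)
        exact ih hv hvκ hw.1 (Or.inr ⟨hq, x, hmemT, hw.2, hr2⟩)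

/-- Send x to the first vertex of Z on a walk in T towards Z; no edge used before has both endpoints
in Z. -/
theorem exists_projection (hT : IsSpanningTree T) {Z : Finset V} (hZ : Z.Nonempty) :
    ∃ π : V → V, (∀ z ∈ Z, π z = z) ∧ (∀ x, π x ∈ Z) ∧ ∀ x, Reach (T \ inner Z) x (π x) := by
  obtain ⟨z, hz⟩ := hZ
  have key : ∀ x, ∃ y, (x ∈ Z → y = x) ∧ y ∈ Z ∧ Reach (T \ inner Z) x y := fun x => by
    refine (hT.reach z x).induct
      (P := fun x => ∃ y, (x ∈ Z → y = x) ∧ y ∈ Z ∧ Reach (T \ inner Z) x y)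
      ⟨z, fun _ => rfl, hz, .refl _⟩ ?_
    rintro a b - ⟨y, -, hy, hr⟩ hab
    by_cases hb : b ∈ Z
    · exact ⟨b, fun _ => rfl, hb, .refl _⟩
    · refine ⟨y, fun h => absurd h hb, hy, Reach.trans (.of_mem ?_) hr⟩
      rw [Sym2.eq_swap, Finset.mem_sdiff]
      exact ⟨hab, by simp [hb]⟩
  choose π h1 h2 h3 using key
  exact ⟨π, h1, h2, h3⟩

/-- If `S` connects `Z` inside `Z`, and `H ⊆ T` links two vertices of `Z` that `H` does not link
inside `Z`, then an edge of `S` inside `Z` can be exchanged for an edge of `H` not inside `Z`. -/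
theorem exists_exchange (hT : IsSpanningTree T)
    (hS : IsSpanningTree S) {H : Finset (Sym2 V)} (hH : H ⊆ T) {Z : Finset V}
    (hZ : ConnOn S Z) {κ : V → Prop} (hκ : ∀ a b, κ a → b ∈ Z → s(a, b) ∈ H → κ b)
    (hκZ : ∀ a, κ a → a ∈ Z) {u v : V} (hu : κ u) (hv : v ∈ Z) (hvκ : ¬ κ v) (hr : Reach H u v) :
    ∃ p q a b, s(p, q) ∈ H ∧ s(p, q) ∉ inner Z ∧ s(a, b) ∈ S ∧ s(a, b) ∈ inner Z ∧
      ¬ Reach (T.erase s(p, q)) q a ∧ Reach (T.erase s(p, q)) q b ∧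
      (∀ x y, Reach (insert s(a, b) (T.erase s(p, q))) x y) ∧
      ∀ x y, Reach (insert s(p, q) (S.erase s(a, b))) x y := by
  obtain ⟨π, h1, h2, h3⟩ := hS.exists_projection ⟨v, hv⟩
  obtain ⟨w, hw⟩ := (Reach.iff_reachable.1 hr).exists_isPath
  obtain ⟨p, q, hpq, hpqZ, hp, hq⟩ := hT.exists_separating_edge hH hκ hκZ h1 hv hvκ w hw.isTrail
    (Or.inl hu)
  -- The projections of p and q lie on different sides of pq, and S joins them inside Z, so the
  -- crossing edge ab lies inside Z.
  obtain ⟨a, b, ha, hb, hab, hpa, hbq⟩ := exists_crossing (K := Reach (T.erase s(p, q)) q)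
    (hZ (π p) (h2 p) (π q) (h2 q)) hp hq
  obtain ⟨hab, habZ⟩ := Finset.mem_inter.1 hab
  -- The links from p and q to their projections use edges not inside Z, so they survive the removal
  -- of ab.
  have m1 : (S ∩ inner Z).erase s(a, b) ⊆ S.erase s(a, b) :=
    Finset.erase_subset_erase _ Finset.inter_subset_left
  have m2 : S \ inner Z ⊆ S.erase s(a, b) := fun e he => by
    rw [Finset.mem_sdiff] at he
    exact Finset.mem_erase.2 ⟨fun h => he.2 (h ▸ habZ), he.1⟩
  have h4 := hT.exchange hS (hH hpq) hab ha hb (((h3 p).mono m2).trans (hpa.mono m1))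
    ((hbq.mono m1).trans ((h3 q).symm.mono m2))
  exact ⟨p, q, a, b, hpq, hpqZ, hab, habZ, ha, hb, h4.1, h4.2⟩

end IsSpanningTree

theorem ConnOn.reach_erase {T : Finset (Sym2 V)} {Z : Finset V} (h : ConnOn T Z) {f : Sym2 V}
    (hf : f ∉ inner Z) {u v : V} (hu : u ∈ Z) (hv : v ∈ Z) : Reach (T.erase f) u v := by
  refine (h u hu v hv).mono fun e he => ?_
  rw [Finset.mem_inter] at he
  exact Finset.mem_erase.2 ⟨fun h => hf (h ▸ he.2), he.1⟩

theorem ConnOn.insert_erase {T : Finset (Sym2 V)} {Z : Finset V} (h : ConnOn T Z) {e f : Sym2 V}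
    (hf : f ∉ inner Z) : ConnOn (insert e (T.erase f)) Z := fun u hu v hv => by
  refine (h u hu v hv).mono fun g hg => ?_
  rw [Finset.mem_inter] at hg ⊢
  exact ⟨Finset.mem_insert_of_mem (Finset.mem_erase.2 ⟨fun h => hf (h ▸ hg.2), hg.1⟩), hg.2⟩

theorem insert_erase_inter {T F : Finset (Sym2 V)} {e f : Sym2 V} (he : e ∉ F) (hf : f ∉ F) :
    insert e (T.erase f) ∩ F = T ∩ F := by
  ext g
  simp only [Finset.mem_inter, Finset.mem_insert, Finset.mem_erase]
  by_cases h1 : g = e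
  · subst h1; simp [he]
  · by_cases h2 : g = f
    · subst h2; simp [hf]
    · simp [h1, h2]

theorem card_insert_erase_inter_lt {T F : Finset (Sym2 V)} {e f : Sym2 V} (he : e ∉ F) (hf : f ∈ F)
    (hfT : f ∈ T) : (insert e (T.erase f) ∩ F).card < (T ∩ F).card := by
  refine Finset.card_lt_card ⟨fun g => ?_, fun h => ?_⟩
  · simp only [Finset.mem_inter, Finset.mem_insert, Finset.mem_erase]
    rintro ⟨rfl | h, hg⟩
    · exact absurd hg he
    · exact ⟨h.2, hg⟩
  · have := h (Finset.mem_inter.2 ⟨hfT, hf⟩)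
    simp only [Finset.mem_inter, Finset.mem_insert, Finset.mem_erase] at this
    rcases this with ⟨rfl | h, -⟩
    · exact he hf
    · exact h.1 rfl

theorem card_lt_card_insert_erase_inter {T F : Finset (Sym2 V)} {e f : Sym2 V} (he : e ∈ F)
    (heT : e ∉ T) (hf : f ∉ F) : (T ∩ F).card < (insert e (T.erase f) ∩ F).card := by
  refine Finset.card_lt_card ⟨fun g => ?_, fun h => ?_⟩
  · simp only [Finset.mem_inter, Finset.mem_insert, Finset.mem_erase]
    rintro ⟨h, hg⟩
    exact ⟨Or.inr ⟨fun e => hf (e ▸ hg), h⟩, hg⟩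
  · exact heT (Finset.mem_inter.1 (h (Finset.mem_inter.2 ⟨Finset.mem_insert_self _ _, he⟩))).1

end Exchange

/-! ### Swaps between two trees -/

section Moves

variable {V : Type*} [Fintype V] [DecidableEq V] {r : ℕ}

/-- Give the edge `e` of the tree `S k` to `S j`, and the edge `f` of `S j` to `S k`. -/
def swap (S : Fin r → Finset (Sym2 V)) (j k : Fin r) (e f : Sym2 V) : Fin r → Finset (Sym2 V) :=
  Function.update (Function.update S j (insert e ((S j).erase f))) k (insert f ((S k).erase e))

/-- Swapping `e` and `f` keeps both edge sets connected. -/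
def Exchangeable (S : Fin r → Finset (Sym2 V)) (j k : Fin r) (e f : Sym2 V) : Prop :=
  e ∈ S k ∧ f ∈ S j ∧ (∀ u v, Reach (insert e ((S j).erase f)) u v) ∧
    ∀ u v, Reach (insert f ((S k).erase e)) u v

/-- The number of sets, among three nested ones, that do not contain `v`. -/
def label (K L M : Finset V) (v : V) : ℕ :=
  (if v ∈ K then 0 else 1) + (if v ∈ L then 0 else 1) + if v ∈ M then 0 else 1

/-- Bounds for the labels of the endpoints of two edges `ab` and `pq`. The label of `q` is `3`. -/
structure Mask where
  aMin : ℕ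
  aMax : ℕ
  b : ℕ
  pMin : ℕ
  pMax : ℕ

/-- The labels of `a`, `b`, `p`, `q` obey the bounds. -/
def Mask.Admits (M : Mask) (ℓ : V → ℕ) (a b p q : V) : Prop :=
  M.aMin ≤ ℓ a ∧ ℓ a ≤ M.aMax ∧ ℓ b = M.b ∧ M.pMin ≤ ℓ p ∧ ℓ p ≤ M.pMax ∧ ℓ q = 3

/-- The bounds exclude label `0`. -/
def Mask.Pos (M : Mask) : Prop := 1 ≤ M.aMin ∧ 1 ≤ M.b ∧ 1 ≤ M.pMin

/-- `S'` arises from `S` by one admissible swap between `S j` and a later tree. -/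
def Move (M : Mask) (ℓ : V → ℕ) (j : Fin r) (S S' : Fin r → Finset (Sym2 V)) : Prop :=
  ∃ k a b p q, j < k ∧ M.Admits ℓ a b p q ∧ Exchangeable S j k s(a, b) s(p, q) ∧
    S' = swap S j k s(a, b) s(p, q)

theorem swap_apply_left {S : Fin r → Finset (Sym2 V)} {j k : Fin r} (h : j < k) (e f : Sym2 V) :
    swap S j k e f j = insert e ((S j).erase f) := by
  simp [swap, Function.update_of_ne h.ne]

theorem swap_apply_of_lt {S : Fin r → Finset (Sym2 V)} {i j k : Fin r} (h : j < k) (hi : i < j)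
    (e f : Sym2 V) : swap S j k e f i = S i := by
  simp [swap, Function.update_of_ne hi.ne, Function.update_of_ne (hi.trans h).ne]

/-- Each received edge is new to its tree unless e = f, in which case nothing changes; so the
indicator sum of every edge over the two trees is preserved. -/
theorem Reassembles.swap {S S' : Fin r → Finset (Sym2 V)} (hS : Reassembles S S') {j k : Fin r}
    (hjk : j < k) {e f : Sym2 V} (h : Exchangeable S' j k e f) :
    Reassembles S (swap S' j k e f) := by
  obtain ⟨he, hf, hc1, hc2⟩ := h
  have hTj := hS.1 j
  have hTk := hS.1 k
  refine ⟨fun i => ?_, ?_⟩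
  · unfold PathTSP.swap
    by_cases hik : i = k
    · subst hik
      rw [Function.update_self]
      exact hTk.insert_erase (hTj.subset_edges hf) he hc2
    · rw [Function.update_of_ne hik]
      by_cases hij : i = j
      · subst hij
        rw [Function.update_self]
        exact hTj.insert_erase (hTk.subset_edges he) hf hc1
      · rw [Function.update_of_ne hij]
        exact hS.1 i
  · rw [← hS.2]
    funext g
    unfold average
    congr 1
    -- The change of the indicator of g in tree j; the change in tree k is its negative.
    set c : ℝ := (if g ∈ insert e ((S' j).erase f) then 1 else 0) - if g ∈ S' j then 1 else 0
      with hc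
    have hc' : c =
        (if g ∈ S' k then 1 else 0) - if g ∈ insert f ((S' k).erase e) then 1 else 0 := by
      by_cases hef : e = f
      · subst hef
        rw [hc, Finset.insert_erase he, Finset.insert_erase hf]
        simp
      · have h1 := hTj.notMem_of_connected_insert_erase hf hef hc1
        have h2 := hTk.notMem_of_connected_insert_erase he (Ne.symm hef) hc2
        rw [hc]
        by_cases hge : g = e
        · subst hge; simp [h1, he, hef]
        · by_cases hgf : g = f
          · subst hgf; simp [h2, hf, hge]
          · simp [hge, hgf]
    have key : ∀ i, (if g ∈ PathTSP.swap S' j k e f i then (1 : ℝ) else 0) =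
        (if g ∈ S' i then 1 else 0) + (if i = j then c else 0) - if i = k then c else 0 := by
      intro i
      unfold PathTSP.swap
      by_cases hik : i = k
      · subst hik
        rw [Function.update_self, if_neg hjk.ne', if_pos rfl, hc']
        ring
      · rw [Function.update_of_ne hik, if_neg hik]
        by_cases hij : i = j
        · subst hij
          rw [Function.update_self, if_pos rfl, hc]
          ring
        · rw [Function.update_of_ne hij, if_neg hij]
          ring
    rw [Finset.sum_congr rfl fun i _ => key i]
    rw [Finset.sum_sub_distrib, Finset.sum_add_distrib]
    simp

end Moves

/-! ### Exhaustive local search under a decreasing potential -/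

section Sweeps

variable {V : Type*} [Fintype V] [DecidableEq V] {r : ℕ}

open Classical in
/-- Try all swaps between `S j` and later trees, one after the other. -/
noncomputable def sweep (vs : List V) (M : Mask) (ℓ : V → ℕ) (j : Fin r)
    (S : Fin r → Finset (Sym2 V)) : Fin r → Finset (Sym2 V) :=
  (List.finRange r ×ˢ vs ×ˢ vs ×ˢ vs ×ˢ vs).foldl (fun S x =>
    if j < x.1 ∧ M.Admits ℓ x.2.1 x.2.2.1 x.2.2.2.1 x.2.2.2.2 ∧
      Exchangeable S j x.1 s(x.2.1, x.2.2.1) s(x.2.2.2.1, x.2.2.2.2)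
    then swap S j x.1 s(x.2.1, x.2.2.1) s(x.2.2.2.1, x.2.2.2.2) else S) S

/-- Sweep as often as the list `vs` is long. -/
noncomputable def sweeps (vs : List V) (M : Mask) (ℓ : V → ℕ) (j : Fin r)
    (S : Fin r → Finset (Sym2 V)) : Fin r → Finset (Sym2 V) :=
  vs.foldl (fun S _ => sweep vs M ℓ j S) S

theorem foldl_reflTransGen {α σ : Type*} (R : σ → σ → Prop) (f : σ → α → σ)
    (hf : ∀ s a, f s a = s ∨ R s (f s a)) (l : List α) (s : σ) :
    Relation.ReflTransGen R s (l.foldl f s) := by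
  induction l generalizing s with
  | nil => exact .refl
  | cons a l ih =>
    rw [List.foldl_cons]
    rcases hf s a with h | h
    · rw [h]; exact ih s
    · exact (Relation.ReflTransGen.single h).trans (ih _)

/-- The state stays the same up to the first effective step, so a step possible at the start is
either reached in that state or preceded by another effective step. -/
theorem foldl_transGen {α σ : Type*} (R : σ → σ → Prop) (f : σ → α → σ)
    (hf : ∀ s a, f s a = s ∨ R s (f s a)) (l : List α) (s : σ) (h : ∃ a ∈ l, R s (f s a)) :
    Relation.TransGen R s (l.foldl f s) := by
  induction l with
  | nil => simp at h
  | cons a l ih =>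
    rw [List.foldl_cons]
    by_cases ha : R s (f s a)
    · exact .trans_left (.single ha) (foldl_reflTransGen R f hf l _)
    · rw [(hf s a).resolve_right ha]
      obtain ⟨b, hb, hR⟩ := h
      rcases List.mem_cons.1 hb with rfl | hb
      · exact absurd hR ha
      · exact ih ⟨b, hb, hR⟩

theorem sweep_reflTransGen (vs : List V) (M : Mask) (ℓ : V → ℕ) (j : Fin r)
    (S : Fin r → Finset (Sym2 V)) : Relation.ReflTransGen (Move M ℓ j) S (sweep vs M ℓ j S) := by
  refine foldl_reflTransGen _ _ (fun S x => ?_) _ _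
  split_ifs with h
  · exact Or.inr ⟨_, _, _, _, _, h.1, h.2.1, h.2.2, rfl⟩
  · exact Or.inl rfl

theorem sweep_transGen {vs : List V} (hvs : ∀ v, v ∈ vs) {M : Mask} {ℓ : V → ℕ} {j : Fin r}
    {S : Fin r → Finset (Sym2 V)} (h : ∃ S', Move M ℓ j S S') :
    Relation.TransGen (Move M ℓ j) S (sweep vs M ℓ j S) := by
  refine foldl_transGen _ _ (fun S x => ?_) _ _ ?_
  · split_ifs with h
    · exact Or.inr ⟨_, _, _, _, _, h.1, h.2.1, h.2.2, rfl⟩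
    · exact Or.inl rfl
  · obtain ⟨S', k, a, b, p, q, h1, h2, h3, rfl⟩ := h
    refine ⟨(k, a, b, p, q), by simp [hvs], ?_⟩
    dsimp only
    rw [if_pos ⟨h1, h2, h3⟩]
    exact ⟨k, a, b, p, q, h1, h2, h3, rfl⟩

/-- Moves that lower a bound `ν`, and that exist as long as `Q` fails, lead to `Q`. -/
theorem sweeps_spec {vs : List V} (hvs : ∀ v, v ∈ vs) {M : Mask} {ℓ : V → ℕ} {j : Fin r}
    (Inv Q : (Fin r → Finset (Sym2 V)) → Prop) (ν : (Fin r → Finset (Sym2 V)) → ℕ)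
    (hInv : ∀ S S', Inv S → Move M ℓ j S S' → Inv S' ∧ (Q S → Q S') ∧ ν S' < ν S)
    (hQ : ∀ S, Inv S → ¬ Q S → ∃ S', Move M ℓ j S S') {S : Fin r → Finset (Sym2 V)} (hS : Inv S)
    (hν : ν S ≤ Fintype.card V) : Inv (sweeps vs M ℓ j S) ∧ Q (sweeps vs M ℓ j S) := by
  have hrefl : ∀ S S', Inv S → Relation.ReflTransGen (Move M ℓ j) S S' →
      Inv S' ∧ (Q S → Q S') ∧ ν S' ≤ ν S := by
    intro S S' hS h
    induction h with
    | refl => exact ⟨hS, id, le_rfl⟩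
    | tail _ h ih =>
      obtain ⟨h1, h2, h3⟩ := hInv _ _ ih.1 h
      exact ⟨h1, fun h => h2 (ih.2.1 h), h3.le.trans ih.2.2⟩
  have htrans : ∀ S S', Inv S → Relation.TransGen (Move M ℓ j) S S' → ν S' < ν S := by
    intro S S' hS h
    obtain ⟨T, h1, h2⟩ := Relation.TransGen.head'_iff.1 h
    obtain ⟨h3, -, h4⟩ := hInv _ _ hS h1
    exact (hrefl _ _ h3 h2).2.2.trans_lt h4
  have hlen : Fintype.card V ≤ vs.length := by
    rw [← Finset.card_univ]
    exact (Finset.card_le_card (fun v _ => List.mem_toFinset.2 (hvs v))).trans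
      (List.toFinset_card_le vs)
  -- Until Q holds, every sweep makes a move and thus costs at least one unit of ν.
  have key : ∀ l : List V, Inv (l.foldl (fun S _ => sweep vs M ℓ j S) S) ∧
      (Q (l.foldl (fun S _ => sweep vs M ℓ j S) S) ∨
        ν (l.foldl (fun S _ => sweep vs M ℓ j S) S) + l.length ≤ Fintype.card V) := by
    intro l
    induction l using List.reverseRecOn with
    | nil => exact ⟨hS, Or.inr (by simpa using hν)⟩
    | append_singleton l a ih =>
      rw [List.foldl_append, List.foldl_cons, List.foldl_nil, List.length_append,
        List.length_singleton]
      obtain ⟨h1, h2⟩ := ih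
      have h3 := hrefl _ _ h1 (sweep_reflTransGen vs M ℓ j _)
      refine ⟨h3.1, ?_⟩
      rcases h2 with h2 | h2
      · exact Or.inl (h3.2.1 h2)
      · by_cases hq : Q (l.foldl (fun S _ => sweep vs M ℓ j S) S)
        · exact Or.inl (h3.2.1 hq)
        · have := htrans _ _ h1 (sweep_transGen hvs (hQ _ h1 hq))
          exact Or.inr (by omega)
  obtain ⟨h1, h2⟩ := key vs
  refine ⟨h1, ?_⟩
  -- There are at least |V| sweeps, so ν has reached 0 and no further move can lower it.
  by_contra hq
  obtain ⟨S', hS'⟩ := hQ _ h1 hq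
  have h3 := (hInv _ _ h1 hS').2.2
  have h4 := h2.resolve_left hq
  omega

end Sweeps

/-! ### From one set of the chain to the next -/

section Stage

variable {V : Type*} [Fintype V] [DecidableEq V] {r : ℕ} {K L M : Finset V}

theorem one_le_label {v : V} (hKL : K ⊆ L) (hLM : L ⊆ M) : 1 ≤ label K L M v ↔ v ∉ K := by
  have h1 := @hKL v
  have h2 := @hLM v
  unfold label
  by_cases h3 : v ∈ K <;> by_cases h4 : v ∈ L <;> by_cases h5 : v ∈ M <;> simp_all

theorem two_le_label {v : V} (hKL : K ⊆ L) (hLM : L ⊆ M) : 2 ≤ label K L M v ↔ v ∉ L := by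
  have h1 := @hKL v
  have h2 := @hLM v
  unfold label
  by_cases h3 : v ∈ K <;> by_cases h4 : v ∈ L <;> by_cases h5 : v ∈ M <;> simp_all

theorem three_le_label {v : V} (hKL : K ⊆ L) (hLM : L ⊆ M) : 3 ≤ label K L M v ↔ v ∉ M := by
  have h1 := @hKL v
  have h2 := @hLM v
  unfold label
  by_cases h3 : v ∈ K <;> by_cases h4 : v ∈ L <;> by_cases h5 : v ∈ M <;> simp_all

theorem label_le_three (v : V) : label K L M v ≤ 3 := by
  unfold label
  split_ifs <;> omega

theorem label_eq_one {v : V} (hKL : K ⊆ L) (hLM : L ⊆ M) (h1 : v ∈ L) (h2 : v ∉ K) :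
    label K L M v = 1 := by
  have h3 := (one_le_label hKL hLM).2 h2
  have h4 : ¬ 2 ≤ label K L M v := fun h => (two_le_label hKL hLM).1 h h1
  omega

theorem label_eq_two {v : V} (hKL : K ⊆ L) (hLM : L ⊆ M) (h1 : v ∈ M) (h2 : v ∉ L) :
    label K L M v = 2 := by
  have h3 := (two_le_label hKL hLM).2 h2
  have h4 : ¬ 3 ≤ label K L M v := fun h => (three_le_label hKL hLM).1 h h1
  omega

theorem label_eq_three {v : V} (hKL : K ⊆ L) (hLM : L ⊆ M) (h : v ∉ M) : label K L M v = 3 :=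
  le_antisymm (label_le_three v) ((three_le_label hKL hLM).2 h)

theorem mem_of_label_le_one {v : V} (hKL : K ⊆ L) (hLM : L ⊆ M) (h : label K L M v ≤ 1) :
    v ∈ L := by
  by_contra h'
  have := (two_le_label hKL hLM).2 h'
  omega

theorem mem_of_label_le_two {v : V} (hKL : K ⊆ L) (hLM : L ⊆ M) (h : label K L M v ≤ 2) :
    v ∈ M := by
  by_contra h'
  have := (three_le_label hKL hLM).2 h'
  omega

/-- `T` connects `L` and `L \ K`, and leaves `L` only from `L \ K`. -/
structure Attached (T : Finset (Sym2 V)) (K L : Finset V) : Prop where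
  connOn : ConnOn T L
  connOn_sdiff : ConnOn T (L \ K)
  notMem : ∀ p q, s(p, q) ∈ T → p ∈ L → q ∉ L → p ∉ K

/-- `S` has the average of `S₀`, and the work that was done in `S₁` is intact. -/
structure Intact (S₀ S₁ : Fin r → Finset (Sym2 V)) (j : Fin r) (K : Finset V)
    (S : Fin r → Finset (Sym2 V)) : Prop where
  reassembles : Reassembles S₀ S
  eq_of_lt : ∀ i < j, S i = S₁ i
  cut_eq : ∀ U ⊆ K, S j ∩ cut U = S₁ j ∩ cut U

theorem Move.exists {m : Mask} {j : Fin r} {S S' : Fin r → Finset (Sym2 V)}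
    (h : Move m (label K L M) j S S') :
    ∃ a b p q, m.Admits (label K L M) a b p q ∧ s(p, q) ∈ S j ∧
      S' j = insert s(a, b) ((S j).erase s(p, q)) ∧
      ∀ S₀, Reassembles S₀ S → Reassembles S₀ S' ∧ (s(a, b) ≠ s(p, q) → s(a, b) ∉ S j) := by
  obtain ⟨k, a, b, p, q, hjk, hm, he, rfl⟩ := h
  exact ⟨a, b, p, q, hm, he.2.1, swap_apply_left hjk _ _, fun S₀ hS => ⟨hS.swap hjk he,
    fun hne => (hS.1 j).notMem_of_connected_insert_erase he.2.1 hne he.2.2.1⟩⟩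

/-- Positive labels keep both swapped edges away from K, so neither can lie in the cut of a subset
of K. -/
theorem Intact.move {m : Mask} (hm : m.Pos) {j : Fin r} {S₀ S₁ S S' : Fin r → Finset (Sym2 V)}
    (hKL : K ⊆ L) (hLM : L ⊆ M) (hS : Intact S₀ S₁ j K S)
    (h : Move m (label K L M) j S S') : Intact S₀ S₁ j K S' := by
  obtain ⟨a, b, p, q, ha, hf, he, hr⟩ := h.exists
  refine ⟨(hr _ hS.reassembles).1, fun i hi => ?_, fun U hU => ?_⟩
  · obtain ⟨k, a, b, p, q, hjk, -, -, rfl⟩ := h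
    rw [swap_apply_of_lt hjk hi, hS.eq_of_lt i hi]
  · rw [← hS.cut_eq U hU, he]
    obtain ⟨h1, -, h2, h3, -, h4⟩ := ha
    have ha := fun h => (one_le_label hKL hLM).1 (hm.1.trans h1) (hU h)
    have hb := fun h => (one_le_label hKL hLM).1 (h2 ▸ hm.2.1) (hU h)
    have hp := fun h => (one_le_label hKL hLM).1 (hm.2.2.trans h3) (hU h)
    have hq := fun h => (one_le_label hKL hLM (v := q)).1 (by omega) (hU h)
    exact insert_erase_inter (by rw [mem_cut]; tauto) (by rw [mem_cut]; tauto)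

/-- The edge given away ends outside M, so it is not needed inside L; the edge received avoids K, so
it cannot leave L from K. -/
theorem Attached.move {m : Mask} (hm : m.Pos) {j : Fin r} {S S' : Fin r → Finset (Sym2 V)}
    (hKL : K ⊆ L) (hLM : L ⊆ M) (hS : Attached (S j) K L)
    (h : Move m (label K L M) j S S') : Attached (S' j) K L := by
  obtain ⟨a, b, p, q, ⟨h1, -, h2, -, -, h4⟩, hf, he, -⟩ := h.exists
  have ha := (one_le_label hKL hLM).1 (hm.1.trans h1)
  have hb := (one_le_label hKL hLM).1 (h2 ▸ hm.2.1)
  have hq := (two_le_label hKL hLM (v := q)).1 (by omega)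
  rw [he]
  refine ⟨hS.connOn.insert_erase (by simp [hq]), hS.connOn_sdiff.insert_erase (by simp [hq]), ?_⟩
  intro c d hcd hc hd
  rcases Finset.mem_insert.1 hcd with hcd | hcd
  · rcases Sym2.eq_iff.1 hcd with ⟨rfl, rfl⟩ | ⟨rfl, rfl⟩ <;> assumption
  · exact hS.notMem c d (Finset.mem_erase.1 hcd).2 hc hd

/-- Take edges inside `M \ L`. -/
def Mask.inside : Mask := ⟨2, 2, 2, 2, 3⟩

/-- Take an edge between `L \ K` and `M \ L`. -/
def Mask.link : Mask := ⟨1, 1, 2, 1, 3⟩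

/-- Give away edges between `L \ K` and the complement of `M`. -/
def Mask.jump : Mask := ⟨2, 3, 3, 1, 1⟩

/-- Take edges outside `M`. -/
def Mask.outside : Mask := ⟨3, 3, 3, 2, 2⟩

variable {s t : V} {S₀ S₁ : Fin r → Finset (Sym2 V)} {x : Sym2 V → ℝ} {ε : ℝ} {j : Fin r}

/-- Two edges that leave a connected set cut off disjoint sides. -/
theorem IsSpanningTree.not_reach_both {T : Finset (Sym2 V)} (hT : IsSpanningTree T) {M : Finset V}
    (hM : ConnOn T M) {p q p' q' z : V} (hpq : s(p, q) ∈ T) (hpq' : s(p', q') ∈ T)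
    (hp : p ∈ M) (hp' : p' ∈ M) (hq : q ∉ M) (hq' : q' ∉ M) (hne : s(p, q) ≠ s(p', q'))
    (h : Reach (T.erase s(p, q)) q z) : ¬ Reach (T.erase s(p', q')) q' z := by
  intro h'
  -- M stays connected without p'q', so the side of q' misses M and is connected without pq. If z
  -- were on both sides, q' would be on the side of q, although p'q' attaches it to M, hence to p.
  have hout : ∀ y, Reach (T.erase s(p', q')) q' y → y ∉ M := fun y hy hyM =>
    hT.not_reach_erase hpq' ((hM.reach_erase (by simp [hq']) hp' hyM).trans hy.symm)
  have h1 : Reach (T.erase s(p, q)) q' z := by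
    refine h'.induct (P := fun y => Reach (T.erase s(p, q)) q' y) (.refl _) ?_
    intro x y hx ih hxy
    refine ih.trans (.of_mem (Finset.mem_erase.2 ⟨fun he => ?_, (Finset.mem_erase.1 hxy).2⟩))
    rcases Sym2.eq_iff.1 he with ⟨rfl, rfl⟩ | ⟨rfl, rfl⟩
    · exact hout _ hx hp
    · exact hout _ (hx.trans (.of_mem hxy)) hp
  exact hT.not_reach_erase hpq ((hM.reach_erase (by simp [hq]) hp hp').trans
    ((Reach.of_mem (Finset.mem_erase.2 ⟨hne.symm, hpq'⟩)).trans (h1.trans h.symm)))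

/-- `T` has an edge between `L \ K` and `M \ L`. -/
def Linked (T : Finset (Sym2 V)) (K L M : Finset V) : Prop :=
  ∃ a b, s(a, b) ∈ T ∧ a ∈ L ∧ a ∉ K ∧ b ∈ M ∧ b ∉ L

section Phases

/-- Since S j crosses δ(L) once, it connects V \ L. If it does not connect M \ L inside that set,
two of its vertices are joined by a detour outside L, and a later tree connected on M \ L allows a
detour edge, which must leave M \ L, to be exchanged for an edge inside. Each swap adds an edge
inside M \ L, and a tree has fewer than |M \ L| of them. -/
theorem sweeps_inside (h : IsInput s t S₀ x ε) (hKL : K ⊂ L) (hLM : L ⊂ M)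
    (hL : Relevant s r x ε j L) (hM : Relevant s r x ε j M) {vs : List V} (hvs : ∀ v, v ∈ vs)
    {S : Fin r → Finset (Sym2 V)} (hS : Intact S₀ S₁ j K S)
    (hA : Attached (S j) K L) (hc : (S j ∩ cut L).card = 1) :
    (Intact S₀ S₁ j K (sweeps vs .inside (label K L M) j S) ∧
      Attached (sweeps vs .inside (label K L M) j S j) K L) ∧
      ConnOn (sweeps vs .inside (label K L M) j S j) (M \ L) := by
  have hKL := hKL.1
  have hLM' := hLM.1
  have key := sweeps_spec (S := S) hvs (M := .inside) (ℓ := label K L M) (j := j)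
    (fun S => (Intact S₀ S₁ j K S ∧ Attached (S j) K L) ∧ (S j ∩ cut L).card = 1)
    (fun S => ConnOn (S j) (M \ L)) (fun S => (M \ L).card - (S j ∩ inner (M \ L)).card)
    ?_ ?_ ⟨⟨hS, hA⟩, hc⟩ ((Nat.sub_le _ _).trans (Finset.card_le_univ _))
  · exact ⟨key.1.1, key.2⟩
  · rintro S S' ⟨⟨hS, hA⟩, hc⟩ hmv
    have hpos : Mask.inside.Pos := ⟨by decide, by decide, by decide⟩
    refine ⟨⟨⟨hS.move hpos hKL hLM' hmv, hA.move hpos hKL hLM' hmv⟩, ?_⟩, ?_⟩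
    all_goals
      have hmv' := hmv
      obtain ⟨a, b, p, q, hm, hf, he, hr⟩ := hmv.exists
      have hin := hS.reassembles.1 j
      rw [he]
      simp only [Mask.Admits, Mask.inside] at hm
      obtain ⟨h1, h1', h2, h3, -, h4⟩ := hm
      have ha := (two_le_label hKL hLM').1 h1
      have hb := (two_le_label hKL hLM').1 h2.ge
      have hp := (two_le_label hKL hLM').1 h3
      have hq := (three_le_label hKL hLM').1 h4.ge
      have hqL : q ∉ L := fun h => hq (hLM' h)
    · rw [insert_erase_inter (by simp [ha, hb]) (by simp [hp, hqL])]
      exact hc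
    · refine ⟨fun hQ => hQ.insert_erase (by simp [hq]), ?_⟩
      have haM : a ∈ M := mem_of_label_le_two hKL hLM' h1'
      have hbM : b ∈ M := mem_of_label_le_two hKL hLM' h2.le
      have hne : s(a, b) ≠ s(p, q) := by
        rintro h
        rcases Sym2.eq_iff.1 h with ⟨rfl, rfl⟩ | ⟨rfl, rfl⟩ <;> contradiction
      have heS := (hr _ hS.reassembles).2 hne
      have hab : a ≠ b := by
        obtain ⟨h1, h2⟩ := hr _ hS.reassembles
        exact (h1.1 j).ne (he ▸ Finset.mem_insert_self _ _)
      have h5 := card_lt_card_insert_erase_inter (T := S j) (F := inner (M \ L)) (e := s(a, b))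
        (f := s(p, q)) (by simp [ha, hb, haM, hbM, hab]) heS (by simp [hq])
      have h6 := (((hr _ hS.reassembles).1).1 j).card_inner_add_one_le
        (Finset.sdiff_nonempty.2 hLM.2)
      rw [he] at h6
      omega
  · rintro S ⟨⟨hS, hA⟩, hc⟩ hQ
    have hT := hS.reassembles.1 j
    obtain ⟨k, hjk, hk⟩ := hM.exists_later_connOn h hS.reassembles hLM (Or.inr hL) hQ
    unfold ConnOn at hQ
    push Not at hQ
    obtain ⟨u, hu, v, hv, huv⟩ := hQ
    obtain ⟨p₀, q₀, hp₀, -, hpq₀⟩ := cut_eq_of_card_eq_one hc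
    have hD := hT.connOn_compl_of_cut_eq hpq₀ hp₀
    rw [Finset.mem_sdiff] at hu hv
    obtain ⟨p, q, a, b, hpq, hpqZ, hab, habZ, -, -, hc1, hc2⟩ := hT.exists_exchange
      (hS.reassembles.1 k) (H := S j ∩ inner Lᶜ) Finset.inter_subset_left hk
      (κ := fun y => y ∈ M \ L ∧ Reach (S j ∩ inner (M \ L)) u y) (u := u) (v := v) (by
        rintro c d ⟨hc, hr⟩ hd hcd
        rw [Finset.mem_inter] at hcd
        refine ⟨hd, hr.trans (.of_mem (Finset.mem_inter.2 ⟨hcd.1, ?_⟩))⟩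
        rw [mem_inner]
        exact ⟨hT.ne hcd.1, hc, hd⟩) (fun _ h => h.1) ⟨by simpa using hu, .refl _⟩
          (by simpa using hv)
      (fun h => huv h.2) (hD u (by simp [hu.2]) v (by simp [hv.2]))
    rw [Finset.mem_inter, mem_inner, Finset.mem_compl, Finset.mem_compl] at hpq
    rw [mem_inner, Finset.mem_sdiff, Finset.mem_sdiff] at habZ
    have hlab := label_eq_two hKL hLM' habZ.2.1.1 habZ.2.1.2
    have hlab' := label_eq_two hKL hLM' habZ.2.2.1 habZ.2.2.2
    have lp := (two_le_label hKL hLM').2 hpq.2.2.1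
    have lq := (two_le_label hKL hLM').2 hpq.2.2.2
    have lp' := label_le_three (K := K) (L := L) (M := M) p
    have lq' := label_le_three (K := K) (L := L) (M := M) q
    by_cases hq : q ∈ M
    · have hp : p ∉ M := fun hp => hpqZ (by
        rw [mem_inner, Finset.mem_sdiff, Finset.mem_sdiff]
        exact ⟨hpq.2.1, ⟨hp, hpq.2.2.1⟩, hq, hpq.2.2.2⟩)
      have lp3 := (three_le_label hKL hLM').2 hp
      refine ⟨_, k, a, b, q, p, hjk, ⟨hlab.ge, hlab.le, hlab', lq, lq', by omega⟩, ?_, rfl⟩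
      rw [Sym2.eq_swap (a := q)]
      exact ⟨hab, hpq.1, hc1, hc2⟩
    · have lq3 := (three_le_label hKL hLM').2 hq
      exact ⟨_, k, a, b, p, q, hjk, ⟨hlab.ge, hlab.le, hlab', lp, lp', by omega⟩,
        ⟨hab, hpq.1, hc1, hc2⟩, rfl⟩

/-- Without a link, S j does not connect M \ K, but some later tree does. The exchange inside M \ K
uses only edges of S j not inside L, and the edge received must be a link. One move already achieves
the goal; the potential only serves the general search lemma. -/
theorem sweeps_link (h : IsInput s t S₀ x ε) (hKL : K ⊂ L) (hLM : L ⊂ M)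
    (hK : K = ∅ ∨ Relevant s r x ε j K) (hM : Relevant s r x ε j M) {vs : List V}
    (hvs : ∀ v, v ∈ vs)
    {S : Fin r → Finset (Sym2 V)} (hS : Intact S₀ S₁ j K S)
    (hA : Attached (S j) K L) (hW : ConnOn (S j) (M \ L)) :
    (Intact S₀ S₁ j K (sweeps vs .link (label K L M) j S) ∧
      Attached (sweeps vs .link (label K L M) j S j) K L ∧
      ConnOn (sweeps vs .link (label K L M) j S j) (M \ L)) ∧
      Linked (sweeps vs .link (label K L M) j S j) K L M := by
  have hKL' := hKL.1
  have hLM' := hLM.1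
  refine sweeps_spec (S := S) hvs (M := .link) (ℓ := label K L M) (j := j)
    (fun S => Intact S₀ S₁ j K S ∧ Attached (S j) K L ∧ ConnOn (S j) (M \ L))
    (fun S => Linked (S j) K L M) (fun S => M.card - (S j ∩ inner M).card)
    ?_ ?_ ⟨hS, hA, hW⟩ ((Nat.sub_le _ _).trans (Finset.card_le_univ _))
  · rintro S S' ⟨hS, hA, hW⟩ hmv
    have hpos : Mask.link.Pos := ⟨by decide, by decide, by decide⟩
    obtain ⟨a, b, p, q, hm, hf, he, hr⟩ := hmv.exists
    simp only [Mask.Admits, Mask.link] at hm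
    obtain ⟨h1, h1', h2, -, -, h4⟩ := hm
    have haK := (one_le_label hKL' hLM').1 h1
    have haL := mem_of_label_le_one hKL' hLM' h1'
    have hbL := (two_le_label hKL' hLM').1 h2.ge
    have hbM := mem_of_label_le_two hKL' hLM' h2.le
    have hq := (three_le_label hKL' hLM').1 h4.ge
    have hl : Linked (S' j) K L M :=
      ⟨a, b, he ▸ Finset.mem_insert_self _ _, haL, haK, hbM, hbL⟩
    refine ⟨⟨hS.move hpos hKL' hLM' hmv, hA.move hpos hKL' hLM' hmv, ?_⟩, fun _ => hl, ?_⟩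
    · rw [he]
      exact hW.insert_erase (by simp [hq])
    · have hne : s(a, b) ≠ s(p, q) := by
        rintro h
        rcases Sym2.eq_iff.1 h with ⟨rfl, rfl⟩ | ⟨rfl, rfl⟩
        · exact hq hbM
        · exact hq (hLM' haL)
      have hab : a ≠ b := fun e => hbL (e ▸ haL)
      have h5 := card_lt_card_insert_erase_inter (T := S j) (F := inner M) (e := s(a, b))
        (f := s(p, q)) (by simp [hLM' haL, hbM, hab]) ((hr _ hS.reassembles).2 hne) (by simp [hq])
      have h6 := ((hr _ hS.reassembles).1.1 j).card_inner_add_one_le (Z := M) ⟨b, hbM⟩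
      rw [he] at h6 ⊢
      omega
  · rintro S ⟨hS, hA, hW⟩ hQ
    have hT := hS.reassembles.1 j
    obtain ⟨u, huL, huK⟩ := Finset.exists_of_ssubset hKL
    obtain ⟨v, hvM, hvL⟩ := Finset.exists_of_ssubset hLM
    have hclosed : ∀ a b, a ∈ L \ K → b ∈ M \ K → s(a, b) ∈ S j → b ∈ L \ K := by
      intro a b ha hb hab
      rw [Finset.mem_sdiff] at ha hb ⊢
      refine ⟨?_, hb.2⟩
      by_contra hbL
      exact hQ ⟨a, b, hab, ha.1, ha.2, hb.1, hbL⟩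
    have hZ : ¬ ConnOn (S j) (M \ K) := by
      intro hZ
      have := (hZ u (by simp [hLM' huL, huK]) v (by simpa [hvM] using fun h => hvL (hKL' h))).induct
        (P := fun y => y ∈ L \ K) (by simp [huL, huK]) (by
          intro a b _ ha hab
          rw [Finset.mem_inter, mem_inner] at hab
          exact hclosed a b ha hab.2.2.2 hab.1)
      exact hvL (Finset.mem_sdiff.1 this).1
    obtain ⟨k, hjk, hk⟩ := hM.exists_later_connOn h hS.reassembles (hKL.trans hLM) hK hZ
    -- After its last visit to L the walk has left from L \ K, and from there on it uses no edge
    -- inside L.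
    have hp₀ : v ∈ L ∨ ∃ p₀ ∈ L \ K, Reach (S j \ inner L) p₀ v := by
      refine (hT.reach u v).induct
        (P := fun y => y ∈ L ∨ ∃ p₀ ∈ L \ K, Reach (S j \ inner L) p₀ y) (Or.inl huL) ?_
      intro y z _ hy hyz
      by_cases hz : z ∈ L
      · exact Or.inl hz
      · have hmem : s(y, z) ∈ S j \ inner L := Finset.mem_sdiff.2 ⟨hyz, by simp [hz]⟩
        by_cases hyL : y ∈ L
        · exact Or.inr ⟨y, Finset.mem_sdiff.2 ⟨hyL, hA.notMem y z hyz hyL hz⟩, .of_mem hmem⟩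
        · obtain ⟨p₀, h1, h2⟩ := hy.resolve_left hyL
          exact Or.inr ⟨p₀, h1, h2.trans (.of_mem hmem)⟩
    obtain ⟨p₀, hp₀, hr⟩ := hp₀.resolve_left hvL
    have hsub : L \ K ⊆ M \ K := Finset.sdiff_subset_sdiff hLM' (Finset.Subset.refl _)
    have hsub' : M \ L ⊆ M \ K := Finset.sdiff_subset_sdiff (Finset.Subset.refl _) hKL'
    obtain ⟨p, q, a, b, hpq, hpqZ, hab, habZ, ha, hb, hc1, hc2⟩ := hT.exists_exchange
      (hS.reassembles.1 k) (H := S j \ inner L) Finset.sdiff_subset hk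
      (κ := fun y => y ∈ L \ K) (fun c d hc hd hcd => hclosed c d hc hd (Finset.mem_sdiff.1 hcd).1)
      (fun _ h => hsub h) hp₀ (v := v) (by simpa [hvM] using fun h => hvL (hKL' h))
      (by simp [hvL]) hr
    rw [Finset.mem_sdiff] at hpq
    -- Both L \ K and M \ L stay connected when pq is removed, so ab, whose ends lie on different
    -- sides of pq, is inside neither and joins the two.
    have hneg : ∀ Z ⊆ M \ K, ConnOn (S j) Z → ¬ (a ∈ Z ∧ b ∈ Z) := fun Z hZ hc hab =>
      ha (hb.trans (hc.reach_erase (fun h => hpqZ (inner_mono hZ h)) hab.2 hab.1))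
    have hn1 := hneg _ hsub hA.connOn_sdiff
    have hn2 := hneg _ hsub' hW
    rw [mem_inner] at habZ
    obtain ⟨-, haZ, hbZ⟩ := habZ
    rw [Finset.mem_sdiff] at haZ hbZ
    rw [Finset.mem_sdiff, Finset.mem_sdiff] at hn1 hn2
    have lab : ∃ a' b', s(a', b') = s(a, b) ∧ label K L M a' = 1 ∧ label K L M b' = 2 := by
      by_cases haL : a ∈ L
      · have hbL : b ∉ L := fun h => hn1 ⟨⟨haL, haZ.2⟩, h, hbZ.2⟩
        exact ⟨a, b, rfl, label_eq_one hKL' hLM' haL haZ.2, label_eq_two hKL' hLM' hbZ.1 hbL⟩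
      · have hbL : b ∈ L := by
          by_contra hbL
          exact hn2 ⟨⟨haZ.1, haL⟩, hbZ.1, hbL⟩
        exact ⟨b, a, Sym2.eq_swap, label_eq_one hKL' hLM' hbL hbZ.2,
          label_eq_two hKL' hLM' haZ.1 haL⟩
    have hpqne := hT.ne hpq.1
    have notK : ∀ c d, s(c, d) = s(p, q) → c ∉ K := by
      intro c d hcd hc
      by_cases hd : d ∈ L
      · refine hpq.2 (hcd ▸ ?_)
        rw [mem_inner]
        refine ⟨?_, hKL' hc, hd⟩
        rcases Sym2.eq_iff.1 hcd with ⟨rfl, rfl⟩ | ⟨rfl, rfl⟩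
        · exact hpqne
        · exact hpqne.symm
      · exact hA.notMem c d (hcd ▸ hpq.1) (hKL' hc) hd hc
    have hpK := notK p q rfl
    have hqK := notK q p Sym2.eq_swap
    have lab' : ∃ p' q', s(p', q') = s(p, q) ∧ 1 ≤ label K L M p' ∧ label K L M q' = 3 := by
      by_cases hqM : q ∈ M
      · have hpM : p ∉ M := fun hpM => hpqZ (by
          rw [mem_inner, Finset.mem_sdiff, Finset.mem_sdiff]
          exact ⟨hpqne, ⟨hpM, hpK⟩, hqM, hqK⟩)
        exact ⟨q, p, Sym2.eq_swap, (one_le_label hKL' hLM').2 hqK, label_eq_three hKL' hLM' hpM⟩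
      · exact ⟨p, q, rfl, (one_le_label hKL' hLM').2 hpK, label_eq_three hKL' hLM' hqM⟩
    obtain ⟨a', b', h1, h2, h3⟩ := lab
    obtain ⟨p', q', h4, h5, h6⟩ := lab'
    refine ⟨_, k, a', b', p', q', hjk, ⟨h2.ge, h2.le, h3, h5, label_le_three _, h6⟩, ?_, rfl⟩
    rw [h1, h4]
    exact ⟨hab, hpq.1, hc1, hc2⟩

/-- Let pq lead from L to V \ M, and let a later tree have no such edge. Its walk from p to q enters
the side of q at a vertex outside M, through an edge that therefore does not start in L. Swapping
this edge for pq removes one forbidden edge and creates none. -/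
theorem sweeps_jump (h : IsInput s t S₀ x ε) (hKL : K ⊂ L) (hLM : L ⊂ M) (hL : Relevant s r x ε j L)
    (hM : Relevant s r x ε j M) {vs : List V} (hvs : ∀ v, v ∈ vs)
    {S : Fin r → Finset (Sym2 V)} (hS : Intact S₀ S₁ j K S)
    (hA : Attached (S j) K L) (hW : ConnOn (S j) (M \ L)) (hl : Linked (S j) K L M) :
    (Intact S₀ S₁ j K (sweeps vs .jump (label K L M) j S) ∧
      Attached (sweeps vs .jump (label K L M) j S j) K L ∧
      ConnOn (sweeps vs .jump (label K L M) j S j) (M \ L) ∧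
      Linked (sweeps vs .jump (label K L M) j S j) K L M) ∧
      sweeps vs .jump (label K L M) j S j ∩ (cut L ∩ cut M) = ∅ := by
  have hKL' := hKL.1
  have hLM' := hLM.1
  refine sweeps_spec (S := S) hvs (M := .jump) (ℓ := label K L M) (j := j)
    (fun S => Intact S₀ S₁ j K S ∧ Attached (S j) K L ∧ ConnOn (S j) (M \ L) ∧
      Linked (S j) K L M)
    (fun S => S j ∩ (cut L ∩ cut M) = ∅) (fun S => (S j ∩ (cut L ∩ cut M)).card)
    ?_ ?_ ⟨hS, hA, hW, hl⟩ ?_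
  · rintro S S' ⟨hS, hA, hW, hl⟩ hmv
    have hpos : Mask.jump.Pos := ⟨by decide, by decide, by decide⟩
    obtain ⟨a, b, p, q, hm, hf, he, hr⟩ := hmv.exists
    simp only [Mask.Admits, Mask.jump] at hm
    obtain ⟨h1, -, h2, h3, h3', h4⟩ := hm
    have haL := (two_le_label hKL' hLM').1 h1
    have hbM := (three_le_label hKL' hLM').1 h2.ge
    have hbL : b ∉ L := fun h => hbM (hLM' h)
    have hpL := mem_of_label_le_one hKL' hLM' h3'
    have hq := (three_le_label hKL' hLM').1 h4.ge
    have hqL : q ∉ L := fun h => hq (hLM' h)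
    have hlt : (S' j ∩ (cut L ∩ cut M)).card < (S j ∩ (cut L ∩ cut M)).card := by
      rw [he]
      exact card_insert_erase_inter_lt (by simp [haL, hbL]) (by simp [hpL, hq, hqL, hLM' hpL]) hf
    refine ⟨⟨hS.move hpos hKL' hLM' hmv, hA.move hpos hKL' hLM' hmv, ?_, ?_⟩, fun h0 => ?_, hlt⟩
    · rw [he]
      exact hW.insert_erase (by simp [hq])
    · obtain ⟨c, d, hcd, hcL, hcK, hdM, hdL⟩ := hl
      refine ⟨c, d, he ▸ Finset.mem_insert_of_mem (Finset.mem_erase.2 ⟨fun h => ?_, hcd⟩), hcL, hcK,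
        hdM, hdL⟩
      rcases Sym2.eq_iff.1 h with ⟨rfl, rfl⟩ | ⟨rfl, rfl⟩ <;> contradiction
    · rw [h0] at hlt
      simp at hlt
  · rintro S ⟨hS, hA, hW, hl⟩ hQ
    have hT := hS.reassembles.1 j
    obtain ⟨k, hjk, hk⟩ := hL.exists_later_inter_eq_empty h hS.reassembles hLM hM hQ
    obtain ⟨f, hf⟩ := Finset.nonempty_iff_ne_empty.2 hQ
    rw [Finset.mem_inter, Finset.mem_inter] at hf
    obtain ⟨hfT, hfL, hfM⟩ := hf
    obtain ⟨p, q, hpL, hqL, rfl⟩ := exists_of_mem_cut hfL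
    have hqM : q ∉ M := by
      rw [mem_cut] at hfM
      have := hLM' hpL
      tauto
    have hnot : ¬ Reach ((S j).erase s(p, q)) q p := fun h => hT.not_reach_erase hfT h.symm
    obtain ⟨a, b, ha, hb, hab, hpa, hbq⟩ := exists_crossing
      (K := Reach ((S j).erase s(p, q)) q) ((hS.reassembles.1 k).reach p q) hnot (.refl _)
    -- L, M \ L and the link hold M together without pq, so all of M stays on the side of p.
    have hside : ∀ y ∈ M, ¬ Reach ((S j).erase s(p, q)) q y := by
      intro y hy hr
      have hLr : ∀ z ∈ L, Reach ((S j).erase s(p, q)) z p := fun z hz =>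
        hA.connOn.reach_erase (by simp [hqL]) hz hpL
      refine hnot (hr.trans ?_)
      by_cases hyL : y ∈ L
      · exact hLr y hyL
      · obtain ⟨c, d, hcd, hcL, -, hdM, hdL⟩ := hl
        refine (hW.reach_erase (by simp [hqM]) (by simp [hy, hyL]) (v := d)
          (by simp [hdM, hdL])).trans (Reach.trans (.of_mem ?_) (hLr c hcL))
        rw [Sym2.eq_swap (a := d), Finset.mem_erase]
        refine ⟨fun h => ?_, hcd⟩
        rcases Sym2.eq_iff.1 h with ⟨rfl, rfl⟩ | ⟨rfl, rfl⟩ <;> contradiction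
    have hbM : b ∉ M := fun h => hside b h hb
    have haL : a ∉ L := by
      intro haL
      have : s(a, b) ∈ S k ∩ (cut L ∩ cut M) := by
        rw [Finset.mem_inter, Finset.mem_inter, mem_cut, mem_cut]
        exact ⟨hab, Or.inl ⟨haL, fun h => hbM (hLM' h)⟩, Or.inl ⟨hLM' haL, hbM⟩⟩
      simp [hk] at this
    have h4 := hT.exchange (hS.reassembles.1 k) hfT hab ha hb hpa hbq
    have lp := label_eq_one hKL' hLM' hpL (hA.notMem p q hfT hpL hqL)
    exact ⟨_, k, a, b, p, q, hjk, ⟨(two_le_label hKL' hLM').2 haL, label_le_three _,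
      label_eq_three hKL' hLM' hbM, lp.ge, lp.le, label_eq_three hKL' hLM' hqM⟩,
      ⟨hab, hfT, h4.1, h4.2⟩, rfl⟩
  · have h1 := (hS.reassembles.1 j).card_add_one
    have h2 := Finset.card_le_card (Finset.inter_subset_left (s₁ := S j) (s₂ := cut L ∩ cut M))
    omega

/-- S j is now connected on M. If it has two edges in δ(M), a later tree has just one, with outer
end z. Giving away an edge pq whose far side misses z, the later tree's walk from p to q enters that
side through an edge with both ends outside M. The end p is not in L because no edge leads from L
out of M. -/
theorem sweeps_outside (h : IsInput s t S₀ x ε) (hKL : K ⊂ L) (hLM : L ⊂ M)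
    (hM : Relevant s r x ε j M) {vs : List V} (hvs : ∀ v, v ∈ vs)
    {S : Fin r → Finset (Sym2 V)} (hS : Intact S₀ S₁ j K S)
    (hA : Attached (S j) K L) (hW : ConnOn (S j) (M \ L)) (hl : Linked (S j) K L M)
    (hJ : S j ∩ (cut L ∩ cut M) = ∅) :
    (Intact S₀ S₁ j K (sweeps vs .outside (label K L M) j S) ∧
      Attached (sweeps vs .outside (label K L M) j S j) K L ∧
      ConnOn (sweeps vs .outside (label K L M) j S j) (M \ L) ∧
      Linked (sweeps vs .outside (label K L M) j S j) K L M ∧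
      sweeps vs .outside (label K L M) j S j ∩ (cut L ∩ cut M) = ∅) ∧
      (sweeps vs .outside (label K L M) j S j ∩ cut M).card = 1 := by
  have hKL' := hKL.1
  have hLM' := hLM.1
  refine sweeps_spec (S := S) hvs (M := .outside) (ℓ := label K L M) (j := j)
    (fun S => Intact S₀ S₁ j K S ∧ Attached (S j) K L ∧ ConnOn (S j) (M \ L) ∧
      Linked (S j) K L M ∧ S j ∩ (cut L ∩ cut M) = ∅)
    (fun S => (S j ∩ cut M).card = 1) (fun S => (S j ∩ cut M).card)
    ?_ ?_ ⟨hS, hA, hW, hl, hJ⟩ ?_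
  · rintro S S' ⟨hS, hA, hW, hl, hJ⟩ hmv
    have hpos : Mask.outside.Pos := ⟨by decide, by decide, by decide⟩
    obtain ⟨a, b, p, q, hm, hf, he, hr⟩ := hmv.exists
    simp only [Mask.Admits, Mask.outside] at hm
    obtain ⟨h1, -, h2, h3, h3', h4⟩ := hm
    have haM := (three_le_label hKL' hLM').1 h1
    have hbM := (three_le_label hKL' hLM').1 h2.ge
    have haL : a ∉ L := fun h => haM (hLM' h)
    have hbL : b ∉ L := fun h => hbM (hLM' h)
    have hpL := (two_le_label hKL' hLM').1 h3
    have hpM := mem_of_label_le_two hKL' hLM' h3'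
    have hq := (three_le_label hKL' hLM').1 h4.ge
    have hqL : q ∉ L := fun h => hq (hLM' h)
    have hlt : (S' j ∩ cut M).card < (S j ∩ cut M).card := by
      rw [he]
      exact card_insert_erase_inter_lt (by simp [haM, hbM]) (by simp [hpM, hq]) hf
    have hge := ((hr _ hS.reassembles).1.1 j).one_le_card_cut ⟨s, hM.1⟩ hM.2.1
    refine ⟨⟨hS.move hpos hKL' hLM' hmv, hA.move hpos hKL' hLM' hmv, ?_, ?_, ?_⟩, fun h0 => ?_, hlt⟩
    · rw [he]
      exact hW.insert_erase (by simp [hq])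
    · obtain ⟨c, d, hcd, hcL, hcK, hdM, hdL⟩ := hl
      refine ⟨c, d, he ▸ Finset.mem_insert_of_mem (Finset.mem_erase.2 ⟨fun h => ?_, hcd⟩), hcL, hcK,
        hdM, hdL⟩
      rcases Sym2.eq_iff.1 h with ⟨rfl, rfl⟩ | ⟨rfl, rfl⟩ <;> contradiction
    · rw [he, insert_erase_inter (by simp [haL, hbL]) (by simp [hpL, hqL]), hJ]
    · omega
  · rintro S ⟨hS, hA, hW, hl, hJ⟩ hQ
    have hT := hS.reassembles.1 j
    have hconn : ConnOn (S j) M := by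
      obtain ⟨c, d, hcd, hcL, -, hdM, hdL⟩ := hl
      have key : ∀ y ∈ M, Reach (S j ∩ inner M) c y := by
        intro y hy
        by_cases hyL : y ∈ L
        · exact (hA.connOn c hcL y hyL).mono
            (Finset.inter_subset_inter_left (inner_mono hLM'))
        · refine Reach.trans (.of_mem (Finset.mem_inter.2 ⟨hcd, ?_⟩))
            ((hW d (by simp [hdM, hdL]) y (by simp [hy, hyL])).mono
              (Finset.inter_subset_inter_left (inner_mono Finset.sdiff_subset)))
          rw [mem_inner]
          exact ⟨hT.ne hcd, hLM' hcL, hdM⟩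
      exact fun u hu v hv => (key u hu).symm.trans (key v hv)
    obtain ⟨k, hjk, hk⟩ := hM.exists_later_cut h hS.reassembles hQ
    obtain ⟨p₀, z, hp₀, hz, hpz⟩ := cut_eq_of_card_eq_one hk
    have hge := hT.one_le_card_cut ⟨s, hM.1⟩ hM.2.1
    obtain ⟨f₁, hf₁, f₂, hf₂, hne⟩ := Finset.one_lt_card.1 (show 1 < (S j ∩ cut M).card by omega)
    rw [Finset.mem_inter] at hf₁ hf₂
    obtain ⟨p₁, q₁, hp₁, hq₁, rfl⟩ := exists_of_mem_cut hf₁.2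
    obtain ⟨p₂, q₂, hp₂, hq₂, rfl⟩ := exists_of_mem_cut hf₂.2
    -- The far sides of two edges leaving M are disjoint, so z is missed by at least one of them.
    obtain ⟨p, q, hpM, hqM, hpq, hzK⟩ : ∃ p q, p ∈ M ∧ q ∉ M ∧ s(p, q) ∈ S j ∧
        ¬ Reach ((S j).erase s(p, q)) q z := by
      by_cases h1 : Reach ((S j).erase s(p₁, q₁)) q₁ z
      · exact ⟨p₂, q₂, hp₂, hq₂, hf₂.1, hT.not_reach_both hconn hf₁.1 hf₂.1 hp₁ hp₂ hq₁ hq₂ hne h1⟩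
      · exact ⟨p₁, q₁, hp₁, hq₁, hf₁.1, h1⟩
    have hnot : ¬ Reach ((S j).erase s(p, q)) q p := fun h => hT.not_reach_erase hpq h.symm
    obtain ⟨a, b, ha, hb, hab, hpa, hbq⟩ := exists_crossing
      (K := Reach ((S j).erase s(p, q)) q) ((hS.reassembles.1 k).reach p q) hnot (.refl _)
    have hbM : b ∉ M := fun hbM =>
      hnot (hb.trans (hconn.reach_erase (by simp [hqM]) hbM hpM))
    have haM : a ∉ M := by
      intro haM
      have h1 : s(a, b) ∈ S k ∩ cut M := by
        rw [Finset.mem_inter, mem_cut]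
        exact ⟨hab, Or.inl ⟨haM, hbM⟩⟩
      rw [hpz, Finset.mem_singleton] at h1
      rcases Sym2.eq_iff.1 h1 with ⟨rfl, rfl⟩ | ⟨rfl, rfl⟩
      · exact hzK hb
      · exact hbM hp₀
    have hpL : p ∉ L := by
      intro hpL
      have h1 : s(p, q) ∈ S j ∩ (cut L ∩ cut M) := by
        rw [Finset.mem_inter, Finset.mem_inter, mem_cut, mem_cut]
        exact ⟨hpq, Or.inl ⟨hpL, fun h => hqM (hLM' h)⟩, Or.inl ⟨hpM, hqM⟩⟩
      simp [hJ] at h1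
    have h4 := hT.exchange (hS.reassembles.1 k) hpq hab ha hb hpa hbq
    have lp := label_eq_two hKL' hLM' hpM hpL
    exact ⟨_, k, a, b, p, q, hjk, ⟨(three_le_label hKL' hLM').2 haM, label_le_three _,
      label_eq_three hKL' hLM' hbM, lp.ge, lp.le, label_eq_three hKL' hLM' hqM⟩,
      ⟨hab, hpq, h4.1, h4.2⟩, rfl⟩
  · have h1 := (hS.reassembles.1 j).card_add_one
    have h2 := Finset.card_le_card (Finset.inter_subset_left (s₁ := S j) (s₂ := cut M))
    omega

/-- All swaps that make `S j` cross `M` only once, when it crosses `L` only once. -/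
noncomputable def stage (vs : List V) (j : Fin r) (K L M : Finset V)
    (S : Fin r → Finset (Sym2 V)) : Fin r → Finset (Sym2 V) :=
  sweeps vs .outside (label K L M) j (sweeps vs .jump (label K L M) j
    (sweeps vs .link (label K L M) j (sweeps vs .inside (label K L M) j S)))

/-- The link phase may add edges to δ(L), so the single crossing of L is not an invariant
throughout. It is recovered at the end from the structure inside M. -/
theorem stage_spec (h : IsInput s t S₀ x ε) (hKL : K ⊂ L) (hLM : L ⊂ M)
    (hK : K = ∅ ∨ Relevant s r x ε j K) (hL : Relevant s r x ε j L) (hM : Relevant s r x ε j M)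
    {vs : List V} (hvs : ∀ v, v ∈ vs)
    {S : Fin r → Finset (Sym2 V)} (hS : Intact S₀ S₁ j K S)
    (hA : Attached (S j) K L) (hc : (S j ∩ cut L).card = 1) :
    Intact S₀ S₁ j K (stage vs j K L M S) ∧ Attached (stage vs j K L M S j) L M ∧
      (stage vs j K L M S j ∩ cut L).card = 1 ∧ (stage vs j K L M S j ∩ cut M).card = 1 := by
  have hKL' := hKL.1
  have hLM' := hLM.1
  obtain ⟨⟨a1, a2⟩, a3⟩ := sweeps_inside h hKL hLM hL hM hvs hS hA hc
  obtain ⟨⟨b1, b2, b3⟩, b4⟩ := sweeps_link h hKL hLM hK hM hvs a1 a2 a3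
  obtain ⟨⟨c1, c2, c3, c4⟩, c5⟩ := sweeps_jump h hKL hLM hL hM hvs b1 b2 b3 b4
  obtain ⟨⟨d1, d2, d3, d4, d5⟩, d6⟩ := sweeps_outside h hKL hLM hM hvs c1 c2 c3 c4 c5
  change Intact S₀ S₁ j K (stage vs j K L M S) at d1
  change Attached (stage vs j K L M S j) K L at d2
  change ConnOn (stage vs j K L M S j) (M \ L) at d3
  change Linked (stage vs j K L M S j) K L M at d4
  change stage vs j K L M S j ∩ (cut L ∩ cut M) = ∅ at d5
  change (stage vs j K L M S j ∩ cut M).card = 1 at d6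
  set T := stage vs j K L M S j
  have hT : IsSpanningTree T := d1.reassembles.1 j
  obtain ⟨c, d, hcd, hcL, -, hdM, hdL⟩ := d4
  have hleave : ∀ p q, s(p, q) ∈ T → p ∈ L → q ∉ L → q ∈ M := by
    intro p q hpq hp hq
    by_contra hqM
    have : s(p, q) ∈ T ∩ (cut L ∩ cut M) := by
      rw [Finset.mem_inter, Finset.mem_inter, mem_cut, mem_cut]
      exact ⟨hpq, Or.inl ⟨hp, hq⟩, Or.inl ⟨hLM' hp, hqM⟩⟩
    simp [d5] at this
  have hconn : ConnOn T M := by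
    have key : ∀ y ∈ M, Reach (T ∩ inner M) c y := by
      intro y hy
      by_cases hyL : y ∈ L
      · exact (d2.connOn c hcL y hyL).mono (Finset.inter_subset_inter_left (inner_mono hLM'))
      · refine Reach.trans (.of_mem (Finset.mem_inter.2 ⟨hcd, ?_⟩))
          ((d3 d (by simp [hdM, hdL]) y (by simp [hy, hyL])).mono
            (Finset.inter_subset_inter_left (inner_mono Finset.sdiff_subset)))
        rw [mem_inner]
        exact ⟨hT.ne hcd, hLM' hcL, hdM⟩
    exact fun u hu v hv => (key u hu).symm.trans (key v hv)
  refine ⟨d1, ⟨hconn, d3, fun p q hpq hp hq hpL => ?_⟩, ?_, d6⟩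
  · exact hq (hleave p q hpq hpL fun h => hq (hLM' h))
  · rw [Finset.card_eq_one]
    refine ⟨s(c, d), Finset.eq_singleton_iff_unique_mem.2 ⟨Finset.mem_inter.2 ⟨hcd, ?_⟩, ?_⟩⟩
    · rw [mem_cut]
      exact Or.inl ⟨hcL, hdL⟩
    · intro f hf
      rw [Finset.mem_inter] at hf
      obtain ⟨p, q, hp, hq, rfl⟩ := exists_of_mem_cut hf.2
      -- A second edge from L to M \ L would close a cycle with the link, as S j connects both sets
      -- inside.
      by_contra hne
      have hqM := hleave p q hf.1 hp hq
      refine hT.not_reach_erase hf.1 ((d2.connOn.reach_erase (by simp [hq]) hp hcL).trans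
        ((Reach.of_mem (Finset.mem_erase.2 ⟨Ne.symm hne, hcd⟩)).trans
          (d3.reach_erase (by simp [hp]) (by simp [hdM, hdL]) (by simp [hqM, hq]))))

end Phases

end Stage

/-! ### Finding the chain, and correctness of the whole procedure -/

section Algorithm

variable {V : Type*} [Fintype V] [DecidableEq V] {r : ℕ}

open Classical in
/-- The vertices that are reached from `s` in `T` without the edge `e`. -/
noncomputable def side (s : V) (T : Finset (Sym2 V)) (e : Sym2 V) : Finset V :=
  Finset.univ.filter fun v => Reach (T.erase e) s v

open Classical in
/-- Search the fundamental cuts of the trees for a set with `m` elements that satisfies `P`. -/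
noncomputable def candidate (vs : List V) (P : Finset V → Prop) (s : V) (m : ℕ)
    (S : Fin r → Finset (Sym2 V)) : Finset V :=
  (List.finRange r ×ˢ vs ×ˢ vs).foldl (fun U y =>
    if s(y.2.1, y.2.2) ∈ S y.1 ∧ P (side s (S y.1) s(y.2.1, y.2.2)) ∧
      (side s (S y.1) s(y.2.1, y.2.2)).card = m
    then side s (S y.1) s(y.2.1, y.2.2) else U) ∅

open Classical in
/-- Treat the set with `m` elements that satisfies `P`, if there is one. -/
noncomputable def extend (vs : List V) (P : Finset V → Prop) (s : V) (j : Fin r)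
    (Z : Finset V × Finset V × (Fin r → Finset (Sym2 V))) (m : ℕ) :
    Finset V × Finset V × (Fin r → Finset (Sym2 V)) :=
  -- An unsuccessful search returns ∅, so containing s signals success; sizes below 2 are skipped
  -- because {s} is the starting set.
  if 2 ≤ m ∧ s ∈ candidate vs P s m Z.2.2 then
    (Z.2.1, candidate vs P s m Z.2.2,
      stage vs j Z.1 Z.2.1 (candidate vs P s m Z.2.2) Z.2.2)
  else Z

/-- Make `S j` cross each set that satisfies `P` only once. -/
noncomputable def untangle (vs : List V) (P : Finset V → Prop) (s : V) (j : Fin r)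
    (S : Fin r → Finset (Sym2 V)) : Fin r → Finset (Sym2 V) :=
  ((List.range vs.length).foldl (extend vs P s j) (∅, {s}, S)).2.2

/-- Untangle all trees, one after the other. -/
noncomputable def reassemble (vs : List V) (P : ℕ → Finset V → Prop) (s : V)
    (S : Fin r → Finset (Sym2 V)) : Fin r → Finset (Sym2 V) :=
  (List.finRange r).foldl (fun S (j : Fin r) => untangle vs (P j) s j S) S

theorem candidate_spec {vs : List V} (hvs : ∀ v, v ∈ vs) (P : Finset V → Prop) (s : V) (m : ℕ)
    (S : Fin r → Finset (Sym2 V)) :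
    (candidate vs P s m S = ∅ ∧ ∀ k a b, s(a, b) ∈ S k →
      ¬ (P (side s (S k) s(a, b)) ∧ (side s (S k) s(a, b)).card = m)) ∨
    P (candidate vs P s m S) ∧ (candidate vs P s m S).card = m := by
  classical
  have key : ∀ l : List (Fin r × V × V), let U := l.foldl (fun U y =>
      if s(y.2.1, y.2.2) ∈ S y.1 ∧ P (side s (S y.1) s(y.2.1, y.2.2)) ∧
        (side s (S y.1) s(y.2.1, y.2.2)).card = m
      then side s (S y.1) s(y.2.1, y.2.2) else U) ∅
      (U = ∅ ∧ ∀ y ∈ l, ¬ (s(y.2.1, y.2.2) ∈ S y.1 ∧ P (side s (S y.1) s(y.2.1, y.2.2)) ∧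
        (side s (S y.1) s(y.2.1, y.2.2)).card = m)) ∨ P U ∧ U.card = m := by
    intro l
    induction l using List.reverseRecOn with
    | nil => exact Or.inl ⟨rfl, by simp⟩
    | append_singleton l y ih =>
      simp only [List.foldl_append, List.foldl_cons, List.foldl_nil]
      by_cases hy : s(y.2.1, y.2.2) ∈ S y.1 ∧ P (side s (S y.1) s(y.2.1, y.2.2)) ∧
          (side s (S y.1) s(y.2.1, y.2.2)).card = m
      · rw [if_pos hy]
        exact Or.inr hy.2
      · rw [if_neg hy]
        refine ih.imp_left fun h => ⟨h.1, fun z hz => ?_⟩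
        rcases List.mem_append.1 hz with hz | hz
        · exact h.2 z hz
        · rw [List.mem_singleton.1 hz]
          exact hy
  have h := key (List.finRange r ×ˢ vs ×ˢ vs)
  dsimp only at h
  have h2 := h.imp_left fun h => (⟨h.1, fun k a b hab hP => h.2 (k, a, b) (by simp [hvs])
    ⟨hab, hP⟩⟩ : _ ∧ ∀ k a b, s(a, b) ∈ S k →
      ¬ (P (side s (S k) s(a, b)) ∧ (side s (S k) s(a, b)).card = m))
  unfold candidate
  convert h2

variable {s t : V} {S₀ : Fin r → Finset (Sym2 V)} {x : Sym2 V → ℝ} {ε : ℝ}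

/-- More than j ≥ 0 trees cross a relevant cut exactly once, so there is at least one, and U is a
side of the fundamental cut of its crossing edge. -/
theorem exists_side_eq (h : IsInput s t S₀ x ε) {S : Fin r → Finset (Sym2 V)}
    (hS : Reassembles S₀ S) {j : ℕ} {U : Finset V} (hU : Relevant s r x ε j U) :
    ∃ k a b, s(a, b) ∈ S k ∧ side s (S k) s(a, b) = U := by
  obtain ⟨k, hk⟩ := Finset.card_pos.1 ((Nat.zero_le j).trans_lt (hU.lt_card_filter_cut h hS))
  obtain ⟨p, q, hp, -, hpq⟩ := cut_eq_of_card_eq_one (Finset.mem_filter.1 hk).2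
  have hside := (hS.1 k).side_eq hpq hp
  refine ⟨k, p, q, (Finset.mem_inter.1 (hpq ▸ Finset.mem_singleton_self _)).1, ?_⟩
  ext v
  have hs := (hside s).2 hU.1
  simp only [side, Finset.mem_filter]
  rw [← hside v]
  exact ⟨fun h => hs.trans h.2, fun h => ⟨Finset.mem_univ _, hs.symm.trans h⟩⟩

/-- The state of the algorithm after it has treated all sets with less than `m` elements. -/
structure Treated (S₀ S₁ : Fin r → Finset (Sym2 V)) (s : V) (x : Sym2 V → ℝ) (ε : ℝ) (j : Fin r)
    (m : ℕ) (Z : Finset V × Finset V × (Fin r → Finset (Sym2 V))) : Prop where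
  reassembles : Reassembles S₀ Z.2.2
  eq_of_lt : ∀ i < j, Z.2.2 i = S₁ i
  ssubset : Z.1 ⊂ Z.2.1
  relevant_left : Z.1 = ∅ ∨ Relevant s r x ε j Z.1
  relevant_right : Z.2.1 = {s} ∨ Relevant s r x ε j Z.2.1
  -- The maximum with 2 accounts for {s}, which is treated from the start.
  card_lt : Z.2.1.card < max m 2
  attached : Attached (Z.2.2 j) Z.1 Z.2.1
  card_cut : (Z.2.2 j ∩ cut Z.2.1).card = 1
  treated : ∀ U, Relevant s r x ε j U → U.card < max m 2 →
    (U = Z.2.1 ∨ U ⊆ Z.1) ∧ (Z.2.2 j ∩ cut U).card = 1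

theorem Treated.base (h : IsInput s t S₀ x ε) {S : Fin r → Finset (Sym2 V)}
    (hS : Reassembles S₀ S) (j : Fin r) : Treated S₀ S s x ε j 0 (∅, {s}, S) := by
  have hconn : ConnOn (S j) {s} := by
    intro u hu v hv
    rw [Finset.mem_singleton] at hu hv
    rw [hu, hv]
    exact .refl _
  refine ⟨hS, fun _ _ => rfl, by simp, Or.inl rfl, Or.inl rfl,
    by simp, ⟨hconn, by simpa using hconn, by simp⟩, card_cut_source h hS j, ?_⟩
  intro U hU hcard
  have : U = {s} := by
    symm
    refine Finset.eq_of_subset_of_card_le (Finset.singleton_subset_iff.2 hU.1) ?_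
    simp only [Nat.zero_le, sup_of_le_right] at hcard
    rw [Finset.card_singleton]
    omega
  rw [this]
  exact ⟨Or.inl rfl, card_cut_source h hS j⟩

/-- In a chain at most one relevant set has m elements, so the set found is the only one to treat.
Sets inside K keep their crossing edges, while the set L is taken care of by the stage itself. -/
theorem Treated.step (h : IsInput s t S₀ x ε) {vs : List V} (hvs : ∀ v, v ∈ vs)
    {S₁ : Fin r → Finset (Sym2 V)} {j : Fin r} {m : ℕ}
    {Z : Finset V × Finset V × (Fin r → Finset (Sym2 V))} (hZ : Treated S₀ S₁ s x ε j m Z) :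
    Treated S₀ S₁ s x ε j (m + 1) (extend vs (Relevant s r x ε j) s j Z m) := by
  obtain ⟨K, L, S⟩ := Z
  obtain ⟨h1, h2, h3, h4, h5, h6, h7, h8, h9⟩ := hZ
  dsimp only at h1 h2 h3 h4 h5 h6 h7 h8 h9
  unfold extend
  dsimp only
  have hspec := candidate_spec hvs (Relevant s r x ε j) s m S
  split_ifs with hm
  · obtain ⟨hm2, hs⟩ := hm
    set M := candidate vs (Relevant s r x ε j) s m S with hMdef
    obtain ⟨hM, hMcard⟩ : Relevant s r x ε j M ∧ M.card = m := by
      refine hspec.resolve_left fun h0 => ?_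
      rw [h0.1] at hs
      exact Finset.notMem_empty _ hs
    have hL : Relevant s r x ε j L := h5.elim (fun e => e ▸ hM.singleton h) id
    rw [max_eq_left hm2] at h6 h9
    have hLM : L ⊂ M := by
      rcases hL.subset_or_subset h hM with hsub | hsub
      · exact Finset.ssubset_iff_subset_ne.2 ⟨hsub, fun e => by rw [e] at h6; omega⟩
      · have := Finset.card_le_card hsub
        omega
    obtain ⟨a1, a2, a3, a4⟩ := stage_spec h h3 hLM h4 hL hM hvs
      (S := S) (S₁ := S) ⟨h1, fun _ _ => rfl, fun _ _ => rfl⟩ h7 h8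
    refine ⟨a1.reassembles, fun i hi => (a1.eq_of_lt i hi).trans (h2 i hi), hLM, Or.inr hL,
      Or.inr hM, ?_, a2, a4, ?_⟩
    · dsimp only
      rw [hMcard]
      omega
    · intro U hU hcard
      dsimp only
      rw [max_eq_left (by omega)] at hcard
      rcases Nat.lt_succ_iff_lt_or_eq.1 hcard with hlt | heq
      · obtain ⟨rfl | hsub, hc⟩ := h9 U hU hlt
        · exact ⟨Or.inr (Finset.Subset.refl _), a3⟩
        · refine ⟨Or.inr (hsub.trans h3.1), ?_⟩
          rw [a1.cut_eq U hsub]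
          exact hc
      · have : U = M := by
          rcases hU.subset_or_subset h hM with hsub | hsub
          · exact Finset.eq_of_subset_of_card_le hsub (by omega)
          · exact (Finset.eq_of_subset_of_card_le hsub (by omega)).symm
        rw [this]
        exact ⟨Or.inl rfl, a4⟩
  · refine ⟨h1, h2, h3, h4, h5, h6.trans_le (by omega), h7, h8, fun U hU hcard => ?_⟩
    refine h9 U hU ?_
    by_contra hc
    have hm2 : 2 ≤ m ∧ U.card = m := by omega
    refine hm ⟨hm2.1, ?_⟩
    rcases hspec with hspec | hspec
    · obtain ⟨k, a, b, hab, hside⟩ := exists_side_eq h h1 hU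
      exact absurd ⟨hside ▸ hU, hside ▸ hm2.2⟩ (hspec.2 k a b hab)
    · exact hspec.1.1

theorem untangle_spec (h : IsInput s t S₀ x ε) {vs : List V} (hvs : ∀ v, v ∈ vs)
    {S : Fin r → Finset (Sym2 V)} (hS : Reassembles S₀ S) (j : Fin r) :
    Reassembles S₀ (untangle vs (Relevant s r x ε j) s j S) ∧
      (∀ i < j, untangle vs (Relevant s r x ε j) s j S i = S i) ∧
      ∀ U, Relevant s r x ε j U → (untangle vs (Relevant s r x ε j) s j S j ∩ cut U).card = 1 := by
  have key : ∀ m, Treated S₀ S s x ε j m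
      ((List.range m).foldl (extend vs (Relevant s r x ε j) s j) (∅, {s}, S)) := by
    intro m
    induction m with
    | zero => exact Treated.base h hS j
    | succ m ih =>
      rw [List.range_succ, List.foldl_append]
      exact ih.step h hvs
  have hlen : Fintype.card V ≤ vs.length := by
    rw [← Finset.card_univ]
    exact (Finset.card_le_card (fun v _ => List.mem_toFinset.2 (hvs v))).trans
      (List.toFinset_card_le vs)
  have hk := key vs.length
  refine ⟨hk.reassembles, hk.eq_of_lt, fun U hU => (hk.treated U hU ?_).2⟩
  -- A relevant set omits t, so it has fewer than |V| elements and its size was covered by the loop.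
  have := Finset.card_lt_univ_of_notMem (hU.notMem h)
  omega

theorem reassemble_spec (h : IsInput s t S₀ x ε) {vs : List V} (hvs : ∀ v, v ∈ vs) :
    Reassembles S₀ (reassemble vs (Relevant s r x ε) s S₀) ∧ ∀ (j : Fin r) (U : Finset V),
      Relevant s r x ε j U → (reassemble vs (Relevant s r x ε) s S₀ j ∩ cut U).card = 1 := by
  have key : ∀ m ≤ r, ∀ S : Fin r → Finset (Sym2 V), S = ((List.finRange r).take m).foldl
      (fun S j => untangle vs (Relevant s r x ε (j : Fin r)) s j S) S₀ →
      Reassembles S₀ S ∧ ∀ j : Fin r, (j : ℕ) < m → ∀ U, Relevant s r x ε j U →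
        (S j ∩ cut U).card = 1 := by
    intro m hm
    induction m with
    | zero =>
      rintro S rfl
      exact ⟨h.reassembles, by simp⟩
    | succ m ih =>
      rintro S rfl
      obtain ⟨h1, h2⟩ := ih (by omega) _ rfl
      have htake : (List.finRange r).take (m + 1) =
          (List.finRange r).take m ++ [⟨m, by omega⟩] := by
        rw [List.take_add_one, List.getElem?_eq_getElem (by simpa using hm)]
        simp
      simp only [htake, List.foldl_append, List.foldl_cons, List.foldl_nil]
      obtain ⟨h3, h4, h5⟩ := untangle_spec h hvs h1 ⟨m, by omega⟩
      refine ⟨h3, fun j hj U hU => ?_⟩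
      rcases Nat.lt_succ_iff_lt_or_eq.1 hj with hlt | heq
      · rw [h4 j hlt]
        exact h2 j hlt U hU
      · subst heq
        exact h5 U hU
  have := key r le_rfl _ rfl
  simp only [List.take_of_length_le (List.length_finRange (n := r)).le] at this
  exact ⟨this.1, fun j => this.2 j j.2⟩

/-- The algorithm is correct. -/
theorem isOutput_reassemble (h : IsInput s t S₀ x ε) {vs : List V} (hvs : ∀ v, v ∈ vs) :
    IsOutput S₀ x ε (reassemble vs (Relevant s r x ε) s S₀) := by
  obtain ⟨h1, h2⟩ := reassemble_spec h hvs
  refine ⟨h1.1, h1.2, ?_⟩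
  rintro C ⟨⟨U, hne, huniv, rfl⟩, hlt⟩
  -- Relevance is formulated for sets containing s; complementing does not change the cut.
  obtain ⟨U', hsU, hne', huniv', hcut⟩ : ∃ U', s ∈ U' ∧ U'.Nonempty ∧ U' ≠ Finset.univ ∧
      cut U' = cut U := by
    by_cases hs : s ∈ U
    · exact ⟨U, hs, hne, huniv, rfl⟩
    · refine ⟨Uᶜ, by simpa using hs, ⟨s, by simpa using hs⟩, ?_, cut_compl U⟩
      rw [Ne, Finset.compl_eq_univ_iff]
      exact hne.ne_empty
  rw [← hcut] at hlt ⊢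
  clear hcut hne huniv U
  have hr : (0 : ℝ) < r := Nat.cast_pos.2 (Nat.pos_of_ne_zero h.ne_zero)
  set θ : ℝ := 2 - weight x (cut U') - ε with hθ
  -- For natural j, being below the ceiling of rθ is the same as j < rθ, which is relevance. Capping
  -- at r loses nothing because θ ≤ 1.
  refine ⟨min r ⌈r * θ⌉₊, min_le_left _ _, ?_, fun j hj => ?_⟩
  · rw [ge_iff_le, le_div_iff₀ hr, mul_comm, Nat.cast_min]
    refine le_min ?_ (Nat.le_ceil _)
    have h3 : 1 ≤ weight x (cut U') := by
      by_cases hodd : Odd (U' ∩ {s, t}).card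
      · exact h.feasible.odd_cut U' hne' huniv' hodd
      · exact one_le_two.trans
          (h.feasible.even_cut U' hne' huniv' (Nat.not_odd_iff_even.1 hodd))
    have := h.eps_nonneg
    nlinarith
  · rw [Finset.inter_comm]
    exact h2 j U' ⟨hsU, huniv', Nat.lt_ceil.1 (hj.trans_le (min_le_right _ _))⟩

end Algorithm

/-! ### Computations in polynomial time -/

section Bounds

variable {ι κ : Type} {a b : ι → Data} {f g : ι → ℕ}

/-- `f` is bounded by a polynomial in the size of `a`. -/
def PolyBdd (a : ι → Data) (f : ι → ℕ) : Prop :=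
  ∃ Q : Polynomial ℕ, ∀ i, f i ≤ Q.eval (a i).size

theorem eval_mono_of_le (Q : Polynomial ℕ) {m k : ℕ} (h : m ≤ k) : Q.eval m ≤ Q.eval k := by
  rw [Polynomial.eval_eq_sum_range, Polynomial.eval_eq_sum_range]
  gcongr

theorem PolyBdd.mono (h : PolyBdd a f) (hg : ∀ i, g i ≤ f i) : PolyBdd a g := by
  obtain ⟨Q, hQ⟩ := h
  exact ⟨Q, fun i => (hg i).trans (hQ i)⟩

theorem PolyBdd.const (k : ℕ) : PolyBdd a fun _ => k := ⟨.C k, fun i => by simp⟩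

theorem PolyBdd.size : PolyBdd a fun i => (a i).size := ⟨.X, fun i => by simp⟩

theorem PolyBdd.add (hf : PolyBdd a f) (hg : PolyBdd a g) : PolyBdd a fun i => f i + g i := by
  obtain ⟨P, hP⟩ := hf
  obtain ⟨Q, hQ⟩ := hg
  exact ⟨P + Q, fun i => by rw [Polynomial.eval_add]; exact add_le_add (hP i) (hQ i)⟩

theorem PolyBdd.mul (hf : PolyBdd a f) (hg : PolyBdd a g) : PolyBdd a fun i => f i * g i := by
  obtain ⟨P, hP⟩ := hf
  obtain ⟨Q, hQ⟩ := hg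
  exact ⟨P * Q, fun i => by rw [Polynomial.eval_mul]; exact Nat.mul_le_mul (hP i) (hQ i)⟩

theorem PolyBdd.reindex (h : PolyBdd a f) (φ : κ → ι) :
    PolyBdd (fun k => a (φ k)) fun k => f (φ k) := by
  obtain ⟨Q, hQ⟩ := h
  exact ⟨Q, fun k => hQ (φ k)⟩

theorem PolyBdd.trans (h : PolyBdd a fun i => (b i).size) (hf : PolyBdd b f) : PolyBdd a f := by
  obtain ⟨P, hP⟩ := h
  obtain ⟨Q, hQ⟩ := hf
  exact ⟨Q.comp P, fun i => (hQ i).trans <| by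
    rw [Polynomial.eval_comp]; exact eval_mono_of_le Q (hP i)⟩

/-- Turns a bound on all indices k over i into one number that depends on i alone; this bounds every
iteration of a loop at once. -/
theorem PolyBdd.exists_uniform {φ : κ → ι} {f : κ → ℕ} (h : PolyBdd (fun k => a (φ k)) f) :
    ∃ B : ι → ℕ, PolyBdd a B ∧ ∀ k, f k ≤ B (φ k) := by
  obtain ⟨Q, hQ⟩ := h
  exact ⟨fun i => Q.eval (a i).size, ⟨Q, fun _ => le_rfl⟩, hQ⟩

end Bounds

theorem Data.size_pos (d : Data) : 0 < d.size := by
  cases d <;> simp only [Data.size] <;> omega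

theorem Op.size_eval_le (o : Op) : ∃ k, ∀ d : Data, (o.eval d).size ≤ 2 * d.size + k := by
  have hb : ∀ b, (Data.ofBool b).size ≤ 2 := by decide
  have h0 : (Data.int 0).size = 1 := by decide
  have hadd : ∀ y z : ℤ, (y + z).natAbs.size ≤ y.natAbs.size + z.natAbs.size + 1 := by
    intro y z
    rw [Nat.size_le]
    have h1 := Nat.lt_size_self y.natAbs
    have h2 := Nat.lt_size_self z.natAbs
    have h3 := Nat.pow_le_pow_right two_pos
      (show y.natAbs.size ≤ y.natAbs.size + z.natAbs.size by omega)
    have h4 := Nat.pow_le_pow_right two_pos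
      (show z.natAbs.size ≤ y.natAbs.size + z.natAbs.size by omega)
    rw [pow_succ]
    have := Int.natAbs_add_le y z
    omega
  have hmul : ∀ y z : ℤ, (y * z).natAbs.size ≤ y.natAbs.size + z.natAbs.size := by
    intro y z
    rw [Nat.size_le, Int.natAbs_mul, pow_add]
    exact Nat.mul_lt_mul'' (Nat.lt_size_self _) (Nat.lt_size_self _)
  obtain ⟨k, hk⟩ : ∃ k, ∀ z, o = .const z → (Data.int z).size ≤ k := by
    by_cases h : ∃ z, o = .const z
    · obtain ⟨z, rfl⟩ := h
      exact ⟨_, fun z' h => by obtain rfl := Op.const.inj h; exact le_rfl⟩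
    · exact ⟨0, fun z hz => absurd ⟨z, hz⟩ h⟩
  refine ⟨k + 2, fun d => ?_⟩
  unfold Op.eval
  split
  · omega
  · have := hk _ rfl
    omega
  · simp only [Data.size]; omega
  · simp only [Data.size]; omega
  · rename_i y z
    have := hadd y z
    simp only [Data.size]; omega
  · rename_i y z
    have := hmul y z
    simp only [Data.size]; omega
  · rename_i y z
    have := hb (decide (y ≤ z))
    omega
  · rename_i y z
    have := hb (decide (y = z))
    omega
  · have := hb true
    omega
  · omega

/-- Programs are charged for their output, so polynomial time implies polynomial output size. This
makes compositions polynomial. -/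
theorem Runs.size_le {p : Prog} {d e : Data} {m : ℕ} (h : Runs p d e m) : e.size ≤ m := by
  induction h with
  | op o d => omega
  | pair _ _ h1 h2 => simp only [Data.size]; omega
  | seq _ _ _ h => omega
  | iteTrue _ _ _ _ h => omega
  | iteFalse _ _ _ h => omega
  | whileStop _ _ => omega
  | whileStep _ _ _ _ _ _ h => omega

/-- One program computes `b i` from `a i`, for all `i`, in time polynomial in the size of `a i`. -/
def Comp {ι : Type} (a b : ι → Data) : Prop :=
  ∃ (p : Prog) (t : ι → ℕ), (∀ i, Runs p (a i) (b i) (t i)) ∧ PolyBdd a t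

/-! ### Closure of polynomial-time computation under composition, arithmetic and logic -/

section Basic

variable {ι κ : Type} {a b c d : ι → Data}

theorem Comp.size_bdd (h : Comp a b) : PolyBdd a fun i => (b i).size := by
  obtain ⟨p, t, hp, ht⟩ := h
  exact ht.mono fun i => (hp i).size_le

theorem Comp.bdd_of_bdd (h : Comp a b) {f : ι → ℕ} (hf : PolyBdd b f) : PolyBdd a f :=
  h.size_bdd.trans hf

theorem Comp.reindex (h : Comp a b) (φ : κ → ι) : Comp (fun k => a (φ k)) fun k => b (φ k) := by
  obtain ⟨p, t, hp, ht⟩ := h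
  exact ⟨p, fun k => t (φ k), fun k => hp (φ k), ht.reindex φ⟩

theorem Comp.congr (h : Comp a b) (hbc : ∀ i, b i = c i) : Comp a c := by
  obtain rfl : b = c := funext hbc
  exact h

theorem Comp.op (o : Op) : Comp a fun i => o.eval (a i) := by
  obtain ⟨k, hk⟩ := o.size_eval_le
  exact ⟨.op o, _, fun i => .op o (a i), .add .size
    (((PolyBdd.const 2).mul .size |>.add (.const k)).mono fun i => hk _)⟩

theorem Comp.refl : Comp a a := Comp.op .copy

theorem Comp.trans (h : Comp a b) (h' : Comp b c) : Comp a c := by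
  have hs := h.size_bdd
  obtain ⟨p, t, hp, ht⟩ := h
  obtain ⟨q, u, hq, hu⟩ := h'
  exact ⟨.seq p q, _, fun i => .seq (hp i) (hq i), (ht.add (hs.trans hu)).add (.const 1)⟩

/-- What can be computed from `a` can be computed where `a` is available. -/
theorem Comp.lift (h : Comp a b) (φ : κ → ι) {c : κ → Data} (hc : Comp c fun k => a (φ k)) :
    Comp c fun k => b (φ k) := hc.trans (h.reindex φ)

theorem Comp.pair (h : Comp a b) (h' : Comp a c) : Comp a fun i => .pair (b i) (c i) := by
  obtain ⟨p, t, hp, ht⟩ := h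
  obtain ⟨q, u, hq, hu⟩ := h'
  exact ⟨.pair p q, _, fun i => .pair (hp i) (hq i), (ht.add hu).add (.const 1)⟩

theorem Comp.fst (h : Comp a fun i => .pair (b i) (c i)) : Comp a b := h.trans (Comp.op .fst)

theorem Comp.snd (h : Comp a fun i => .pair (b i) (c i)) : Comp a c := h.trans (Comp.op .snd)

theorem Comp.const (z : ℤ) : Comp a fun _ => .int z :=
  (Comp.op (.const z)).congr fun i => by cases a i <;> rfl

theorem Comp.add {y z : ι → ℤ} (hy : Comp a fun i => .int (y i)) (hz : Comp a fun i => .int (z i)) :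
    Comp a fun i => .int (y i + z i) := (hy.pair hz).trans (Comp.op .add)

theorem Comp.mul {y z : ι → ℤ} (hy : Comp a fun i => .int (y i)) (hz : Comp a fun i => .int (z i)) :
    Comp a fun i => .int (y i * z i) := (hy.pair hz).trans (Comp.op .mul)

theorem Comp.sub {y z : ι → ℤ} (hy : Comp a fun i => .int (y i)) (hz : Comp a fun i => .int (z i)) :
    Comp a fun i => .int (y i - z i) :=
  (hy.add ((Comp.const (-1)).mul hz)).congr fun i => by rw [neg_one_mul, sub_eq_add_neg]

open Classical in
/-- One program decides the propositions `P i`, given `a i`, in polynomial time. -/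
def Decides (a : ι → Data) (P : ι → Prop) : Prop := Comp a fun i => .ofBool (decide (P i))

variable {P Q : ι → Prop}

theorem Decides.congr (h : Decides a P) (hPQ : ∀ i, P i ↔ Q i) : Decides a Q := by
  obtain rfl : P = Q := funext fun i => propext (hPQ i)
  exact h

theorem Decides.ofBool [∀ i, Decidable (P i)] (h : Decides a P) :
    Comp a fun i => .ofBool (decide (P i)) := Comp.congr h fun i => by congr

theorem Comp.decides [∀ i, Decidable (P i)] (h : Comp a fun i => .ofBool (decide (P i))) :
    Decides a P := h.congr fun i => by congr

theorem Comp.le {y z : ι → ℤ} (hy : Comp a fun i => .int (y i)) (hz : Comp a fun i => .int (z i)) :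
    Decides a fun i => y i ≤ z i := ((hy.pair hz).trans (Comp.op .le)).decides

theorem Comp.lt {y z : ι → ℤ} (hy : Comp a fun i => .int (y i)) (hz : Comp a fun i => .int (z i)) :
    Decides a fun i => y i < z i := (hy.add (.const 1)).le hz

theorem Comp.eq (h : Comp a b) (h' : Comp a c) : Decides a fun i => b i = c i :=
  ((h.pair h').trans (Comp.op .eq)).congr fun i => by
    simp only [Op.eval]
    congr

theorem Comp.ite [∀ i, Decidable (P i)] (hP : Decides a P) (h : Comp a b) (h' : Comp a c) :
    Comp a fun i => if P i then b i else c i := by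
  obtain ⟨p, t, hp, ht⟩ := h
  obtain ⟨q, u, hq, hu⟩ := h'
  obtain ⟨r, v, hr, hv⟩ := hP
  refine ⟨.ite r p q, fun i => v i + (if P i then t i else u i) + 1, fun i => ?_,
    (hv.add ((ht.add hu).mono fun i => ?_)).add (.const 1)⟩
  · have := hr i
    by_cases h : P i
    · simp only [if_pos h]
      exact .iteTrue this (by simp [h, Data.ofBool]) (hp i)
    · simp only [if_neg h]
      simp only [h, Data.ofBool, decide_false, Bool.false_eq_true, if_false] at this
      exact .iteFalse this (hq i)
  · split_ifs <;> omega

/-- The version of `Comp.ite` for encoded objects. -/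
theorem Comp.ite_apply {σ : ι → Type} (e : ∀ i, σ i → Data) {x y : ∀ i, σ i}
    {_ : ∀ i, Decidable (P i)} (hP : Decides a P) (h : Comp a fun i => e i (x i))
    (h' : Comp a fun i => e i (y i)) : Comp a fun i => e i (if P i then x i else y i) :=
  (Comp.ite hP h h').congr fun i => by split_ifs <;> rfl

theorem Decides.true : Decides a fun _ => True :=
  (Comp.const 1).congr fun i => by simp [Data.ofBool]

theorem Decides.false : Decides a fun _ => False :=
  (Comp.const 0).congr fun i => by simp [Data.ofBool]

open Classical in
theorem Decides.ite {R : ι → Prop} (hP : Decides a P) (hQ : Decides a Q) (hR : Decides a R) :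
    Decides a fun i => if P i then Q i else R i :=
  (Comp.ite hP hQ hR).congr fun i => by
    by_cases h : P i <;> simp [h]

theorem Decides.not (hP : Decides a P) : Decides a fun i => ¬ P i := by
  classical
  exact (hP.ite Decides.false Decides.true).congr fun i => by
    by_cases h : P i <;> simp [h]

theorem Decides.and (hP : Decides a P) (hQ : Decides a Q) : Decides a fun i => P i ∧ Q i := by
  classical
  exact (hP.ite hQ Decides.false).congr fun i => by
    by_cases h : P i <;> simp [h]

theorem Decides.or (hP : Decides a P) (hQ : Decides a Q) : Decides a fun i => P i ∨ Q i := by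
  classical
  exact (hP.ite Decides.true hQ).congr fun i => by
    by_cases h : P i <;> simp [h]

end Basic

/-! ### Loops over lists -/

section Loops

variable {ι κ : Type} {a : ι → Data}

theorem Data.size_list (l : List Data) :
    (Data.list l).size = (l.map fun d => d.size + 1).sum + 1 := by
  induction l with
  | nil => rfl
  | cons d l ih =>
    rw [Data.list, Data.size, ih, List.map_cons, List.sum_cons]
    omega

theorem Data.length_lt_size_list (l : List Data) : l.length < (Data.list l).size := by
  rw [Data.size_list, Nat.lt_succ_iff]
  induction l with
  | nil => simp
  | cons d l ih =>
    rw [List.map_cons, List.sum_cons, List.length_cons]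
    omega

theorem Data.size_lt_size_list {d : Data} {l : List Data} (h : d ∈ l) :
    d.size < (Data.list l).size := by
  rw [Data.size_list, Nat.lt_succ_iff]
  exact (Nat.le_succ _).trans (List.single_le_sum (fun _ _ => Nat.zero_le _) _
    (List.mem_map_of_mem (f := fun d : Data => d.size + 1) h))

theorem Data.size_list_le {l : List Data} {B : ℕ} (h : ∀ d ∈ l, d.size ≤ B) :
    (Data.list l).size ≤ l.length * (B + 1) + 1 := by
  rw [Data.size_list]
  have := List.sum_le_card_nsmul (l.map fun d => d.size + 1) (B + 1) (by
    intro k hk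
    obtain ⟨d, hd, rfl⟩ := List.mem_map.1 hk
    exact Nat.succ_le_succ (h d hd))
  simpa using this

theorem Data.size_list_le_of_sublist {l l' : List Data} (h : l.Sublist l') :
    (Data.list l).size ≤ (Data.list l').size := by
  rw [Data.size_list, Data.size_list]
  exact Nat.succ_le_succ ((h.map _).sum_le_sum fun _ _ => Nat.zero_le _)

/-- Loops over a list, with an invariantly small state. -/
theorem Comp.foldl_of_polyBdd {α σ : ι → Type} (e : ∀ i, α i → Data) (st : ∀ i, σ i → Data)
    {l : ∀ i, List (α i)} {f : ∀ i, σ i → α i → σ i} {s₀ : ∀ i, σ i}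
    (hl : Comp a fun i => .list ((l i).map (e i))) (hs : Comp a fun i => st i (s₀ i))
    -- The body must be computable in every context that provides the input, the state and the
    -- element. Quantifying over the index type makes nested loops and loop-dependent parameters
    -- possible.
    (hf : ∀ {κ : Type} {c : κ → Data} (φ : κ → ι) (s : ∀ k, σ (φ k)) (x : ∀ k, α (φ k)),
      (Comp c fun k => a (φ k)) → (Comp c fun k => st _ (s k)) → (Comp c fun k => e _ (x k)) →
      Comp c fun k => st _ (f (φ k) (s k) (x k)))
    (hb : PolyBdd (fun q : ι × ℕ => a q.1) fun q =>
      (st q.1 (((l q.1).take q.2).foldl (f q.1) (s₀ q.1))).size) :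
    Comp a fun i => st i ((l i).foldl (f i) (s₀ i)) := by
  -- The memory after a number of rounds: the input, the rest of the list, and the state.
  set D : ι × ℕ → Data := fun q => .pair (a q.1) (.pair (.list (((l q.1).drop q.2).map (e q.1)))
    (st q.1 (((l q.1).take q.2).foldl (f q.1) (s₀ q.1)))) with hD
  have hbody : Comp (fun q : {q : ι × ℕ // q.2 < (l q.1).length} => D q.1)
      fun q => D (q.1.1, q.1.2 + 1) := by
    have h : Comp (fun q : {q : ι × ℕ // q.2 < (l q.1).length} => D q.1) fun q => D q.1 := .refl
    have hrest := h.snd.fst.congr (c := fun q : {q : ι × ℕ // q.2 < (l q.1).length} =>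
      .pair (e _ ((l q.1.1)[q.1.2]'q.2)) (.list (((l q.1.1).drop (q.1.2 + 1)).map (e q.1.1))))
      fun q => by rw [List.drop_eq_getElem_cons q.2]; rfl
    refine h.fst.pair (hrest.snd.pair ((hf (fun q : {q : ι × ℕ // q.2 < (l q.1).length} => q.1.1)
      _ _ h.fst h.snd.snd hrest.fst).congr fun q => ?_))
    simp only [List.take_add_one, List.getElem?_eq_getElem q.2, Option.toList_some,
      List.foldl_append, List.foldl_cons, List.foldl_nil]
  have hcond : Comp D fun q => .ofBool (decide (q.2 < (l q.1).length)) := by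
    have h : Comp D fun q => D q := .refl
    refine (h.snd.fst.trans (Comp.op .isPair)).congr fun q => ?_
    by_cases hq : q.2 < (l q.1).length
    · rw [List.drop_eq_getElem_cons hq, List.map_cons, Data.list]
      simp only [hq, Op.eval, decide_true]
    · rw [List.drop_eq_nil_of_le (by omega)]
      simp [hq, Data.list, Op.eval, Data.ofBool]
  have hsize : PolyBdd (fun q : ι × ℕ => a q.1) fun q => (D q).size := by
    refine (((PolyBdd.size (a := fun q : ι × ℕ => a q.1)).add
      ((hl.size_bdd.reindex (Prod.fst : ι × ℕ → ι)).add hb)).add (.const 2)).mono fun q => ?_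
    have := Data.size_list_le_of_sublist (((l q.1).drop_sublist q.2).map (e q.1))
    simp only [hD, Data.size]
    omega
  obtain ⟨c, u, hc, hu⟩ := hcond
  obtain ⟨p, v, hp, hv⟩ := hbody
  -- Bounds that do not depend on the round; the total time is at most their sum plus one, times the
  -- number of rounds plus one.
  obtain ⟨B₁, hB₁, h₁⟩ := (hsize.trans hu).exists_uniform
  obtain ⟨B₂, hB₂, h₂⟩ := PolyBdd.exists_uniform (a := a)
    (φ := fun q : {q : ι × ℕ // q.2 < (l q.1).length} => q.1.1)
    ((hsize.reindex Subtype.val).trans hv)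
  obtain ⟨B₃, hB₃, h₃⟩ := hsize.exists_uniform
  have hrun : ∀ i d m, m + d = (l i).length → ∃ T, Runs (.while c p) (D (i, m))
      (D (i, (l i).length)) T ∧ T ≤ (d + 1) * (B₁ i + B₂ i + B₃ i + 1) := by
    intro i d
    induction d with
    | zero =>
      intro m hm
      obtain rfl : m = (l i).length := hm
      have h := hc (i, (l i).length)
      simp only [lt_self_iff_false, decide_false, Data.ofBool, Bool.false_eq_true, if_false] at h
      refine ⟨_, .whileStop h, ?_⟩
      have := h₁ (i, (l i).length)
      have := h₃ (i, (l i).length)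
      dsimp only at *
      omega
    | succ d ih =>
      intro m hm
      have hlt : m < (l i).length := by omega
      obtain ⟨T, hT, hT'⟩ := ih (m + 1) (by omega)
      have h := hc (i, m)
      simp only [hlt, decide_true, Data.ofBool, if_true] at h
      refine ⟨_, .whileStep h (by simp) (hp ⟨(i, m), hlt⟩) hT, ?_⟩
      have := h₁ (i, m)
      have := h₂ ⟨(i, m), hlt⟩
      dsimp only at *
      rw [add_mul (d + 1)]
      omega
  have hrun' := fun i => hrun i (l i).length 0 (zero_add _)
  choose T hT hT' using hrun'
  have h0 : Comp a fun i => D (i, 0) := (Comp.refl.pair (hl.pair hs)).congr fun i => by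
    simp [hD]
  have h1 : Comp (fun i => D (i, 0)) fun i => D (i, (l i).length) := by
    refine ⟨_, T, hT, Comp.bdd_of_bdd (Comp.fst .refl) ?_⟩
    refine PolyBdd.mono ((hl.size_bdd.add (.const 1)).mul (((hB₁.add hB₂).add hB₃).add (.const 1)))
      fun i => (hT' i).trans (Nat.mul_le_mul_right _ ?_)
    have := Data.length_lt_size_list ((l i).map (e i))
    rw [List.length_map] at this
    omega
  exact (h0.trans h1).snd.snd.congr fun i => by rw [List.take_length]

/-- Loops over a list, where all states are small. -/
theorem Comp.foldl {α σ : ι → Type} (e : ∀ i, α i → Data) (st : ∀ i, σ i → Data)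
    {l : ∀ i, List (α i)} {f : ∀ i, σ i → α i → σ i} {s₀ : ∀ i, σ i}
    (hl : Comp a fun i => .list ((l i).map (e i))) (hs : Comp a fun i => st i (s₀ i))
    (hb : PolyBdd (fun q : Σ i, σ i => a q.1) fun q => (st q.1 q.2).size)
    (hf : ∀ {κ : Type} {c : κ → Data} (φ : κ → ι) (s : ∀ k, σ (φ k)) (x : ∀ k, α (φ k)),
      (Comp c fun k => a (φ k)) → (Comp c fun k => st _ (s k)) → (Comp c fun k => e _ (x k)) →
      Comp c fun k => st _ (f (φ k) (s k) (x k))) :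
    Comp a fun i => st i ((l i).foldl (f i) (s₀ i)) :=
  Comp.foldl_of_polyBdd e st hl hs hf (hb.reindex fun q : ι × ℕ => ⟨q.1, _⟩)

theorem Comp.list_reverse {l : ι → List Data} (h : Comp a fun i => .list (l i)) :
    Comp a fun i => .list (l i).reverse := by
  have := Comp.foldl_of_polyBdd (σ := fun _ => List Data) (fun _ d => d) (fun _ => Data.list)
    (l := l) (f := fun _ s x => x :: s) (s₀ := fun _ => []) (by simpa using h) (Comp.const 0)
    (fun φ s x _ hs hx => hx.pair hs)
    ((h.size_bdd.reindex (Prod.fst : ι × ℕ → ι)).mono fun q => ?_)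
  · refine this.congr fun i => ?_
    rw [List.foldl_flip_cons_eq_append']
    simp
  · rw [List.foldl_flip_cons_eq_append']
    simp only [List.append_nil, Data.size_list, List.map_reverse, List.sum_reverse]
    rw [← Data.size_list, ← Data.size_list]
    exact Data.size_list_le_of_sublist (List.take_sublist _ _)

theorem Comp.list_map {α : ι → Type} (e : ∀ i, α i → Data) {g : ∀ i, α i → Data}
    {l : ∀ i, List (α i)} (hl : Comp a fun i => .list ((l i).map (e i)))
    (hg : ∀ {κ : Type} {c : κ → Data} (φ : κ → ι) (x : ∀ k, α (φ k)),
      (Comp c fun k => a (φ k)) → (Comp c fun k => e _ (x k)) → Comp c fun k => g _ (x k)) :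
    Comp a fun i => .list ((l i).map (g i)) := by
  have hfold : ∀ i (l' : List (α i)) s, l'.foldl (fun s x => g i x :: s) s =
      (l'.map (g i)).reverse ++ s := by
    intro i l'
    induction l' with
    | nil => simp
    | cons x l' ih => intro s; simp [ih]
  -- Restricting to members of the list bounds the encoded elements, and hence the results, by the
  -- size of the list.
  have hsize : PolyBdd (fun q : Σ i, {x // x ∈ l i} => a q.1) fun q => (g q.1 q.2).size := by
    refine PolyBdd.trans (b := fun q : Σ i, {x // x ∈ l i} => .pair (a q.1) (e q.1 q.2)) ?_
      (hg (fun q : Σ i, {x // x ∈ l i} => q.1) (fun q => q.2.1) (Comp.fst .refl)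
        (Comp.snd .refl)).size_bdd
    refine (((PolyBdd.size (a := fun q : Σ i, {x // x ∈ l i} => a q.1)).add
      (hl.size_bdd.reindex Sigma.fst)).add (.const 1)).mono fun q => ?_
    have := Data.size_lt_size_list (List.mem_map_of_mem (f := e q.1) q.2.2)
    simp only [Data.size]
    omega
  obtain ⟨B, hB, hgB⟩ := hsize.exists_uniform
  have := Comp.foldl_of_polyBdd (σ := fun _ => List Data) e (fun _ => Data.list) (l := l)
    (f := fun i s x => g i x :: s) (s₀ := fun _ => []) hl (Comp.const 0)
    (fun φ s x ha hs hx => (hg φ x ha hx).pair hs)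
    ((((hl.size_bdd.mul (hB.add (.const 1))).add (.const 1)).reindex
      (Prod.fst : ι × ℕ → ι)).mono fun q => ?_)
  · refine this.list_reverse.congr fun i => ?_
    rw [hfold]
    simp
  · rw [hfold]
    refine (Data.size_list_le (B := B q.1) fun d hd => ?_).trans ?_
    · simp only [List.append_nil, List.mem_reverse, List.mem_map] at hd
      obtain ⟨x, hx, rfl⟩ := hd
      exact hgB ⟨q.1, x, List.mem_of_mem_take hx⟩
    · have := Data.length_lt_size_list ((l q.1).map (e q.1))
      simp only [List.append_nil, List.length_reverse, List.length_map, List.length_take] at this ⊢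
      gcongr
      omega

theorem Decides.exists_mem {α : ι → Type} (e : ∀ i, α i → Data) {P : ∀ i, α i → Prop}
    {l : ∀ i, List (α i)} (hl : Comp a fun i => .list ((l i).map (e i)))
    (hP : ∀ {κ : Type} {c : κ → Data} (φ : κ → ι) (x : ∀ k, α (φ k)),
      (Comp c fun k => a (φ k)) → (Comp c fun k => e _ (x k)) → Decides c fun k => P _ (x k)) :
    Decides a fun i => ∃ x ∈ l i, P i x := by
  classical
  have := Comp.foldl (σ := fun _ => Prop) e (fun _ p => .ofBool (decide p)) (l := l)
    (f := fun i s x => s ∨ P i x) (s₀ := fun _ => False) hl Decides.false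
    ((PolyBdd.const 2).mono fun q => ?_)
    (fun φ s x ha hs hx => Decides.or hs (hP φ x ha hx))
  · refine Decides.congr this fun i => ?_
    have : ∀ (l' : List (α i)) (s : Prop), l'.foldl (fun s x => s ∨ P i x) s ↔
        s ∨ ∃ x ∈ l', P i x := by
      intro l'
      induction l' with
      | nil => simp
      | cons x l' ih => intro s; simp [ih, or_assoc]
    simp [this]
  · cases decide q.2 <;> decide

theorem Decides.forall_mem {α : ι → Type} (e : ∀ i, α i → Data) {P : ∀ i, α i → Prop}
    {l : ∀ i, List (α i)} (hl : Comp a fun i => .list ((l i).map (e i)))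
    (hP : ∀ {κ : Type} {c : κ → Data} (φ : κ → ι) (x : ∀ k, α (φ k)),
      (Comp c fun k => a (φ k)) → (Comp c fun k => e _ (x k)) → Decides c fun k => P _ (x k)) :
    Decides a fun i => ∀ x ∈ l i, P i x :=
  (Decides.exists_mem (P := fun i x => ¬ P i x) e hl
    fun φ x ha hx => (hP φ x ha hx).not).not.congr fun i => by simp

/-- Numbers are counted up along a list. -/
theorem Data.size_nat_le (k : ℕ) : (Data.int k).size ≤ k + 1 := by
  rw [Data.size, Int.natAbs_natCast, add_comm]
  exact Nat.succ_le_succ (Nat.size_le.2 Nat.lt_two_pow_self)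

theorem Comp.list_range {l : ι → List Data} (h : Comp a fun i => .list (l i)) :
    Comp a fun i => .list ((List.range (l i).length).map fun k => .int (k : ℕ)) := by
  have hfold : ∀ l : List Data, l.foldl (fun (s : ℕ × List Data) _ =>
      (s.1 + 1, Data.int s.1 :: s.2)) (0, []) =
      (l.length, ((List.range l.length).map fun k => Data.int (k : ℕ)).reverse) := by
    intro l
    induction l using List.reverseRecOn with
    | nil => rfl
    | append_singleton l d ih => simp [ih, List.range_succ]
  have := Comp.foldl_of_polyBdd (a := a) (σ := fun _ => ℕ × List Data) (fun _ d => d)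
    (fun _ s => .pair (.int s.1) (.list s.2)) (l := l)
    (f := fun _ s _ => (s.1 + 1, Data.int s.1 :: s.2)) (s₀ := fun _ => (0, [])) (by simpa using h)
    ((Comp.const 0).pair (Comp.const 0))
    (fun φ s x _ hs _ => (hs.fst.add (.const 1)).pair (hs.fst.pair hs.snd)) ?_
  · refine this.snd.list_reverse.congr fun i => ?_
    rw [hfold]
    simp
  · have hs := h.size_bdd.reindex (Prod.fst : ι × ℕ → ι)
    refine (((hs.add (.const 2)).add (hs.mul (hs.add (.const 2)))).add (.const 1)).mono fun q => ?_
    rw [hfold]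
    dsimp only
    have hlen := Data.length_lt_size_list (l q.1)
    have htake : ((l q.1).take q.2).length ≤ (l q.1).length := List.length_take_le' _ _
    have h1 := Data.size_nat_le ((l q.1).take q.2).length
    have h2 := Data.size_list_le (l := ((List.range ((l q.1).take q.2).length).map
      fun k => Data.int (k : ℕ)).reverse) (B := (Data.list (l q.1)).size + 1) (by
        intro d hd
        simp only [List.mem_reverse, List.mem_map, List.mem_range] at hd
        obtain ⟨k, hk, rfl⟩ := hd
        have := Data.size_nat_le k
        omega)
    rw [List.length_reverse, List.length_map, List.length_range] at h2
    have h3 := Nat.mul_le_mul_right ((Data.list (l q.1)).size + 1 + 1) (htake.trans hlen.le)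
    simp only [add_assoc, Nat.reduceAdd] at h2 h3
    simp only [Data.size] at h1 ⊢
    omega

theorem Comp.list_getElem {l : ι → List Data} {k : ∀ i, Fin (l i).length}
    (h : Comp a fun i => .list (l i)) (hk : Comp a fun i => .int (k i : ℕ)) :
    Comp a fun i => (l i)[k i] := by
  classical
  have hfold : ∀ (l : List Data) (k : ℕ), l.foldl (fun (s : ℕ × Data) d =>
      (s.1 + 1, if ((s.1 : ℤ) = k) then d else s.2)) (0, .int 0) =
      (l.length, l.getD k (.int 0)) := by
    intro l k
    induction l using List.reverseRecOn with
    | nil => rfl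
    | append_singleton l d ih =>
      rw [List.foldl_append, ih]
      simp only [List.foldl_cons, List.foldl_nil, List.length_append, List.length_singleton,
        Nat.cast_inj, Prod.mk.injEq, true_and]
      split_ifs with hk
      · subst hk
        simp
      · rcases Nat.lt_or_gt_of_ne hk with h | h
        · rw [List.getD_eq_default _ _ h.le, List.getD_eq_default _ _ (by simp; omega)]
        · rw [List.getD_append _ _ _ _ h]
  have := Comp.foldl_of_polyBdd (a := a) (σ := fun _ => ℕ × Data) (fun _ d => d)
    (fun _ s => .pair (.int s.1) s.2) (l := l)
    (f := fun i s d => (s.1 + 1, if ((s.1 : ℤ) = (k i : ℕ)) then d else s.2))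
    (s₀ := fun _ => (0, .int 0)) (by simpa using h)
    ((Comp.const 0).pair (Comp.const 0))
    (fun φ s x ha hs hx => (hs.fst.add (.const 1)).pair (Comp.ite
      ((hs.fst.eq (hk.lift φ ha)).congr fun _ => by simp) hx hs.snd)) ?_
  · refine this.snd.congr fun i => ?_
    rw [hfold]
    simp
  · have hs := h.size_bdd.reindex (Prod.fst : ι × ℕ → ι)
    refine ((hs.add hs).add (.const 2)).mono fun q => ?_
    rw [hfold]
    dsimp only
    have hlen := Data.length_lt_size_list (l q.1)
    have htake : ((l q.1).take q.2).length ≤ (l q.1).length := List.length_take_le' _ _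
    have h1 := Data.size_nat_le ((l q.1).take q.2).length
    have h2 : (((l q.1).take q.2).getD (k q.1) (.int 0)).size ≤ (Data.list (l q.1)).size := by
      by_cases hlt : (k q.1 : ℕ) < ((l q.1).take q.2).length
      · rw [List.getD_eq_getElem _ _ hlt]
        exact (Data.size_lt_size_list (List.mem_of_mem_take (List.getElem_mem hlt))).le
      · rw [List.getD_eq_default _ _ (by omega)]
        exact Data.size_pos _
    simp only [Data.size] at h1 ⊢
    omega

theorem foldl_product {α β σ : Type*} (f : σ → α × β → σ) (l : List α) (l' : List β) (s : σ) :
    (l ×ˢ l').foldl f s = l.foldl (fun s x => l'.foldl (fun s y => f s (x, y)) s) s := by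
  induction l generalizing s with
  | nil => simp
  | cons x l ih => simp [List.product_cons, ih, List.foldl_map]

end Loops

/-! ### Operations on encoded vertex sets, edge sets and families of edge sets -/

section Encodings

/-- The list of all elements of `Fin n`. -/
def Data.fins (n : ℕ) : Data := .list ((List.finRange n).map fun v : Fin n => .int (v : ℕ))

/-- A set of vertices is written as a list of truth values. -/
def Data.vertexSet {n : ℕ} (U : Finset (Fin n)) : Data :=
  .list (List.ofFn fun v => .ofBool (decide (v ∈ U)))

variable {ι : Type} {a : ι → Data} {n r : ι → ℕ}

theorem Comp.fins_of_list {l : ι → List Data} (h : Comp a fun i => .list (l i))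
    (hl : ∀ i, (l i).length = n i) : Comp a fun i => .fins (n i) :=
  h.list_range.congr fun i => by
    rw [Data.fins, hl, ← List.map_coe_finRange_eq_range, List.map_map]
    rfl

theorem Comp.list_ofFn {g : ∀ i, Fin (n i) → Data} (hn : Comp a fun i => .fins (n i))
    (hg : ∀ {κ : Type} {c : κ → Data} (φ : κ → ι) (v : ∀ k, Fin (n (φ k))),
      (Comp c fun k => a (φ k)) → (Comp c fun k => .int (v k : ℕ)) → Comp c fun k => g _ (v k)) :
    Comp a fun i => .list (List.ofFn (g i)) :=
  (hn.list_map (fun _ (v : Fin _) => .int (v : ℕ)) hg).congr fun i => by rw [List.ofFn_eq_map]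

theorem Comp.ofFn_apply {g : ∀ i, Fin (n i) → Data} {v : ∀ i, Fin (n i)}
    (h : Comp a fun i => .list (List.ofFn (g i))) (hv : Comp a fun i => .int (v i : ℕ)) :
    Comp a fun i => g i (v i) :=
  (h.list_getElem (k := fun _ => ⟨v _, by simp⟩) hv).congr fun i => by simp

theorem Comp.fins_of_ofFn {g : ∀ i, Fin (n i) → Data}
    (h : Comp a fun i => .list (List.ofFn (g i))) : Comp a fun i => .fins (n i) :=
  h.fins_of_list fun _ => List.length_ofFn

theorem Comp.eq_fin {u v : ∀ i, Fin (n i)} (hu : Comp a fun i => .int (u i : ℕ))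
    (hv : Comp a fun i => .int (v i : ℕ)) : Decides a fun i => u i = v i :=
  (hu.eq hv).congr fun i => by simp [Fin.ext_iff]

theorem Comp.lt_fin {u v : ∀ i, Fin (n i)} (hu : Comp a fun i => .int (u i : ℕ))
    (hv : Comp a fun i => .int (v i : ℕ)) : Decides a fun i => u i < v i :=
  (hu.lt hv).congr fun i => by simp

theorem Decides.exists_fin {P : ∀ i, Fin (n i) → Prop} (hn : Comp a fun i => .fins (n i))
    (hP : ∀ {κ : Type} {c : κ → Data} (φ : κ → ι) (v : ∀ k, Fin (n (φ k))),
      (Comp c fun k => a (φ k)) → (Comp c fun k => .int (v k : ℕ)) →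
      Decides c fun k => P _ (v k)) : Decides a fun i => ∃ v, P i v :=
  (Decides.exists_mem (fun _ (v : Fin _) => .int (v : ℕ)) hn hP).congr fun i => by simp

theorem Decides.forall_fin {P : ∀ i, Fin (n i) → Prop} (hn : Comp a fun i => .fins (n i))
    (hP : ∀ {κ : Type} {c : κ → Data} (φ : κ → ι) (v : ∀ k, Fin (n (φ k))),
      (Comp c fun k => a (φ k)) → (Comp c fun k => .int (v k : ℕ)) →
      Decides c fun k => P _ (v k)) : Decides a fun i => ∀ v, P i v :=
  (Decides.forall_mem (fun _ (v : Fin _) => .int (v : ℕ)) hn hP).congr fun i => by simp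

theorem Comp.vertexSet {U : ∀ i, Finset (Fin (n i))} (hn : Comp a fun i => .fins (n i))
    (hU : ∀ {κ : Type} {c : κ → Data} (φ : κ → ι) (v : ∀ k, Fin (n (φ k))),
      (Comp c fun k => a (φ k)) → (Comp c fun k => .int (v k : ℕ)) →
      Decides c fun k => v k ∈ U _) : Comp a fun i => .vertexSet (U i) :=
  hn.list_ofFn fun φ v ha hv => (hU φ v ha hv).ofBool

theorem Comp.mem_vertexSet {U : ∀ i, Finset (Fin (n i))} {v : ∀ i, Fin (n i)}
    (hU : Comp a fun i => .vertexSet (U i)) (hv : Comp a fun i => .int (v i : ℕ)) :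
    Decides a fun i => v i ∈ U i := (Comp.ofFn_apply hU hv).decides

theorem Comp.edgeSet {T : ∀ i, Finset (Sym2 (Fin (n i)))} (hn : Comp a fun i => .fins (n i))
    (hT : ∀ {κ : Type} {c : κ → Data} (φ : κ → ι) (u v : ∀ k, Fin (n (φ k))),
      (Comp c fun k => a (φ k)) → (Comp c fun k => .int (u k : ℕ)) →
      (Comp c fun k => .int (v k : ℕ)) → Decides c fun k => s(u k, v k) ∈ T _) :
    Comp a fun i => .edgeSet (T i) :=
  hn.list_ofFn fun φ u ha hu => (hn.lift φ ha).list_ofFn fun ψ v hc hv =>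
    (hT (fun k => φ (ψ k)) (fun k => u (ψ k)) v (ha.lift ψ hc) (hu.lift ψ hc) hv).ofBool

theorem Comp.mem_edgeSet {T : ∀ i, Finset (Sym2 (Fin (n i)))} {u v : ∀ i, Fin (n i)}
    (hT : Comp a fun i => .edgeSet (T i)) (hu : Comp a fun i => .int (u i : ℕ))
    (hv : Comp a fun i => .int (v i : ℕ)) : Decides a fun i => s(u i, v i) ∈ T i :=
  (Comp.ofFn_apply (Comp.ofFn_apply hT hu) hv).decides

theorem Comp.fins_of_edgeSet {T : ∀ i, Finset (Sym2 (Fin (n i)))}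
    (hT : Comp a fun i => .edgeSet (T i)) : Comp a fun i => .fins (n i) := Comp.fins_of_ofFn hT

theorem Comp.edgeSets {S : ∀ i, Fin (r i) → Finset (Sym2 (Fin (n i)))}
    (hr : Comp a fun i => .fins (r i))
    (hS : ∀ {κ : Type} {c : κ → Data} (φ : κ → ι) (j : ∀ k, Fin (r (φ k))),
      (Comp c fun k => a (φ k)) → (Comp c fun k => .int (j k : ℕ)) →
      Comp c fun k => .edgeSet (S _ (j k))) : Comp a fun i => .edgeSets (S i) :=
  hr.list_ofFn hS

theorem Comp.edgeSets_apply {S : ∀ i, Fin (r i) → Finset (Sym2 (Fin (n i)))} {j : ∀ i, Fin (r i)}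
    (hS : Comp a fun i => .edgeSets (S i)) (hj : Comp a fun i => .int (j i : ℕ)) :
    Comp a fun i => .edgeSet (S i (j i)) := Comp.ofFn_apply hS hj

theorem Comp.fins_of_edgeSets {S : ∀ i, Fin (r i) → Finset (Sym2 (Fin (n i)))}
    (hS : Comp a fun i => .edgeSets (S i)) : Comp a fun i => .fins (r i) := Comp.fins_of_ofFn hS

theorem Comp.eq_edge {u v p q : ∀ i, Fin (n i)} (hu : Comp a fun i => .int (u i : ℕ))
    (hv : Comp a fun i => .int (v i : ℕ)) (hp : Comp a fun i => .int (p i : ℕ))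
    (hq : Comp a fun i => .int (q i : ℕ)) : Decides a fun i => s(u i, v i) = s(p i, q i) :=
  (((hu.eq_fin hp).and (hv.eq_fin hq)).or ((hu.eq_fin hq).and (hv.eq_fin hp))).congr fun i => by
    rw [Sym2.eq_iff]

theorem Comp.insert_edge {T : ∀ i, Finset (Sym2 (Fin (n i)))} {p q : ∀ i, Fin (n i)}
    (hT : Comp a fun i => .edgeSet (T i)) (hp : Comp a fun i => .int (p i : ℕ))
    (hq : Comp a fun i => .int (q i : ℕ)) : Comp a fun i => .edgeSet (insert s(p i, q i) (T i)) :=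
  hT.fins_of_edgeSet.edgeSet fun φ u v ha hu hv =>
    ((hu.eq_edge hv (hp.lift φ ha) (hq.lift φ ha)).or ((hT.lift φ ha).mem_edgeSet hu hv)).congr
      fun i => by rw [Finset.mem_insert]

theorem Comp.erase_edge {T : ∀ i, Finset (Sym2 (Fin (n i)))} {p q : ∀ i, Fin (n i)}
    (hT : Comp a fun i => .edgeSet (T i)) (hp : Comp a fun i => .int (p i : ℕ))
    (hq : Comp a fun i => .int (q i : ℕ)) : Comp a fun i => .edgeSet ((T i).erase s(p i, q i)) :=
  hT.fins_of_edgeSet.edgeSet fun φ u v ha hu hv =>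
    ((hu.eq_edge hv (hp.lift φ ha) (hq.lift φ ha)).not.and
      ((hT.lift φ ha).mem_edgeSet hu hv)).congr fun i => by rw [Finset.mem_erase]

theorem Data.lt_size_fins (n : ℕ) : n < (Data.fins n).size := by
  have := Data.length_lt_size_list ((List.finRange n).map fun v : Fin n => Data.int (v : ℕ))
  rwa [List.length_map, List.length_finRange] at this

theorem Data.size_list_ofFn_le {n : ℕ} {g : Fin n → Data} {B : ℕ} (h : ∀ v, (g v).size ≤ B) :
    (Data.list (List.ofFn g)).size ≤ n * (B + 1) + 1 := by
  have := Data.size_list_le (l := List.ofFn g) (B := B) fun d hd => by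
    obtain ⟨v, rfl⟩ := List.mem_ofFn.1 hd
    exact h v
  rwa [List.length_ofFn] at this

theorem Data.size_ofBool_le (b : Bool) : (Data.ofBool b).size ≤ 2 := by
  cases b <;> decide

theorem PolyBdd.list_ofFn {g : ∀ i, Fin (n i) → Data} (hn : Comp a fun i => .fins (n i))
    (hg : PolyBdd (fun q : Σ i, Fin (n i) => a q.1) fun q => (g q.1 q.2).size) :
    PolyBdd a fun i => (Data.list (List.ofFn (g i))).size := by
  obtain ⟨B, hB, hgB⟩ := hg.exists_uniform
  refine ((hn.size_bdd.mul (hB.add (.const 1))).add (.const 1)).mono fun i => ?_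
  refine (Data.size_list_ofFn_le (B := B i) fun v => hgB ⟨i, v⟩).trans ?_
  have := (Data.lt_size_fins (n i)).le
  gcongr

/-- The bound depends only on the number of vertices, not on the set, so loops with such states need
no invariant. -/
theorem PolyBdd.vertexSet {U : ∀ i, Finset (Fin (n i))} (hn : Comp a fun i => .fins (n i)) :
    PolyBdd a fun i => (Data.vertexSet (U i)).size :=
  PolyBdd.list_ofFn hn ((PolyBdd.const 2).mono fun _ => Data.size_ofBool_le _)

theorem PolyBdd.edgeSet {T : ∀ i, Finset (Sym2 (Fin (n i)))} (hn : Comp a fun i => .fins (n i)) :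
    PolyBdd a fun i => (Data.edgeSet (T i)).size :=
  PolyBdd.list_ofFn hn (PolyBdd.list_ofFn (hn.reindex Sigma.fst)
    ((PolyBdd.const 2).mono fun _ => Data.size_ofBool_le _))

theorem PolyBdd.edgeSets {S : ∀ i, Fin (r i) → Finset (Sym2 (Fin (n i)))}
    (hn : Comp a fun i => .fins (n i)) (hr : Comp a fun i => .fins (r i)) :
    PolyBdd a fun i => (Data.edgeSets (S i)).size :=
  PolyBdd.list_ofFn hr (PolyBdd.edgeSet (hn.reindex Sigma.fst))

theorem Comp.card {U : ∀ i, Finset (Fin (n i))} (hU : Comp a fun i => .vertexSet (U i)) :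
    Comp a fun i => .int ((U i).card : ℕ) := by
  have hn : Comp a fun i => .fins (n i) := Comp.fins_of_ofFn hU
  have hfold : ∀ {n : ℕ} (U : Finset (Fin n)) (l : List (Fin n)) (m : ℕ),
      l.foldl (fun m v => if v ∈ U then m + 1 else m) m = m + (l.filter (· ∈ U)).length := by
    intro n U l
    induction l with
    | nil => simp
    | cons v l ih =>
      intro m
      rw [List.foldl_cons, ih, List.filter_cons]
      split_ifs with h1 h2 h2
      · rw [List.length_cons]; omega
      · simp [h1] at h2
      · simp [h1] at h2
      · rfl
  have := Comp.foldl_of_polyBdd (σ := fun _ => ℕ) (fun _ (v : Fin _) => .int (v : ℕ))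
    (fun _ m => .int m)
    (f := fun i m v => if v ∈ U i then m + 1 else m) (s₀ := fun _ => 0) hn (Comp.const 0)
    (fun φ m v ha hm hv => Comp.ite_apply (σ := fun _ => ℕ) (fun _ m => .int m)
      (P := fun k => v k ∈ U (φ k)) (x := fun k => m k + 1) (y := m)
      ((hU.lift φ ha).mem_vertexSet hv) (hm.add (.const 1)) hm) ?_
  · refine this.congr fun i => ?_
    rw [hfold, zero_add]
    congr 2
    rw [← List.toFinset_card_of_nodup ((List.nodup_finRange _).filter _)]
    congr 1
    ext v
    simp
  · refine ((hn.size_bdd.reindex (Prod.fst : ι × ℕ → ι)).add (.const 1)).mono fun q => ?_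
    rw [hfold, zero_add]
    refine (Data.size_nat_le _).trans (Nat.succ_le_succ ?_)
    refine le_trans ?_ (Data.lt_size_fins (n q.1)).le
    refine (List.length_filter_le _ _).trans ((List.length_take_le' _ _).trans ?_)
    rw [List.length_finRange]

end Encodings

/-! ### Reachability by repeated growth -/

section Reachability

variable {V : Type*} [Fintype V] [DecidableEq V]

/-- Add all neighbours. -/
def grow (T : Finset (Sym2 V)) (R : Finset V) : Finset V :=
  Finset.univ.filter fun v => v ∈ R ∨ ∃ w, w ∈ R ∧ s(w, v) ∈ T

/-- Grow the set `{u}` as often as the list `vs` is long. -/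
def reachSet (vs : List V) (T : Finset (Sym2 V)) (u : V) : Finset V :=
  vs.foldl (fun R _ => grow T R) {u}

/-- Each round either gains a vertex or shows that the set is closed under edges, so |V| rounds
reach a fixed point. -/
theorem mem_reachSet {vs : List V} (hvs : ∀ v, v ∈ vs) {T : Finset (Sym2 V)} {u v : V} :
    v ∈ reachSet vs T u ↔ Reach T u v := by
  have hsub : ∀ R : Finset V, R ⊆ grow T R := fun R v hv => by simp [grow, hv]
  have key : ∀ l : List V, u ∈ l.foldl (fun R _ => grow T R) {u} ∧
      (∀ v ∈ l.foldl (fun R _ => grow T R) {u}, Reach T u v) ∧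
      (grow T (l.foldl (fun R _ => grow T R) {u}) = l.foldl (fun R _ => grow T R) {u} ∨
        l.length < (l.foldl (fun R _ => grow T R) {u}).card) := by
    intro l
    induction l using List.reverseRecOn with
    | nil => simp [Reach.refl]
    | append_singleton l w ih =>
      rw [List.foldl_append, List.foldl_cons, List.foldl_nil, List.length_append,
        List.length_singleton]
      set R := l.foldl (fun R _ => grow T R) {u}
      obtain ⟨h1, h2, h3⟩ := ih
      refine ⟨hsub _ h1, fun v hv => ?_, ?_⟩
      · simp only [grow, Finset.mem_filter, Finset.mem_univ, true_and] at hv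
        rcases hv with hv | ⟨w, hw, hwv⟩
        · exact h2 v hv
        · exact (h2 w hw).trans (.of_mem hwv)
      · by_cases h : grow T R = R
        · rw [h]
          exact Or.inl h
        · have := Finset.card_lt_card
            (Finset.ssubset_iff_subset_ne.2 ⟨hsub R, fun e => h e.symm⟩)
          have := h3.resolve_left h
          exact Or.inr (by omega)
  have hlen : Fintype.card V ≤ vs.length := by
    rw [← Finset.card_univ]
    exact (Finset.card_le_card (fun v _ => List.mem_toFinset.2 (hvs v))).trans
      (List.toFinset_card_le vs)
  obtain ⟨h1, h2, h3⟩ := key vs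
  have h4 := h3.resolve_right fun h => by
    have := Finset.card_le_univ (vs.foldl (fun R _ => grow T R) {u})
    omega
  refine ⟨h2 v, fun h => h.induct (P := fun v => v ∈ reachSet vs T u) h1 fun p q _ hp hpq => ?_⟩
  change q ∈ vs.foldl (fun R _ => grow T R) {u}
  rw [← h4, grow, Finset.mem_filter]
  exact ⟨Finset.mem_univ _, Or.inr ⟨p, hp, hpq⟩⟩

end Reachability

/-! ### The reassembling algorithm runs in polynomial time -/

section Complexity

variable {ι : Type} {a : ι → Data} {n r : ι → ℕ}

theorem Comp.foldl_vertexSet {m : ι → ℕ} {U : ∀ i, Finset (Fin (n i))}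
    {f : ∀ i, Finset (Fin (n i)) → Fin (m i) → Finset (Fin (n i))}
    (hm : Comp a fun i => .fins (m i)) (hU : Comp a fun i => .vertexSet (U i))
    (hf : ∀ {κ : Type} {c : κ → Data} (φ : κ → ι) (U : ∀ k, Finset (Fin (n (φ k))))
      (x : ∀ k, Fin (m (φ k))), (Comp c fun k => a (φ k)) → (Comp c fun k => .vertexSet (U k)) →
      (Comp c fun k => .int (x k : ℕ)) → Comp c fun k => .vertexSet (f (φ k) (U k) (x k))) :
    Comp a fun i => .vertexSet ((List.finRange (m i)).foldl (f i) (U i)) :=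
  Comp.foldl (fun _ (v : Fin _) => .int (v : ℕ)) (fun _ => .vertexSet) hm hU
    (PolyBdd.vertexSet ((Comp.fins_of_ofFn hU).reindex Sigma.fst)) hf

theorem Comp.foldl_edgeSets {m : ι → ℕ} {S : ∀ i, Fin (r i) → Finset (Sym2 (Fin (n i)))}
    {f : ∀ i, (Fin (r i) → Finset (Sym2 (Fin (n i)))) → Fin (m i) →
      Fin (r i) → Finset (Sym2 (Fin (n i)))}
    (hm : Comp a fun i => .fins (m i)) (hn : Comp a fun i => .fins (n i))
    (hS : Comp a fun i => .edgeSets (S i))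
    (hf : ∀ {κ : Type} {c : κ → Data} (φ : κ → ι)
      (S : ∀ k, Fin (r (φ k)) → Finset (Sym2 (Fin (n (φ k)))))
      (x : ∀ k, Fin (m (φ k))), (Comp c fun k => a (φ k)) → (Comp c fun k => .edgeSets (S k)) →
      (Comp c fun k => .int (x k : ℕ)) → Comp c fun k => .edgeSets (f (φ k) (S k) (x k))) :
    Comp a fun i => .edgeSets ((List.finRange (m i)).foldl (f i) (S i)) :=
  Comp.foldl (fun _ (v : Fin _) => .int (v : ℕ)) (fun _ => .edgeSets) hm hS
    (PolyBdd.edgeSets (hn.reindex Sigma.fst) (hS.fins_of_edgeSets.reindex Sigma.fst)) hf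

theorem Decides.reach {T : ∀ i, Finset (Sym2 (Fin (n i)))} {u v : ∀ i, Fin (n i)}
    (hT : Comp a fun i => .edgeSet (T i)) (hu : Comp a fun i => .int (u i : ℕ))
    (hv : Comp a fun i => .int (v i : ℕ)) : Decides a fun i => Reach (T i) (u i) (v i) := by
  have hn := hT.fins_of_edgeSet
  have h : Comp a fun i => .vertexSet (reachSet (List.finRange (n i)) (T i) (u i)) := by
    refine Comp.foldl_vertexSet hn (hn.vertexSet fun φ v ha hv => ?_) fun φ R _ ha hR _ => ?_
    · exact (hv.eq_fin (hu.lift φ ha)).congr fun i => by rw [Finset.mem_singleton]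
    · refine (hn.lift φ ha).vertexSet fun ψ v hc hv => ?_
      refine ((hR.lift ψ hc).mem_vertexSet hv |>.or (Decides.exists_fin
        (P := fun k w => w ∈ R (ψ k) ∧ s(w, v k) ∈ T (φ (ψ k)))
        (hn.lift (fun k => φ (ψ k)) (ha.lift ψ hc)) fun χ w hd hw => ?_)).congr fun i => ?_
      · exact ((hR.lift (fun k => ψ (χ k)) (hc.lift χ hd)).mem_vertexSet hw).and
          ((hT.lift (fun k => φ (ψ (χ k))) (ha.lift (fun k => ψ (χ k)) (hc.lift χ hd))).mem_edgeSet
            hw (hv.lift χ hd))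
      · simp only [grow, Finset.mem_filter, Finset.mem_univ, true_and]
  exact (h.mem_vertexSet hv).congr fun i => mem_reachSet List.mem_finRange

theorem Comp.side {T : ∀ i, Finset (Sym2 (Fin (n i)))} {s p q : ∀ i, Fin (n i)}
    (hT : Comp a fun i => .edgeSet (T i)) (hs : Comp a fun i => .int (s i : ℕ))
    (hp : Comp a fun i => .int (p i : ℕ)) (hq : Comp a fun i => .int (q i : ℕ)) :
    Comp a fun i => .vertexSet (PathTSP.side (s i) (T i) s(p i, q i)) :=
  hT.fins_of_edgeSet.vertexSet fun φ v ha hv =>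
    (Decides.reach ((hT.erase_edge hp hq).lift φ ha) (hs.lift φ ha) hv).congr fun i => by
      simp [PathTSP.side]

theorem Decides.connected {T : ∀ i, Finset (Sym2 (Fin (n i)))}
    (hT : Comp a fun i => .edgeSet (T i)) : Decides a fun i => ∀ u v, Reach (T i) u v := by
  have hn := hT.fins_of_edgeSet
  exact Decides.forall_fin hn fun φ u ha hu => Decides.forall_fin
    (P := fun k v => Reach (T (φ k)) (u k) v) (hn.lift φ ha) fun ψ v hc hv =>
    Decides.reach (hT.lift (fun k => φ (ψ k)) (ha.lift ψ hc)) (hu.lift ψ hc) hv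

variable {S : ∀ i, Fin (r i) → Finset (Sym2 (Fin (n i)))} {j k : ∀ i, Fin (r i)}
  {s u v p q : ∀ i, Fin (n i)}

theorem Decides.exchangeable (hS : Comp a fun i => .edgeSets (S i))
    (hj : Comp a fun i => .int (j i : ℕ)) (hk : Comp a fun i => .int (k i : ℕ))
    (hu : Comp a fun i => .int (u i : ℕ)) (hv : Comp a fun i => .int (v i : ℕ))
    (hp : Comp a fun i => .int (p i : ℕ)) (hq : Comp a fun i => .int (q i : ℕ)) :
    Decides a fun i => Exchangeable (S i) (j i) (k i) s(u i, v i) s(p i, q i) :=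
  ((hS.edgeSets_apply hk).mem_edgeSet hu hv).and
    (((hS.edgeSets_apply hj).mem_edgeSet hp hq).and
      ((Decides.connected (((hS.edgeSets_apply hj).erase_edge hp hq).insert_edge hu hv)).and
        (Decides.connected (((hS.edgeSets_apply hk).erase_edge hu hv).insert_edge hp hq))))

theorem Comp.swap (hS : Comp a fun i => .edgeSets (S i))
    (hj : Comp a fun i => .int (j i : ℕ)) (hk : Comp a fun i => .int (k i : ℕ))
    (hu : Comp a fun i => .int (u i : ℕ)) (hv : Comp a fun i => .int (v i : ℕ))
    (hp : Comp a fun i => .int (p i : ℕ)) (hq : Comp a fun i => .int (q i : ℕ)) :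
    Comp a fun i => .edgeSets (PathTSP.swap (S i) (j i) (k i) s(u i, v i) s(p i, q i)) := by
  refine hS.fins_of_edgeSets.edgeSets fun φ l ha hl => ?_
  refine (Comp.ite (hl.eq_fin (hk.lift φ ha))
    ((((hS.edgeSets_apply hk).erase_edge hu hv).insert_edge hp hq).lift φ ha)
    (Comp.ite (hl.eq_fin (hj.lift φ ha))
      ((((hS.edgeSets_apply hj).erase_edge hp hq).insert_edge hu hv).lift φ ha)
      ((hS.lift φ ha).edgeSets_apply hl))).congr fun i => ?_
  unfold PathTSP.swap
  split_ifs with h1 h2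
  · rw [h1, Function.update_self]
  · rw [Function.update_of_ne h1, h2, Function.update_self]
  · rw [Function.update_of_ne h1, Function.update_of_ne h2]

variable {K L N : ∀ i, Finset (Fin (n i))}

theorem Comp.label (hK : Comp a fun i => .vertexSet (K i)) (hL : Comp a fun i => .vertexSet (L i))
    (hN : Comp a fun i => .vertexSet (N i)) (hv : Comp a fun i => .int (v i : ℕ)) :
    Comp a fun i => .int (PathTSP.label (K i) (L i) (N i) (v i) : ℕ) :=
  (((Comp.ite (hK.mem_vertexSet hv) (.const 0) (.const 1)).congr fun i => by
      rw [← apply_ite Data.int]).add ((Comp.ite (hL.mem_vertexSet hv) (.const 0) (.const 1)).congr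
      fun i => by rw [← apply_ite Data.int])).add
    ((Comp.ite (hN.mem_vertexSet hv) (.const 0) (.const 1)).congr fun i => by
      rw [← apply_ite Data.int]) |>.congr fun i => by simp [PathTSP.label]

theorem Decides.admits (M : Mask) (hK : Comp a fun i => .vertexSet (K i))
    (hL : Comp a fun i => .vertexSet (L i)) (hN : Comp a fun i => .vertexSet (N i))
    (hu : Comp a fun i => .int (u i : ℕ)) (hv : Comp a fun i => .int (v i : ℕ))
    (hp : Comp a fun i => .int (p i : ℕ)) (hq : Comp a fun i => .int (q i : ℕ)) :
    Decides a fun i => M.Admits (label (K i) (L i) (N i)) (u i) (v i) (p i) (q i) :=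
  (((Comp.const M.aMin).le (hK.label hL hN hu)).and
    (((hK.label hL hN hu).le (.const M.aMax)).and (((hK.label hL hN hv).eq (.const M.b)).and
      (((Comp.const M.pMin).le (hK.label hL hN hp)).and
        (((hK.label hL hN hp).le (.const M.pMax)).and ((hK.label hL hN hq).eq
          (.const 3))))))).congr fun i => by
    simp only [Mask.Admits, Nat.cast_le, Data.int.injEq, Nat.cast_inj]
    norm_cast

theorem Comp.sweep (M : Mask) (hn : Comp a fun i => .fins (n i))
    (hK : Comp a fun i => .vertexSet (K i))
    (hL : Comp a fun i => .vertexSet (L i)) (hN : Comp a fun i => .vertexSet (N i))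
    (hj : Comp a fun i => .int (j i : ℕ)) (hS : Comp a fun i => .edgeSets (S i)) :
    Comp a fun i => .edgeSets
      (PathTSP.sweep (List.finRange (n i)) M (PathTSP.label (K i) (L i) (N i)) (j i) (S i)) := by
  simp only [PathTSP.sweep, foldl_product]
  refine Comp.foldl_edgeSets hS.fins_of_edgeSets hn hS fun φ S k ha hS hk => ?_
  refine Comp.foldl_edgeSets (hn.lift φ ha) (hn.lift φ ha) hS fun φ₁ S u h₁ hS hu => ?_
  replace ha := ha.lift φ₁ h₁
  replace hk := hk.lift φ₁ h₁
  refine Comp.foldl_edgeSets (hn.lift _ ha) (hn.lift _ ha) hS fun φ₂ S v h₂ hS hv => ?_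
  replace ha := ha.lift φ₂ h₂
  replace hk := hk.lift φ₂ h₂
  replace hu := hu.lift φ₂ h₂
  refine Comp.foldl_edgeSets (hn.lift _ ha) (hn.lift _ ha) hS fun φ₃ S p h₃ hS hp => ?_
  replace ha := ha.lift φ₃ h₃
  replace hk := hk.lift φ₃ h₃
  replace hu := hu.lift φ₃ h₃
  replace hv := hv.lift φ₃ h₃
  refine Comp.foldl_edgeSets (hn.lift _ ha) (hn.lift _ ha) hS fun φ₄ S q h₄ hS hq => ?_
  replace ha := ha.lift φ₄ h₄
  replace hk := hk.lift φ₄ h₄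
  replace hu := hu.lift φ₄ h₄
  replace hv := hv.lift φ₄ h₄
  replace hp := hp.lift φ₄ h₄
  refine Comp.ite_apply (σ := fun _ => Fin (r _) → Finset (Sym2 (Fin (n _))))
    (fun _ => .edgeSets) ?_ (Comp.swap hS (hj.lift _ ha) hk hu hv hp hq) hS
  exact ((hj.lift _ ha).lt_fin hk).and ((Decides.admits M (hK.lift _ ha) (hL.lift _ ha)
    (hN.lift _ ha) hu hv hp hq).and
    (Decides.exchangeable hS (hj.lift _ ha) hk hu hv hp hq))

theorem Comp.sweeps (M : Mask) (hn : Comp a fun i => .fins (n i))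
    (hK : Comp a fun i => .vertexSet (K i))
    (hL : Comp a fun i => .vertexSet (L i)) (hN : Comp a fun i => .vertexSet (N i))
    (hj : Comp a fun i => .int (j i : ℕ)) (hS : Comp a fun i => .edgeSets (S i)) :
    Comp a fun i => .edgeSets
      (PathTSP.sweeps (List.finRange (n i)) M (PathTSP.label (K i) (L i) (N i)) (j i) (S i)) :=
  Comp.foldl_edgeSets hn hn hS fun φ _ _ ha hS _ => Comp.sweep M (hn.lift φ ha) (hK.lift φ ha)
    (hL.lift φ ha) (hN.lift φ ha) (hj.lift φ ha) hS

theorem Comp.stage (hn : Comp a fun i => .fins (n i)) (hK : Comp a fun i => .vertexSet (K i))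
    (hL : Comp a fun i => .vertexSet (L i)) (hN : Comp a fun i => .vertexSet (N i))
    (hj : Comp a fun i => .int (j i : ℕ)) (hS : Comp a fun i => .edgeSets (S i)) :
    Comp a fun i => .edgeSets
      (PathTSP.stage (List.finRange (n i)) (j i) (K i) (L i) (N i) (S i)) :=
  Comp.sweeps _ hn hK hL hN hj <| Comp.sweeps _ hn hK hL hN hj <|
    Comp.sweeps _ hn hK hL hN hj <| Comp.sweeps _ hn hK hL hN hj hS

theorem Comp.candidate {P : ∀ i, Finset (Fin (n i)) → Prop} {m : ι → ℕ}
    (hn : Comp a fun i => .fins (n i))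
    (hP : ∀ {κ : Type} {c : κ → Data} (φ : κ → ι) (U : ∀ k, Finset (Fin (n (φ k)))),
      (Comp c fun k => a (φ k)) → (Comp c fun k => .vertexSet (U k)) →
      Decides c fun k => P _ (U k))
    (hs : Comp a fun i => .int (s i : ℕ)) (hm : Comp a fun i => .int (m i))
    (hS : Comp a fun i => .edgeSets (S i)) :
    Comp a fun i => .vertexSet
      (PathTSP.candidate (List.finRange (n i)) (P i) (s i) (m i) (S i)) := by
  simp only [PathTSP.candidate, foldl_product]
  refine Comp.foldl_vertexSet hS.fins_of_edgeSets (hn.vertexSet fun φ v ha hv =>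
    Decides.false.congr fun i => by simp) fun φ U k ha hU hk => ?_
  refine Comp.foldl_vertexSet (hn.lift φ ha) hU fun φ₁ U u h₁ hU hu => ?_
  replace ha := ha.lift φ₁ h₁
  replace hk := hk.lift φ₁ h₁
  refine Comp.foldl_vertexSet (hn.lift _ ha) hU fun φ₂ U v h₂ hU hv => ?_
  replace ha := ha.lift φ₂ h₂
  replace hk := hk.lift φ₂ h₂
  replace hu := hu.lift φ₂ h₂
  have hT := (hS.lift _ ha).edgeSets_apply hk
  have hside := hT.side (hs.lift _ ha) hu hv
  refine Comp.ite_apply (σ := fun _ => Finset (Fin (n _))) (fun _ => .vertexSet)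
    ((hT.mem_edgeSet hu hv).and ((hP _ _ ha hside).and ?_)) hside hU
  exact (hside.card.eq (hm.lift _ ha)).congr fun i => by simp

theorem Comp.untangle {P : ∀ i, Finset (Fin (n i)) → Prop}
    (hn : Comp a fun i => .fins (n i))
    (hP : ∀ {κ : Type} {c : κ → Data} (φ : κ → ι) (U : ∀ k, Finset (Fin (n (φ k)))),
      (Comp c fun k => a (φ k)) → (Comp c fun k => .vertexSet (U k)) →
      Decides c fun k => P _ (U k))
    (hs : Comp a fun i => .int (s i : ℕ)) (hj : Comp a fun i => .int (j i : ℕ))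
    (hS : Comp a fun i => .edgeSets (S i)) :
    Comp a fun i => .edgeSets
      (PathTSP.untangle (List.finRange (n i)) (P i) (s i) (j i) (S i)) := by
  refine Comp.snd (Comp.snd (Comp.foldl
    (σ := fun i => Finset (Fin (n i)) × Finset (Fin (n i)) ×
      (Fin (r i) → Finset (Sym2 (Fin (n i)))))
    (fun _ (m : ℕ) => .int m)
    (fun _ Z => .pair (.vertexSet Z.1) (.pair (.vertexSet Z.2.1) (.edgeSets Z.2.2)))
    (f := fun i => extend (List.finRange (n i)) (P i) (s i) (j i))
    (s₀ := fun i => (∅, {s i}, S i)) ?_ ?_ ?_ ?_))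
  · exact hn.congr fun i => by
      rw [Data.fins, List.length_finRange, ← List.map_coe_finRange_eq_range, List.map_map]
      rfl
  · exact (hn.vertexSet fun φ v ha hv => Decides.false.congr fun i => by simp).pair
      ((hn.vertexSet fun φ v ha hv => (hv.eq_fin (hs.lift φ ha)).congr fun i => by simp).pair hS)
  · have hn' := hn.reindex (Sigma.fst : (Σ i, Finset (Fin (n i)) × Finset (Fin (n i)) ×
      (Fin (r i) → Finset (Sym2 (Fin (n i))))) → ι)
    refine (((PolyBdd.vertexSet (U := fun q => q.2.1) hn').add
      ((PolyBdd.vertexSet (U := fun q => q.2.2.1) hn').add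
        (PolyBdd.edgeSets (S := fun q => q.2.2.2) hn'
          (hS.fins_of_edgeSets.reindex Sigma.fst)))).add (.const 2)).mono fun q => ?_
    simp only [Data.size]
    omega
  · intro κ c φ Z m ha hZ hm
    have hcand := Comp.candidate (S := fun k => (Z k).2.2) (P := fun k => P (φ k)) (hn.lift φ ha)
      (fun ψ U hc hU => hP (fun k => φ (ψ k)) U (ha.lift ψ hc) hU) (hs.lift φ ha) hm hZ.snd.snd
    refine Comp.ite_apply (σ := fun _ => Finset (Fin (n _)) × Finset (Fin (n _)) ×
      (Fin (r _) → Finset (Sym2 (Fin (n _)))))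
      (fun _ Z => .pair (.vertexSet Z.1) (.pair (.vertexSet Z.2.1) (.edgeSets Z.2.2)))
      ((((Comp.const 2).le hm).congr fun i => by simp).and
        (hcand.mem_vertexSet (hs.lift φ ha)))
      (hZ.snd.fst.pair (hcand.pair (Comp.stage (hn.lift φ ha) hZ.fst hZ.snd.fst hcand
        (hj.lift φ ha) hZ.snd.snd))) hZ

theorem Comp.reassemble {P : ∀ i, ℕ → Finset (Fin (n i)) → Prop}
    (hn : Comp a fun i => .fins (n i))
    (hP : ∀ {κ : Type} {c : κ → Data} (φ : κ → ι) (j : κ → ℕ) (U : ∀ k, Finset (Fin (n (φ k)))),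
      (Comp c fun k => a (φ k)) → (Comp c fun k => .int (j k)) →
      (Comp c fun k => .vertexSet (U k)) → Decides c fun k => P _ (j k) (U k))
    (hs : Comp a fun i => .int (s i : ℕ)) (hS : Comp a fun i => .edgeSets (S i)) :
    Comp a fun i => .edgeSets
      (PathTSP.reassemble (List.finRange (n i)) (P i) (s i) (S i)) :=
  Comp.foldl_edgeSets hS.fins_of_edgeSets hn hS fun φ _ j ha hS hj =>
    Comp.untangle (P := fun k => P (φ k) (j k)) (hn.lift φ ha)
      (fun ψ U hc hU => hP (fun k => φ (ψ k)) (fun k => j (ψ k)) U (ha.lift ψ hc) (hj.lift ψ hc) hU)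
      (hs.lift φ ha) hj hS

end Complexity

/-! ### Sums of unreduced fractions -/

section Fractions

/-- The sum of a list of fractions, which is not reduced. -/
def fracSum (l : List (ℤ × ℤ)) : ℤ × ℤ :=
  l.foldl (fun s x => (s.1 * x.2 + x.1 * s.2, s.2 * x.2)) (0, 1)

theorem fracSum_append_singleton (l : List (ℤ × ℤ)) (x : ℤ × ℤ) : fracSum (l ++ [x]) =
    ((fracSum l).1 * x.2 + x.1 * (fracSum l).2, (fracSum l).2 * x.2) := by
  simp [fracSum]

theorem fracSum_spec {l : List (ℤ × ℤ)} (h : ∀ x ∈ l, 0 < x.2) : 0 < (fracSum l).2 ∧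
    ((fracSum l).1 : ℝ) / (fracSum l).2 = (l.map fun x => (x.1 : ℝ) / x.2).sum := by
  induction l using List.reverseRecOn with
  | nil => simp [fracSum]
  | append_singleton l x ih =>
    obtain ⟨h1, h2⟩ := ih fun y hy => h y (List.mem_append_left _ hy)
    have hx := h x (by simp)
    rw [fracSum_append_singleton]
    refine ⟨mul_pos h1 hx, ?_⟩
    rw [List.map_append, List.sum_append, ← h2]
    have h1' : ((fracSum l).2 : ℝ) ≠ 0 := by exact_mod_cast h1.ne'
    have hx' : (x.2 : ℝ) ≠ 0 := by exact_mod_cast hx.ne'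
    simp only [List.map_cons, List.map_nil, List.sum_cons, List.sum_nil, add_zero]
    push_cast
    field_simp

/-- Denominators are multiplied without reduction, so bit lengths add up over the list and stay
linear in its size. The 4 extra units per fraction in the encoding give a factor 16, which absorbs
the sum of two products in the numerator. -/
theorem natAbs_fracSum_le (l : List (ℤ × ℤ)) :
    (fracSum l).1.natAbs ≤ 2 ^ (Data.list (l.map fun x => .pair (.int x.1) (.int x.2))).size ∧
    (fracSum l).2.natAbs ≤ 2 ^ (Data.list (l.map fun x => .pair (.int x.1) (.int x.2))).size := by
  induction l using List.reverseRecOn with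
  | nil => exact ⟨by simp [fracSum], Nat.one_le_two_pow⟩
  | append_singleton l x ih =>
    obtain ⟨h1, h2⟩ := ih
    rw [fracSum_append_singleton]
    have hsize : (Data.list ((l ++ [x]).map fun x => .pair (.int x.1) (.int x.2))).size =
        (Data.list (l.map fun x => .pair (.int x.1) (.int x.2))).size +
          (x.1.natAbs.size + x.2.natAbs.size + 4) := by
      simp only [Data.size_list, List.map_append, List.sum_append, List.map_cons, List.map_nil,
        List.sum_cons, List.sum_nil, Data.size]
      omega
    rw [hsize]
    set m := (Data.list (l.map fun x => .pair (.int x.1) (.int x.2))).size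
    have h3 := (Nat.lt_size_self x.1.natAbs).le
    have h4 := (Nat.lt_size_self x.2.natAbs).le
    have h5 : 2 ^ x.1.natAbs.size ≤ 2 ^ (x.1.natAbs.size + x.2.natAbs.size) :=
      Nat.pow_le_pow_right two_pos (by omega)
    have h6 : 2 ^ x.2.natAbs.size ≤ 2 ^ (x.1.natAbs.size + x.2.natAbs.size) :=
      Nat.pow_le_pow_right two_pos (by omega)
    have h7 := Nat.mul_le_mul h1 (h4.trans h6)
    have h8 := Nat.mul_le_mul (h3.trans h5) h2
    have h9 := Nat.mul_le_mul h2 (h4.trans h6)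
    have h10 : 2 ^ (m + (x.1.natAbs.size + x.2.natAbs.size + 4)) =
        16 * (2 ^ m * 2 ^ (x.1.natAbs.size + x.2.natAbs.size)) := by
      rw [← pow_add, ← add_assoc, pow_add _ _ 4]
      ring
    rw [h10]
    rw [mul_comm (2 ^ (x.1.natAbs.size + x.2.natAbs.size))] at h8
    have h11 := Int.natAbs_add_le ((fracSum l).1 * x.2) (x.1 * (fracSum l).2)
    rw [Int.natAbs_mul, Int.natAbs_mul] at h11
    dsimp only
    rw [Int.natAbs_mul]
    omega

variable {ι : Type} {a : ι → Data}

theorem Comp.fracSum {l : ι → List (ℤ × ℤ)}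
    (h : Comp a fun i => .list ((l i).map fun x => .pair (.int x.1) (.int x.2))) :
    Comp a fun i => .pair (.int (fracSum (l i)).1) (.int (fracSum (l i)).2) := by
  refine Comp.foldl_of_polyBdd (σ := fun _ => ℤ × ℤ)
    (fun _ (x : ℤ × ℤ) => .pair (.int x.1) (.int x.2)) (fun _ x => .pair (.int x.1) (.int x.2)) h
    ((Comp.const 0).pair (.const 1)) (fun φ s x _ hs hx =>
      ((hs.fst.mul hx.snd).add (hx.fst.mul hs.snd)).pair (hs.snd.mul hx.snd)) ?_
  have hs := h.size_bdd.reindex (Prod.fst : ι × ℕ → ι)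
  refine ((hs.add hs).add (.const 5)).mono fun q => ?_
  change (Data.pair (.int (PathTSP.fracSum ((l q.1).take q.2)).1)
    (.int (PathTSP.fracSum ((l q.1).take q.2)).2)).size ≤ _
  obtain ⟨h1, h2⟩ := natAbs_fracSum_le ((l q.1).take q.2)
  have h3 := Data.size_list_le_of_sublist (((l q.1).take_sublist q.2).map
    fun x => Data.pair (.int x.1) (.int x.2))
  have h4 : ∀ {k m : ℕ}, k ≤ 2 ^ m → k.size ≤ m + 1 := fun h =>
    Nat.size_le.2 (h.trans_lt (Nat.pow_lt_pow_right one_lt_two (Nat.lt_succ_self _)))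
  have h5 := h4 h1
  have h6 := h4 h2
  simp only [Data.size] at h5 h6 ⊢
  omega

end Fractions

/-! ### Deciding relevance by integer arithmetic -/

section Main

/-- Each edge of the cut has exactly one orientation leading out of U, so the sum over ordered pairs
counts it once. -/
theorem weight_cut_eq_sum {V : Type*} [Fintype V] [DecidableEq V] (x : Sym2 V → ℝ)
    (U : Finset V) :
    weight x (cut U) = ∑ u, ∑ v, if u ∈ U ∧ v ∉ U then x s(u, v) else 0 := by
  have hcut : cut U = (U ×ˢ Uᶜ).image fun p => s(p.1, p.2) := by
    ext e
    simp only [cut, Finset.mem_filter, Finset.mem_univ, true_and, Finset.mem_image,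
      Finset.mem_product, Finset.mem_compl, Prod.exists]
    constructor
    · rintro ⟨u, hu, v, hv, rfl⟩
      exact ⟨u, v, ⟨hu, hv⟩, rfl⟩
    · rintro ⟨u, v, ⟨hu, hv⟩, rfl⟩
      exact ⟨u, hu, v, hv, rfl⟩
  have hinj : Set.InjOn (fun p : V × V => s(p.1, p.2)) (U ×ˢ Uᶜ : Finset (V × V)) := by
    rintro ⟨u, v⟩ huv ⟨u', v'⟩ huv' h
    simp only [Finset.coe_product, Set.mem_prod, Finset.mem_coe, Finset.mem_compl] at huv huv'
    rcases Sym2.eq_iff.1 h with ⟨h1, h2⟩ | ⟨h1, h2⟩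
    · exact Prod.ext h1 h2
    · dsimp only at h1
      exact absurd (h1 ▸ huv.1) huv'.2
  rw [weight, hcut, Finset.sum_image hinj, ← Finset.sum_product', ← Finset.sum_filter]
  refine Finset.sum_congr ?_ fun _ _ => rfl
  ext p
  simp

/-- The weight of a cut, as a fraction. -/
def cutFrac {n : ℕ} (x : Sym2 (Fin n) → ℚ) (U : Finset (Fin n)) : ℤ × ℤ :=
  fracSum (List.ofFn fun u => fracSum (List.ofFn fun v =>
    if u ∈ U ∧ v ∉ U then ((x s(u, v)).num, ((x s(u, v)).den : ℤ)) else (0, 1)))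

theorem cutFrac_spec {n : ℕ} (x : Sym2 (Fin n) → ℚ) (U : Finset (Fin n)) :
    0 < (cutFrac x U).2 ∧ ((cutFrac x U).1 : ℝ) / (cutFrac x U).2 =
      weight (fun e => (x e : ℝ)) (cut U) := by
  have hrow := fun u => fracSum_spec (l := List.ofFn fun v =>
    if u ∈ U ∧ v ∉ U then ((x s(u, v)).num, ((x s(u, v)).den : ℤ)) else (0, 1)) (by
      intro y hy
      obtain ⟨v, rfl⟩ := List.mem_ofFn.1 hy
      split_ifs
      · exact Int.natCast_pos.2 (x s(u, v)).den_pos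
      · exact one_pos)
  obtain ⟨h1, h2⟩ := fracSum_spec (l := List.ofFn fun u => fracSum (List.ofFn fun v =>
    if u ∈ U ∧ v ∉ U then ((x s(u, v)).num, ((x s(u, v)).den : ℤ)) else (0, 1))) (by
      intro y hy
      obtain ⟨u, rfl⟩ := List.mem_ofFn.1 hy
      exact (hrow u).1)
  refine ⟨h1, h2.trans ?_⟩
  rw [weight_cut_eq_sum, List.map_ofFn, List.sum_ofFn]
  refine Finset.sum_congr rfl fun u _ => ?_
  rw [Function.comp_apply, (hrow u).2, List.map_ofFn, List.sum_ofFn]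
  refine Finset.sum_congr rfl fun v _ => ?_
  rw [Function.comp_apply]
  split_ifs
  · rw [Rat.cast_def]
    norm_cast
  · simp

variable {ι : Type} {a : ι → Data} {n : ι → ℕ} {x : ∀ i, Sym2 (Fin (n i)) → ℚ}
  {s : ∀ i, Fin (n i)} {r j : ι → ℕ} {ε : ι → ℚ} {U : ∀ i, Finset (Fin (n i))}

theorem Comp.cutFrac (hx : Comp a fun i => .edgeVector (x i))
    (hU : Comp a fun i => .vertexSet (U i)) :
    Comp a fun i => .pair (.int (cutFrac (x i) (U i)).1) (.int (cutFrac (x i) (U i)).2) := by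
  have hn : Comp a fun i => .fins (n i) := hx.fins_of_ofFn
  refine Comp.fracSum ((hn.list_ofFn (g := fun i u => .pair
    (.int (PathTSP.fracSum (List.ofFn fun v => if u ∈ U i ∧ v ∉ U i then
      ((x i s(u, v)).num, ((x i s(u, v)).den : ℤ)) else (0, 1))).1)
    (.int (PathTSP.fracSum (List.ofFn fun v => if u ∈ U i ∧ v ∉ U i then
      ((x i s(u, v)).num, ((x i s(u, v)).den : ℤ)) else (0, 1))).2))
    fun φ u ha hu => Comp.fracSum (((hn.lift φ ha).list_ofFn (g := fun k v =>
      if u k ∈ U (φ k) ∧ v ∉ U (φ k) then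
        .rat (if u k = v then 0 else x (φ k) s(u k, v)) else .pair (.int 0) (.int 1))
      fun ψ v hc hv => ?_).congr fun i => ?_)).congr fun i => ?_)
  · have ha' := ha.lift ψ hc
    exact Comp.ite (((hU.lift _ ha').mem_vertexSet (hu.lift ψ hc)).and
      ((hU.lift _ ha').mem_vertexSet hv).not)
      (((hx.lift _ ha').ofFn_apply (hu.lift ψ hc)).ofFn_apply hv)
      ((Comp.const 0).pair (.const 1))
  · rw [List.map_ofFn]
    congr 2
    funext v
    rw [Function.comp_apply]
    -- The zero diagonal of the encoding is harmless, since no vertex is both in U and outside it.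
    split_ifs with h1 h2
    · rw [h2] at h1
      exact absurd h1.1 h1.2
    · rfl
    · rfl
  · rw [List.map_ofFn]
    rfl

/-- Multiplying by the positive denominators of the cut weight and of ε turns the real inequality
into one between integers. -/
theorem Decides.relevant (hx : Comp a fun i => .edgeVector (x i))
    (hε : Comp a fun i => .rat (ε i)) (hr : Comp a fun i => .int (r i))
    (hs : Comp a fun i => .int (s i : ℕ)) (hj : Comp a fun i => .int (j i))
    (hU : Comp a fun i => .vertexSet (U i)) :
    Decides a fun i => Relevant (s i) (r i) (fun e => (x i e : ℝ)) (ε i) (j i) (U i) := by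
  have hn : Comp a fun i => .fins (n i) := hx.fins_of_ofFn
  have hC := hx.cutFrac hU
  have hDB := hC.snd.mul hε.snd
  have hlt := (hj.mul hDB).lt (hr.mul ((((Comp.const 2).mul hDB).sub (hC.fst.mul hε.snd)).sub
    (hε.fst.mul hC.snd)))
  refine ((hU.mem_vertexSet hs).and ((Decides.forall_fin (P := fun i v => v ∈ U i) hn
    fun φ v ha hv => (hU.lift φ ha).mem_vertexSet hv).not.and hlt)).congr fun i => ?_
  obtain ⟨h1, h2⟩ := cutFrac_spec (x i) (U i)
  refine and_congr_right fun _ => and_congr (not_congr Finset.eq_univ_iff_forall.symm) ?_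
  rw [← h2, Rat.cast_def (ε i)]
  have hD : (0 : ℝ) < (PathTSP.cutFrac (x i) (U i)).2 := by exact_mod_cast h1
  have hB : (0 : ℝ) < (ε i).den := by exact_mod_cast (ε i).den_pos
  have key : (r i : ℝ) * (2 - (PathTSP.cutFrac (x i) (U i)).1 / (PathTSP.cutFrac (x i) (U i)).2 -
      (ε i).num / (ε i).den) = r i * (2 * ((PathTSP.cutFrac (x i) (U i)).2 * (ε i).den) -
      (PathTSP.cutFrac (x i) (U i)).1 * (ε i).den - (ε i).num * (PathTSP.cutFrac (x i) (U i)).2) /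
      ((PathTSP.cutFrac (x i) (U i)).2 * (ε i).den) := by
    field_simp
  rw [key, lt_div_iff₀ (mul_pos hD hB), ← @Int.cast_lt ℝ]
  push_cast
  rfl

end Main

end PathTSP

open PathTSP
theorem theorem4 :
    -- existence, for an arbitrary finite set of cities and real data
    (∀ (V : Type*) [Fintype V] [DecidableEq V] (s t : V) (r : ℕ) (S : Fin r → Finset (Sym2 V))
        (xstar : Sym2 V → ℝ) (ε : ℝ), IsInput s t S xstar ε →
        ∃ Shat : Fin r → Finset (Sym2 V), IsOutput S xstar ε Shat) ∧
    -- such trees can be computed in polynomial time from rational data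
    SolvableInPolyTime (β := fun I : Instance => Fin I.r → Finset (Sym2 (Fin I.n)))
      Instance.encode (fun _ Shat => Data.edgeSets Shat)
      (fun I => IsInput I.s I.t I.S (fun e => (I.xstar e : ℝ)) (I.ε : ℝ))
      (fun I Shat => IsOutput I.S (fun e => (I.xstar e : ℝ)) (I.ε : ℝ) Shat) := by
  refine ⟨fun V _ _ s t r S xstar ε h => ⟨_, isOutput_reassemble h
    (vs := Finset.univ.toList) (by simp)⟩, ?_⟩
  have hI : Comp Instance.encode fun I => .pair (.int I.n) (.pair (.int (I.s : ℕ))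
      (.pair (.int (I.t : ℕ)) (.pair (.edgeSets I.S) (.pair (.edgeVector I.xstar) (.rat I.ε))))) :=
    .refl
  have hs := hI.snd.fst
  have hS := hI.snd.snd.snd.fst
  have hx := hI.snd.snd.snd.snd.fst
  have hε := hI.snd.snd.snd.snd.snd
  -- The encoding does not contain r itself; it is recovered as the length of the list of trees.
  have hr : Comp Instance.encode fun I => .int I.r :=
    ((hS.fins_of_edgeSets.vertexSet (U := fun _ => Finset.univ) fun φ v _ _ =>
      Decides.true.congr fun _ => by simp).card).congr fun I => by simp
  have hn : Comp Instance.encode fun I => .fins I.n := hx.fins_of_ofFn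
  have h : Comp Instance.encode fun I => .edgeSets (reassemble (List.finRange I.n)
      (Relevant I.s I.r (fun e => (I.xstar e : ℝ)) (I.ε : ℝ)) I.s I.S) :=
    Comp.reassemble hn (fun φ j U ha hj hU => Decides.relevant (hx.lift φ ha) (hε.lift φ ha)
      (hr.lift φ ha) (hs.lift φ ha) hj hU) hs hS
  obtain ⟨p, m, hp, Q, hQ⟩ := h
  exact ⟨p, Q, fun I hI => ⟨_, m I, hp I, hQ I, isOutput_reassemble hI List.mem_finRange⟩⟩
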